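/- Let $d\in\mathbb N$ and $\mathbb H^d=\mathbb R^{2d}\times\mathbb R$, with points $(z,s)$, $z=(x,y)$, $x,y\in\mathbb R^d$, equipped with the Lebesgue measure; put $z\cdot_\sigma z'=x'\cdot y-x\cdot y'$ for $z=(x,y)$, $z'=(x',y')$. Let $X_i=\partial_{x_i}+y_i\partial_s$ and $Y_i=\partial_{y_i}-x_i\partial_s$ for $1\le i\le d$, let $L_0=\sum_{i=1}^d(X_i^2+Y_i^2)$ with domain $C_c^\infty(\mathbb H^d)\subset L^2(\mathbb H^d)=L^2(\mathbb H^d;\mathbb C)$, and let $L$ be the closure of $L_0$ in $L^2(\mathbb H^d)$. Let $c\in L^\infty(\mathbb H^d)$ be real-valued and let $L_c=\tfrac12L+c$, with domain $D(L_c)=D(L)$. Let $\mu_G$ be the standard Gaussian measure on $\mathbb R^{2d}$ and, for $\tau\ge0$ and a Schwartz function $\psi\colon\mathbb H^d\to\mathbb C$, let $$[S(\tau)\psi](z,s)=\int_{\mathbb R^{2d}}\psi\big(z+\sqrt\tau\,\zeta,\;s+\sqrt\tau\,z\cdot_\sigma\zeta\big)\,d\mu_G(\zeta)+\tau\,c(z,s)\,\psi(z,s).$$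 Then: (a) $L$ is self-adjoint, and there is exactly one strongly continuous semigroup $(e^{tL_c})_{t\ge0}$ of bounded operators on $L^2(\mathbb H^d)$ whose infinitesimal generator is $L_c$. (b) For every $\tau\ge0$ the map $S(\tau)$ extends uniquely to a bounded linear operator on $L^2(\mathbb H^d)$, still denoted by $S(\tau)$. (c) $S$ is a Chernoff function for $L_c$, that is, $$\lim_{n\to\infty}\ \sup_{t\in[0,T]}\big\|S(t/n)^n\psi-e^{tL_c}\psi\big\|_{L^2(\mathbb H^d)}=0\qquad\text{for all }\psi\in L^2(\mathbb H^d)\text{ and all }T>0.$$ -/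

import Mathlib

open MeasureTheory ProbabilityTheory Filter Topology
open scoped NNReal ENNReal ContDiff SchwartzMap

noncomputable section

/-! ### Strongly continuous semigroups, generators, Chernoff functions -/

/-- Strongly continuous one-parameter semigroups of bounded operators on a complex normed space. -/
structure IsC0Semigroup {B : Type*} [NormedAddCommGroup B] [NormedSpace ℂ B]
    (V : ℝ≥0 → B →L[ℂ] B) : Prop where
  map_zero : V 0 = ContinuousLinearMap.id ℂ B
  map_add : ∀ t s : ℝ≥0, V (t + s) = (V t).comp (V s)
  continuous_apply : ∀ x : B, Continuous fun t : ℝ≥0 => V t x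

/-- `A` is the infinitesimal generator of `V`: a vector `x` is in the domain of `A`, with
`A x = y`, exactly when `(V t x - x) / t` converges to `y` as `t → 0+`. -/
def IsGenerator {B : Type*} [NormedAddCommGroup B] [NormedSpace ℂ B]
    (A : B →ₗ.[ℂ] B) (V : ℝ≥0 → B →L[ℂ] B) : Prop :=
  ∀ x y : B, (x, y) ∈ A.graph ↔
    Tendsto (fun t : ℝ≥0 => (((t : ℝ) : ℂ)⁻¹) • (V t x - x)) (𝓝[>] 0) (𝓝 y)

/-- `S` is Chernoff equivalent to `V`: for every vector `x` and every `T > 0`,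
`sup_{t ∈ [0,T]} ‖S(t/n)^n x - V(t) x‖ → 0` as `n → ∞`. -/
def IsChernoffEquivalent {B : Type*} [NormedAddCommGroup B] [NormedSpace ℂ B]
    (S V : ℝ≥0 → B →L[ℂ] B) : Prop :=
  ∀ (x : B) (T : ℝ≥0), 0 < T →
    TendstoUniformlyOn (fun (n : ℕ) (t : ℝ≥0) => ((S (t / n)) ^ n) x) (fun t => V t x)
      atTop (Set.Icc 0 T)

/-! ### The Heisenberg group and its sub-Laplacian -/

/-- `ℝ^{2d}`, with points `z = (x, y)`. -/
abbrev HorizontalSpace (d : ℕ) : Type := (Fin d → ℝ) × (Fin d → ℝ)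

/-- The space `ℝ^{2d} × ℝ` underlying the `d`-th Heisenberg group, with points
`(z, s) = ((x, y), s)`. -/
abbrev Heisenberg (d : ℕ) : Type := HorizontalSpace d × ℝ

/-- The Lebesgue measure of `ℝ^{2d} × ℝ` is an additive Haar measure. -/
instance isAddHaarMeasure_volume_heisenberg (d : ℕ) :
    (volume : Measure (Heisenberg d)).IsAddHaarMeasure :=
  haveI : ((volume : Measure (Fin d → ℝ)).prod (volume : Measure (Fin d → ℝ))).IsAddHaarMeasure :=
    Measure.prod.instIsAddHaarMeasure _ _
  Measure.prod.instIsAddHaarMeasure _ _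

/-- The form `(x, y) ·_σ (x', y') = x' · y - x · y'` on `ℝ^{2d}`; the group law is
`(z, s) (z', s') = (z + z', s + s' + z ·_σ z')`. -/
def sigmaForm {d : ℕ} (z w : HorizontalSpace d) : ℝ :=
  w.1 ⬝ᵥ z.2 - z.1 ⬝ᵥ w.2

/-- The Hilbert space `L²(ℍ^d)` of complex functions, for the Lebesgue (Haar) measure. -/
abbrev L2Heis (d : ℕ) : Type := Lp ℂ 2 (volume : Measure (Heisenberg d))

/-- The left-invariant vector field `X_i = ∂_{x_i} + y_i ∂_s`, acting on functions. -/
def fieldX {d : ℕ} (i : Fin d) (f : Heisenberg d → ℂ) : Heisenberg d → ℂ := fun p =>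
  fderiv ℝ f p ((Pi.single i 1, 0), 0) + (p.1.2 i : ℂ) * fderiv ℝ f p ((0, 0), 1)

/-- The left-invariant vector field `Y_i = ∂_{y_i} - x_i ∂_s`, acting on functions. -/
def fieldY {d : ℕ} (i : Fin d) (f : Heisenberg d → ℂ) : Heisenberg d → ℂ := fun p =>
  fderiv ℝ f p ((0, Pi.single i 1), 0) - (p.1.1 i : ℂ) * fderiv ℝ f p ((0, 0), 1)

/-- The differential expression `∑ i, (X_i² + Y_i²)`. -/
def subLaplacianExpr {d : ℕ} (f : Heisenberg d → ℂ) : Heisenberg d → ℂ := fun p =>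
  ∑ i : Fin d, (fieldX i (fieldX i f) p + fieldY i (fieldY i f) p)

/-- The space `C_c^∞(ℍ^d)` of smooth compactly supported complex functions. -/
def testFunctions (d : ℕ) : Submodule ℂ (Heisenberg d → ℂ) where
  carrier := {f | ContDiff ℝ ∞ f ∧ HasCompactSupport f}
  add_mem' hf hg := ⟨hf.1.add hg.1, hf.2.add hg.2⟩
  zero_mem' := ⟨contDiff_const, HasCompactSupport.zero⟩
  smul_mem' a _ hf := ⟨contDiff_const.smul hf.1, hf.2.smul_left (f := fun _ => a)⟩

theorem fderiv_apply_mem_testFunctions {d : ℕ} {f : Heisenberg d → ℂ}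
    (hf : f ∈ testFunctions d) (v : Heisenberg d) :
    (fun p => fderiv ℝ f p v) ∈ testFunctions d :=
  ⟨(hf.1.fderiv_right (m := ∞) (by simp)).clm_apply contDiff_const, hf.2.fderiv_apply ℝ v⟩

theorem mul_mem_testFunctions {d : ℕ} {f : Heisenberg d → ℂ} (hf : f ∈ testFunctions d)
    {g : Heisenberg d → ℝ} (hg : ContDiff ℝ ∞ g) :
    (fun p => (g p : ℂ) * f p) ∈ testFunctions d :=
  ⟨(Complex.ofRealCLM.contDiff.comp hg).mul hf.1, hf.2.mul_left (f := fun p => (g p : ℂ))⟩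

theorem fieldX_mem_testFunctions {d : ℕ} (i : Fin d) {f : Heisenberg d → ℂ}
    (hf : f ∈ testFunctions d) : fieldX i f ∈ testFunctions d :=
  (testFunctions d).add_mem (fderiv_apply_mem_testFunctions hf _)
    (mul_mem_testFunctions (g := fun p => p.1.2 i) (fderiv_apply_mem_testFunctions hf _)
      (by fun_prop))

theorem fieldY_mem_testFunctions {d : ℕ} (i : Fin d) {f : Heisenberg d → ℂ}
    (hf : f ∈ testFunctions d) : fieldY i f ∈ testFunctions d :=
  (testFunctions d).sub_mem (fderiv_apply_mem_testFunctions hf _)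
    (mul_mem_testFunctions (g := fun p => p.1.1 i) (fderiv_apply_mem_testFunctions hf _)
      (by fun_prop))

theorem subLaplacianExpr_mem_testFunctions {d : ℕ} {f : Heisenberg d → ℂ}
    (hf : f ∈ testFunctions d) : subLaplacianExpr f ∈ testFunctions d := by
  have h : subLaplacianExpr f =
      ∑ i : Fin d, (fieldX i (fieldX i f) + fieldY i (fieldY i f)) := by
    funext p
    simp [subLaplacianExpr]
  rw [h]
  exact Submodule.sum_mem _ fun i _ => Submodule.add_mem _
    (fieldX_mem_testFunctions i (fieldX_mem_testFunctions i hf))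
    (fieldY_mem_testFunctions i (fieldY_mem_testFunctions i hf))

theorem differentiable_of_mem_testFunctions {d : ℕ} {f : Heisenberg d → ℂ}
    (hf : f ∈ testFunctions d) : Differentiable ℝ f :=
  hf.1.differentiable (by simp)

theorem fieldX_add {d : ℕ} (i : Fin d) {f g : Heisenberg d → ℂ}
    (hf : f ∈ testFunctions d) (hg : g ∈ testFunctions d) :
    fieldX i (f + g) = fieldX i f + fieldX i g := by
  funext p
  simp only [fieldX, Pi.add_apply, fderiv_add (differentiable_of_mem_testFunctions hf p)
    (differentiable_of_mem_testFunctions hg p), add_apply]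
  ring

theorem fieldY_add {d : ℕ} (i : Fin d) {f g : Heisenberg d → ℂ}
    (hf : f ∈ testFunctions d) (hg : g ∈ testFunctions d) :
    fieldY i (f + g) = fieldY i f + fieldY i g := by
  funext p
  simp only [fieldY, Pi.add_apply, fderiv_add (differentiable_of_mem_testFunctions hf p)
    (differentiable_of_mem_testFunctions hg p), add_apply]
  ring

theorem fieldX_smul {d : ℕ} (i : Fin d) (a : ℂ) {f : Heisenberg d → ℂ}
    (hf : f ∈ testFunctions d) : fieldX i (a • f) = a • fieldX i f := by
  funext p
  simp only [fieldX, Pi.smul_apply, smul_eq_mul,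
    fderiv_const_smul (differentiable_of_mem_testFunctions hf p), smul_apply]
  ring

theorem fieldY_smul {d : ℕ} (i : Fin d) (a : ℂ) {f : Heisenberg d → ℂ}
    (hf : f ∈ testFunctions d) : fieldY i (a • f) = a • fieldY i f := by
  funext p
  simp only [fieldY, Pi.smul_apply, smul_eq_mul,
    fderiv_const_smul (differentiable_of_mem_testFunctions hf p), smul_apply]
  ring

/-- The differential expression `∑ i, (X_i² + Y_i²)` as a linear map of `C_c^∞(ℍ^d)`. -/
def subLaplacianTest (d : ℕ) : testFunctions d →ₗ[ℂ] testFunctions d where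
  toFun f := ⟨subLaplacianExpr f.1, subLaplacianExpr_mem_testFunctions f.2⟩
  map_add' f g := by
    apply Subtype.ext
    funext p
    simp only [subLaplacianExpr, Submodule.coe_add, Pi.add_apply, ← Finset.sum_add_distrib]
    refine Finset.sum_congr rfl fun i _ => ?_
    rw [fieldX_add i f.2 g.2, fieldY_add i f.2 g.2,
      fieldX_add i (fieldX_mem_testFunctions i f.2) (fieldX_mem_testFunctions i g.2),
      fieldY_add i (fieldY_mem_testFunctions i f.2) (fieldY_mem_testFunctions i g.2)]
    simp only [Pi.add_apply]
    ring
  map_smul' a f := by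
    apply Subtype.ext
    funext p
    simp only [subLaplacianExpr, Submodule.coe_smul, Pi.smul_apply, Finset.smul_sum,
      RingHom.id_apply]
    refine Finset.sum_congr rfl fun i _ => ?_
    rw [fieldX_smul i a f.2, fieldY_smul i a f.2,
      fieldX_smul i a (fieldX_mem_testFunctions i f.2),
      fieldY_smul i a (fieldY_mem_testFunctions i f.2)]
    simp only [Pi.smul_apply, smul_add]

theorem memLp_of_mem_testFunctions {d : ℕ} {f : Heisenberg d → ℂ} (hf : f ∈ testFunctions d) :
    MemLp f 2 (volume : Measure (Heisenberg d)) :=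
  hf.1.continuous.memLp_of_hasCompactSupport hf.2

/-- The inclusion of `C_c^∞(ℍ^d)` in `L²(ℍ^d)`. -/
def testToL2 (d : ℕ) : testFunctions d →ₗ[ℂ] L2Heis d where
  toFun f := (memLp_of_mem_testFunctions f.2).toLp f.1
  map_add' f g := MemLp.toLp_add (memLp_of_mem_testFunctions f.2) (memLp_of_mem_testFunctions g.2)
  map_smul' a f := MemLp.toLp_const_smul a (memLp_of_mem_testFunctions f.2)

theorem testToL2_injective (d : ℕ) : Function.Injective (testToL2 d) := by
  intro f g h
  have h' : f.1 =ᵐ[volume] g.1 :=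
    (MemLp.toLp_eq_toLp_iff (memLp_of_mem_testFunctions f.2) (memLp_of_mem_testFunctions g.2)).1 h
  exact Subtype.ext ((Continuous.ae_eq_iff_eq volume f.2.1.continuous g.2.1.continuous).1 h')

/-- The operator `L₀ = ∑ i, (X_i² + Y_i²)` in `L²(ℍ^d)`, with domain `C_c^∞(ℍ^d)`. -/
def subLaplacianCore (d : ℕ) : L2Heis d →ₗ.[ℂ] L2Heis d where
  domain := LinearMap.range (testToL2 d)
  toFun := (testToL2 d ∘ₗ subLaplacianTest d) ∘ₗ
    (LinearEquiv.ofInjective (testToL2 d) (testToL2_injective d)).symm.toLinearMap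

/-- The sub-Laplacian `L` of `L²(ℍ^d)`: the closure of `L₀`. -/
def subLaplacian (d : ℕ) : L2Heis d →ₗ.[ℂ] L2Heis d := (subLaplacianCore d).closure

/-- Multiplication by an essentially bounded real function `c`, as an operator on `L²(ℍ^d)`. -/
def mulOp {d : ℕ} {c : Heisenberg d → ℝ} (hc : MemLp c ∞ volume) : L2Heis d →ₗ[ℂ] L2Heis d where
  toFun f := MemLp.toLp (fun p => (c p : ℂ) * f p)
    ((Lp.memLp f).mul (p := ∞) (q := 2) (r := 2) (hc.ofReal (K := ℂ)))
  map_add' f g := by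
    rw [← MemLp.toLp_add, MemLp.toLp_eq_toLp_iff]
    filter_upwards [Lp.coeFn_add f g] with p hp
    rw [hp]
    simp only [Pi.add_apply]
    ring
  map_smul' a f := by
    rw [RingHom.id_apply, ← MemLp.toLp_const_smul, MemLp.toLp_eq_toLp_iff]
    filter_upwards [Lp.coeFn_smul a f] with p hp
    rw [hp]
    simp only [Pi.smul_apply, smul_eq_mul]
    ring

/-- The operator `L_c = L / 2 + c`, with domain the domain of `L`. -/
def heatOperator {d : ℕ} {c : Heisenberg d → ℝ} (hc : MemLp c ∞ volume) :
    L2Heis d →ₗ.[ℂ] L2Heis d :=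
  mulOp hc +ᵥ ((1 / 2 : ℂ) • subLaplacian d)

/-! ### The Gaussian averages -/

/-- The standard Gaussian measure of `ℝ^{2d}`, the product of `2d` standard normal laws. -/
def stdGauss (d : ℕ) : Measure (HorizontalSpace d) :=
  (Measure.pi fun _ : Fin d => gaussianReal 0 1).prod (Measure.pi fun _ : Fin d => gaussianReal 0 1)

/-- `∫ ψ(z + √τ ζ, s + √τ z ·_σ ζ) dμ_G(ζ) + τ c(z, s) ψ(z, s)`. -/
def gaussAverage {d : ℕ} (c : Heisenberg d → ℝ) (τ : ℝ≥0) (ψ : Heisenberg d → ℂ) :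
    Heisenberg d → ℂ := fun p =>
  (∫ ζ, ψ (p.1 + √(τ : ℝ) • ζ, p.2 + √(τ : ℝ) * sigmaForm p.1 ζ) ∂(stdGauss d)) +
    ((τ : ℝ) : ℂ) * (c p : ℂ) * ψ p

/-- The bounded operator `T` on `L²(ℍ^d)` extends `ψ ↦ gaussAverage c τ ψ`, a map defined for
Schwartz functions `ψ`. -/
def ExtendsGaussAverage {d : ℕ} (c : Heisenberg d → ℝ) (τ : ℝ≥0)
    (T : L2Heis d →L[ℂ] L2Heis d) : Prop :=
  ∀ ψ : 𝓢(Heisenberg d, ℂ), T (ψ.toLp 2 volume) =ᵐ[volume] gaussAverage c τ ψ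

end

/-! The heart of (a) is that λ - L₀ has dense range for every λ > 0
(`dense_range_sub_subLaplacianCore`). A vector u orthogonal to that range is an L² weak solution of
Lu = λu. Since L is left-invariant, convolving u on the left with a test function gives again an L²
weak solution v, now smooth, so no hypoelliptic regularity is needed. Testing the equation of v
against χ²v gives λ∫χ²|v|² ≤ Σ∫|X_jχ|²|v|² over all horizontal basis fields (`caccioppoli`). For
cutoffs rescaled by the homogeneous dilations the right side tends to 0, hence v = 0, and varying
the mollifier gives u = 0. As L is symmetric and nonpositive, it is self-adjoint. Adding the bounded
symmetric c keeps this, and L_c is bounded above by κ = ‖c‖_∞. Its resolvent R at κ + 1 satisfies 0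
≤ R ≤ 1, and the semigroup is f_t(R) with f_t(r) = exp(t(κ + 1 - 1/r)), by continuous functional
calculus (`exists_semigroup_of_resolvent`).

For (b), the Gaussian term averages the right translations p ↦ p(√τζ, 0), which preserve Lebesgue
measure. It is therefore an L² contraction (`exists_heat_contraction`), and ‖S(τ)‖ ≤ 1 + κτ.

For (c), Chernoff's theorem (`isChernoffEquivalent_of_core`) asks only for this bound and for the
derivative of S at 0 on a core. It is proved by comparing R with the resolvents of (S(τ) - 1)/τ and
telescoping. On a test function f one expands f(p(√τζ, 0)) to second order along a straight line:
the linear term has Gaussian mean 0, the quadratic term has mean (τ/2)Lf, and the remainder is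
O(τ^{3/2}) in L² (`exists_norm_heat_sub_le`).

Uniqueness of the semigroup in (a) comes last: any semigroup generated by L_c is the limit of the
same iterates S(t/n)^n. -/

open scoped ComplexConjugate

/-! ### Strong convergence of operators -/

section Chernoff

variable {B : Type*} [NormedAddCommGroup B] [NormedSpace ℂ B]

theorem tendsto_zero_of_dense {ι : Type*} {l : Filter ι} {T : ι → B →L[ℂ] B} {M : ℝ}
    (hM : ∀ᶠ i in l, ‖T i‖ ≤ M) {s : Set B} (hs : Dense s)
    (h : ∀ x ∈ s, Tendsto (fun i => T i x) l (𝓝 0)) (x : B) :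
    Tendsto (fun i => T i x) l (𝓝 0) := by
  rw [NormedAddGroup.tendsto_nhds_zero]
  intro ε hε
  have hM' : 0 < |M| + 1 := by positivity
  obtain ⟨y, hy, hxy⟩ := hs.exists_dist_lt x (ε := ε / 2 / (|M| + 1)) (by positivity)
  filter_upwards [hM, (NormedAddGroup.tendsto_nhds_zero.1 (h y hy)) (ε / 2) (by positivity)]
    with i hi hiy
  have h1 : ‖T i (x - y)‖ ≤ (|M| + 1) * (ε / 2 / (|M| + 1)) := by
    refine (T i).le_opNorm _ |>.trans ?_
    rw [dist_eq_norm] at hxy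
    gcongr
    linarith [le_abs_self M]
  rw [mul_div_cancel₀ _ hM'.ne'] at h1
  calc ‖T i x‖ = ‖T i (x - y) + T i y‖ := by rw [← map_add, sub_add_cancel]
    _ ≤ ‖T i (x - y)‖ + ‖T i y‖ := norm_add_le _ _
    _ < ε := by linarith

/-- A finite net of K reduces uniformity to finitely many points. It is applied to orbits of the
semigroup over [0, T]. -/
theorem tendsto_zero_on_compact {ι : Type*} {l : Filter ι} {T : ι → B →L[ℂ] B} {M : ℝ}
    (hM : ∀ᶠ i in l, ‖T i‖ ≤ M) (h : ∀ x, Tendsto (fun i => T i x) l (𝓝 0))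
    {K : Set B} (hK : IsCompact K) {ε : ℝ} (hε : 0 < ε) :
    ∀ᶠ i in l, ∀ x ∈ K, ‖T i x‖ ≤ ε := by
  have hM' : 0 < |M| + 1 := by positivity
  obtain ⟨t, -, htf, hKt⟩ := hK.finite_cover_balls (e := ε / 2 / (|M| + 1)) (by positivity)
  have h1 : ∀ᶠ i in l, ∀ y ∈ t, ‖T i y‖ < ε / 2 := by
    rw [eventually_all_finite htf]
    exact fun y _ => (NormedAddGroup.tendsto_nhds_zero.1 (h y)) (ε / 2) (by positivity)
  filter_upwards [hM, h1] with i hi hit x hx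
  obtain ⟨y, hy, hxy⟩ := Set.mem_iUnion₂.1 (hKt hx)
  have h1 : ‖T i (x - y)‖ ≤ (|M| + 1) * (ε / 2 / (|M| + 1)) := by
    refine (T i).le_opNorm _ |>.trans ?_
    rw [mem_ball_iff_norm] at hxy
    gcongr
    linarith [le_abs_self M]
  rw [mul_div_cancel₀ _ hM'.ne'] at h1
  calc ‖T i x‖ = ‖T i (x - y) + T i y‖ := by rw [← map_add, sub_add_cancel]
    _ ≤ ‖T i (x - y)‖ + ‖T i y‖ := norm_add_le _ _
    _ ≤ ε := by linarith [hit y hy]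

/-! ### Chernoff's theorem -/

/-- The resolvent of `(S - 1) / τ`, for an operator `S` of norm at most `1 + κ τ`. -/
theorem exists_resolvent_difference_quotient [CompleteSpace B] {S : B →L[ℂ] B} {κ lam τ : ℝ}
    (hκ : 0 ≤ κ) (hlam : κ < lam) (hτ : 0 < τ) (hS : ‖S‖ ≤ 1 + κ * τ) :
    ∃ Q : B →L[ℂ] B, (∀ x, S (Q x) = Q x + (τ : ℂ) • ((lam : ℂ) • Q x - x)) ∧
      (∀ x, Q (S x) = Q x + (τ : ℂ) • ((lam : ℂ) • Q x - x)) ∧ ‖Q‖ ≤ 1 / (lam - κ) := by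
  have hk : ‖((1 + lam * τ : ℝ) : ℂ)‖ = 1 + lam * τ := by
    rw [Complex.norm_real, Real.norm_of_nonneg]
    have := mul_pos (hκ.trans_lt hlam) hτ
    linarith
  have hlt : κ * τ < lam * τ := by gcongr
  have hmem : ((1 + lam * τ : ℝ) : ℂ) ∈ resolventSet ℂ S := by
    apply spectrum.mem_resolventSet_of_norm_lt_mul
    rw [hk]
    calc ‖S‖ * ‖(1 : B →L[ℂ] B)‖ ≤ ‖S‖ * 1 := by
          gcongr; exact ContinuousLinearMap.norm_id_le
      _ < 1 + lam * τ := by linarith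
  obtain ⟨U, hU⟩ := (spectrum.mem_resolventSet_iff.1 hmem)
  have h1 : ∀ x, U.val x = ((1 + lam * τ : ℝ) : ℂ) • x - S x := fun x => by
    rw [hU, Algebra.algebraMap_eq_smul_one]; rfl
  have h2 : ∀ x, U.val (U⁻¹.val x) = x := fun x => DFunLike.congr_fun U.mul_inv x
  have h3 : ∀ x, U⁻¹.val (U.val x) = x := fun x => DFunLike.congr_fun U.inv_mul x
  have hd : 0 < (lam - κ) * τ := mul_pos (sub_pos.2 hlam) hτ
  -- Q = τ(1 + λτ - S)⁻¹ = (λ - (S - 1)/τ)⁻¹; the inverse exists because ‖S‖ ≤ 1 + κτ < 1 + λτ.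
  refine ⟨(τ : ℂ) • U⁻¹.val, fun x => ?_, fun x => ?_, ?_⟩
  · have := h2 x
    rw [h1] at this
    simp only [smul_apply, map_smul]
    have h5 : S (U⁻¹.val x) = ((1 + lam * τ : ℝ) : ℂ) • U⁻¹.val x - x := by
      exact eq_sub_of_add_eq (add_comm _ _ |>.trans (sub_eq_iff_eq_add.1 this).symm)
    rw [h5]
    push_cast
    module
  · have := h3 x
    rw [h1, map_sub, map_smul] at this
    simp only [smul_apply]
    have h5 : U⁻¹.val (S x) = ((1 + lam * τ : ℝ) : ℂ) • U⁻¹.val x - x := by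
      exact eq_sub_of_add_eq (add_comm _ _ |>.trans (sub_eq_iff_eq_add.1 this).symm)
    rw [h5]
    push_cast
    module
  · refine ContinuousLinearMap.opNorm_le_bound _ (by have := sub_pos.2 hlam; positivity) fun x => ?_
    rw [smul_apply, norm_smul, Complex.norm_real, Real.norm_of_nonneg hτ.le]
    set y := U⁻¹.val x with hy
    have h5 : (1 + lam * τ) * ‖y‖ - (1 + κ * τ) * ‖y‖ ≤ ‖x‖ := by
      rw [← h2 x, ← hy, h1]
      refine le_trans ?_ (norm_sub_norm_le _ _)
      rw [norm_smul, hk]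
      have : ‖S y‖ ≤ (1 + κ * τ) * ‖y‖ := S.le_of_opNorm_le hS y
      linarith
    rw [div_mul_eq_mul_div, one_mul, le_div_iff₀ (sub_pos.2 hlam)]
    linarith

theorem IsC0Semigroup.exists_bound [CompleteSpace B] {V : ℝ≥0 → B →L[ℂ] B}
    (hV : IsC0Semigroup V) (T : ℝ≥0) : ∃ M, 0 ≤ M ∧ ∀ t ∈ Set.Icc 0 T, ‖V t‖ ≤ M := by
  obtain ⟨M, hM⟩ := banach_steinhaus (g := fun t : Set.Icc (0 : ℝ≥0) T => V t) fun x => by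
    obtain ⟨C, hC⟩ := isCompact_Icc.exists_bound_of_continuousOn
      (hV.continuous_apply x).continuousOn (s := Set.Icc 0 T)
    exact ⟨C, fun t => hC t t.2⟩
  exact ⟨M, (norm_nonneg _).trans (hM ⟨0, by simp⟩), fun t ht => hM ⟨t, ht⟩⟩

theorem IsC0Semigroup.comm {V : ℝ≥0 → B →L[ℂ] B} (hV : IsC0Semigroup V) (t s : ℝ≥0) (x : B) :
    V t (V s x) = V s (V t x) := by
  rw [← ContinuousLinearMap.comp_apply, ← hV.map_add, add_comm, hV.map_add,
    ContinuousLinearMap.comp_apply]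

/-- V t commutes with the difference quotients of V, so it maps the graph of A to itself and carries
the resolvent equation at x to the one at V t x. -/
theorem IsC0Semigroup.comm_resolvent {V : ℝ≥0 → B →L[ℂ] B} (hV : IsC0Semigroup V)
    {A : B →ₗ.[ℂ] B} (hA : IsGenerator A V) {lam : ℝ} {R : B →L[ℂ] B}
    (hR : ∀ x y, (x, y) ∈ A.graph ↔ R ((lam : ℂ) • x - y) = x) (t : ℝ≥0) (x : B) :
    V t (R x) = R (V t x) := by
  have h1 : (R x, (lam : ℂ) • R x - x) ∈ A.graph := by rw [hR]; congr 1; abel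
  have h2 : (V t (R x), V t ((lam : ℂ) • R x - x)) ∈ A.graph := by
    rw [hA]
    refine (((V t).continuous.tendsto _).comp ((hA _ _).1 h1)).congr fun s => ?_
    simp only [Function.comp, map_smul, map_sub, hV.comm t s]
  rw [hR] at h2
  rw [← h2, map_sub (V t), map_smul]
  congr 1
  abel

/-- The discrete Duhamel estimate behind Chernoff's theorem, with `Q` the resolvent of
`(S - 1) / τ`. -/
theorem norm_pow_resolvent_sub_le {V : ℝ≥0 → B →L[ℂ] B} (hV : IsC0Semigroup V)
    {A : B →ₗ.[ℂ] B} (hA : IsGenerator A V) {κ lam : ℝ} (hκ : 0 ≤ κ) {R : B →L[ℂ] B}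
    (hR : ∀ x y, (x, y) ∈ A.graph ↔ R ((lam : ℂ) • x - y) = x) {S Q : B →L[ℂ] B} {τ : ℝ≥0}
    (hτ : 0 < τ) (hS : ‖S‖ ≤ 1 + κ * τ)
    (hQ : ∀ x, S (Q x) = Q x + ((τ : ℝ) : ℂ) • ((lam : ℂ) • Q x - x)) {T : ℝ≥0} {M C η₁ η₂ : ℝ}
    (hM0 : 0 ≤ M) (hM : ∀ t ∈ Set.Icc 0 T, ‖V t‖ ≤ M) (hC : ‖Q‖ ≤ C) (hη₂ : 0 ≤ η₂) (x : B)
    (h1 : ∀ t ∈ Set.Icc 0 T, ‖Q (V t x) - R (V t x)‖ ≤ η₁)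
    (h2 : ‖(((τ : ℝ) : ℂ)⁻¹) • (V τ (R x) - R x) - ((lam : ℂ) • R x - x)‖ ≤ η₂) (n : ℕ)
    (hn : n * τ ≤ T) :
    ‖(S ^ n) (Q (R x)) - Q (V (n * τ) (R x))‖ ≤ n * τ * (1 + κ * τ) ^ n * (η₁ + C * M * η₂) := by
  have hC0 : 0 ≤ C := (norm_nonneg _).trans hC
  have hη₁ : 0 ≤ η₁ := (norm_nonneg _).trans (h1 0 (by simp))
  have hτ' : ((τ : ℝ) : ℂ) ≠ 0 := by exact_mod_cast hτ.ne'
  have hg : (1 : ℝ) ≤ 1 + κ * τ := le_add_of_nonneg_right (by positivity)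
  induction n with
  | zero => simp [hV.map_zero]
  | succ n ih =>
    have hn' : n * τ ≤ T := le_trans (by gcongr; simp) hn
    have hnm : n * τ ∈ Set.Icc 0 T := ⟨zero_le, hn'⟩
    set e := (((τ : ℝ) : ℂ)⁻¹) • (V τ (R x) - R x) - ((lam : ℂ) • R x - x) with he
    set w := V (n * τ) x with hw
    have hVe : V τ (R x) = R x + ((τ : ℝ) : ℂ) • ((lam : ℂ) • R x - x + e) := by
      rw [he, add_sub_cancel, smul_smul, mul_inv_cancel₀ hτ', one_smul, add_sub_cancel]
    have hVs : V ((n + 1 : ℕ) * τ) (R x) = R w + ((τ : ℝ) : ℂ) • ((lam : ℂ) • R w - w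
        + V (n * τ) e) := by
      rw [Nat.cast_add, Nat.cast_one, add_mul, one_mul, hV.map_add, ContinuousLinearMap.comp_apply,
        hVe]
      simp only [map_add, map_smul, map_sub, hV.comm_resolvent hA hR, hw]
    clear_value e
    -- One step of the telescoping. By `hQ`, S - 1 acts on Q(Rw) as τ(λQ - 1)R, while V τ - 1 acts
    -- on the orbit of Rx as τ(λR - 1) up to the consistency error e. After applying Q the λ-terms
    -- cancel and only (Q - R)w and the error remain.
    have key : (S ^ (n + 1)) (Q (R x)) - Q (V ((n + 1 : ℕ) * τ) (R x)) =
        S ((S ^ n) (Q (R x)) - Q (V (n * τ) (R x))) +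
          ((τ : ℝ) : ℂ) • ((Q w - R w) - Q (V (n * τ) e)) := by
      rw [hVs, hV.comm_resolvent hA hR (n * τ) x, ← hw, map_sub, pow_succ', mul_apply_eq_comp]
      simp only [map_add, map_smul, map_sub, hQ (R w)]
      module
    rw [key]
    have hb1 := S.le_of_opNorm_le_of_le hS (ih hn')
    have hb2 : ‖Q (V (n * τ) e)‖ ≤ C * M * η₂ := by
      rw [mul_assoc]
      exact Q.le_of_opNorm_le_of_le hC ((V _).le_of_opNorm_le_of_le (hM _ hnm) h2)
    have hb3 : ‖((τ : ℝ) : ℂ) • ((Q w - R w) - Q (V (n * τ) e))‖ ≤ τ * (η₁ + C * M * η₂) := by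
      rw [norm_smul, Complex.norm_real, Real.norm_of_nonneg τ.coe_nonneg]
      gcongr
      exact (norm_sub_le _ _).trans (add_le_add (h1 _ hnm) hb2)
    refine (norm_add_le _ _).trans ((add_le_add hb1 hb3).trans ?_)
    have h5 : (τ : ℝ) * (η₁ + C * M * η₂) ≤ τ * (1 + κ * τ) ^ (n + 1) * (η₁ + C * M * η₂) := by
      have : (1 : ℝ) ≤ (1 + κ * τ) ^ (n + 1) := one_le_pow₀ hg
      gcongr
      exact le_mul_of_one_le_right τ.2 this
    push_cast
    refine (add_le_add le_rfl h5).trans (le_of_eq ?_)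
    ring

/-- The density of (λ - A)D is the form in which D is a core. It yields strong convergence of the
resolvents Q τ to R, which is uniform on the compact orbits of V; this makes the errors in
`norm_pow_resolvent_sub_le` small uniformly over [0, T]. -/
theorem isChernoffEquivalent_of_core [CompleteSpace B] {S V : ℝ≥0 → B →L[ℂ] B}
    (hV : IsC0Semigroup V) {A : B →ₗ.[ℂ] B} (hA : IsGenerator A V) {κ lam : ℝ} (hκ : 0 ≤ κ)
    (hlam : κ < lam) {R : B →L[ℂ] B}
    (hR : ∀ x y, (x, y) ∈ A.graph ↔ R ((lam : ℂ) • x - y) = x) (hRd : DenseRange R)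
    (hS0 : S 0 = 1) (hS : ∀ τ, ‖S τ‖ ≤ 1 + κ * τ) {D : Set (B × B)} (hDA : D ⊆ A.graph)
    (hD : ∀ p ∈ D, Tendsto (fun τ : ℝ≥0 => (((τ : ℝ) : ℂ)⁻¹) • (S τ p.1 - p.1)) (𝓝[>] 0) (𝓝 p.2))
    (hDd : Dense ((fun p : B × B => (lam : ℂ) • p.1 - p.2) '' D)) :
    IsChernoffEquivalent S V := by
  have hQex : ∀ τ : ℝ≥0, ∃ Q : B →L[ℂ] B, 0 < τ →
      (∀ x, S τ (Q x) = Q x + ((τ : ℝ) : ℂ) • ((lam : ℂ) • Q x - x)) ∧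
      (∀ x, Q (S τ x) = Q x + ((τ : ℝ) : ℂ) • ((lam : ℂ) • Q x - x)) ∧ ‖Q‖ ≤ 1 / (lam - κ) := by
    intro τ
    by_cases hτ : 0 < τ
    · obtain ⟨Q, hQ⟩ := exists_resolvent_difference_quotient hκ hlam (NNReal.coe_pos.2 hτ) (hS τ)
      exact ⟨Q, fun _ => hQ⟩
    · exact ⟨0, fun h => absurd h hτ⟩
  choose Q hQ using hQex
  set C := 1 / (lam - κ) with hC
  have hC0 : 0 ≤ C := by have := sub_pos.2 hlam; positivity
  have hpos : ∀ᶠ τ : ℝ≥0 in 𝓝[>] 0, 0 < τ := self_mem_nhdsWithin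
  have hbound : ∀ᶠ τ in 𝓝[>] (0 : ℝ≥0), ‖Q τ - R‖ ≤ C + ‖R‖ := by
    filter_upwards [hpos] with τ hτ
    exact (norm_sub_le _ _).trans (add_le_add (hQ τ hτ).2.2 le_rfl)
  -- Since Q τ inverts λ - (S τ - 1)/τ and R(λx - y) = x, one has (Q τ - R)(λx - y) = Q τ((S τ x -
  -- x)/τ - y), and the argument of Q τ tends to 0 on D.
  have hQR : ∀ x, Tendsto (fun τ => (Q τ - R) x) (𝓝[>] 0) (𝓝 0) := by
    refine tendsto_zero_of_dense hbound hDd ?_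
    rintro _ ⟨⟨x, y⟩, hp, rfl⟩
    have h1 := hD _ hp
    have h2 : R ((lam : ℂ) • x - y) = x := (hR x y).1 (hDA hp)
    have h3 : Tendsto (fun τ : ℝ≥0 => C * ‖(((τ : ℝ) : ℂ)⁻¹) • (S τ x - x) - y‖) (𝓝[>] 0) (𝓝 0) := by
      have := ((tendsto_iff_norm_sub_tendsto_zero.1 h1).const_mul C)
      simpa using this
    refine squeeze_zero_norm' ?_ h3
    filter_upwards [hpos] with τ hτ
    obtain ⟨-, h4, h5⟩ := hQ τ hτ
    have hτ' : ((τ : ℝ) : ℂ) ≠ 0 := by exact_mod_cast hτ.ne'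
    have h6 : x = Q τ ((lam : ℂ) • x - (((τ : ℝ) : ℂ)⁻¹) • (S τ x - x)) := by
      rw [map_sub, map_smul, map_smul, map_sub, h4, add_sub_cancel_left, smul_smul,
        inv_mul_cancel₀ hτ', one_smul]
      abel
    have h7 : (Q τ - R) ((lam : ℂ) • x - y) = Q τ ((((τ : ℝ) : ℂ)⁻¹) • (S τ x - x) - y) := by
      rw [sub_apply, h2]
      nth_rewrite 2 [h6]
      rw [← map_sub]
      congr 1
      abel
    simp only [h7]
    exact (Q τ).le_of_opNorm_le h5 _
  intro x T hT
  obtain ⟨M, hM0, hM⟩ := hV.exists_bound T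
  have hgrowth : ∀ (n : ℕ) (τ : ℝ≥0), n * τ ≤ T → (1 + κ * τ) ^ n ≤ Real.exp (κ * T) := by
    intro n τ h
    have h1 : 1 + κ * τ ≤ Real.exp (κ * τ) := by linarith [Real.add_one_le_exp (κ * τ)]
    calc (1 + κ * τ) ^ n ≤ Real.exp (κ * τ) ^ n := by gcongr
      _ = Real.exp (κ * (n * τ)) := by rw [← Real.exp_nat_mul]; ring_nf
      _ ≤ _ := by
        gcongr
        exact_mod_cast h
  have hpow : ∀ (n : ℕ) (τ : ℝ≥0), n * τ ≤ T → ‖S τ ^ n‖ ≤ Real.exp (κ * T) := by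
    intro n τ h
    rcases n.eq_zero_or_pos with rfl | hn
    · rw [pow_zero]
      exact ContinuousLinearMap.norm_id_le.trans (Real.one_le_exp (by positivity))
    · exact (norm_pow_le' _ hn).trans ((by gcongr; exact hS τ : ‖S τ‖ ^ n ≤ (1 + κ * τ) ^ n).trans
        (hgrowth n τ h))
  have hquot : Tendsto (fun i : ℕ × ℝ≥0 => i.2 / i.1) (atTop ×ˢ 𝓟 (Set.Icc 0 T)) (𝓝 0) := by
    have h1 : Tendsto (fun i : ℕ × ℝ≥0 => T / i.1) (atTop ×ˢ 𝓟 (Set.Icc 0 T)) (𝓝 0) :=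
      (tendsto_const_div_atTop_nhds_zero_nat T).comp tendsto_fst
    refine tendsto_of_tendsto_of_tendsto_of_le_of_le' tendsto_const_nhds h1
      (Eventually.of_forall fun i => zero_le) ?_
    filter_upwards [tendsto_snd (mem_principal_self (Set.Icc 0 T))] with i hi
    have : i.2 ≤ T := hi.2
    gcongr
  have hev : ∀ᶠ i : ℕ × ℝ≥0 in atTop ×ˢ 𝓟 (Set.Icc 0 T), i.2 ∈ Set.Icc 0 T ∧ 0 < i.1 := by
    filter_upwards [tendsto_snd (mem_principal_self (Set.Icc 0 T)),
      tendsto_fst (eventually_gt_atTop 0)] with i hi h0 using ⟨hi, h0⟩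
  have hmul : ∀ i : ℕ × ℝ≥0, 0 < i.1 → i.1 * (i.2 / i.1) = i.2 := fun i hi =>
    mul_div_cancel₀ _ (by positivity)
  -- Uniformity in t is encoded by letting the pair (n, t) vary, with n → ∞ and t free in [0, T];
  -- along this filter t/n → 0.
  suffices H : ∀ x, Tendsto (fun i : ℕ × ℝ≥0 => (S (i.2 / i.1) ^ i.1 - V i.2) x)
      (atTop ×ˢ 𝓟 (Set.Icc 0 T)) (𝓝 0) by
    rw [tendstoUniformlyOn_iff_tendsto, tendsto_uniformity_iff_dist_tendsto_zero]
    refine (tendsto_zero_iff_norm_tendsto_zero.1 (H x)).congr fun i => ?_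
    rw [dist_comm, dist_eq_norm, sub_apply]
  -- It suffices to treat vectors R(Rx). The outer R is the one replaced by Q τ, and the inner one
  -- places Rx in the domain of A, where V is differentiable.
  refine tendsto_zero_of_dense (M := Real.exp (κ * T) + M) ?_
    (hRd.comp hRd R.continuous) ?_
  · filter_upwards [hev] with i hi
    refine (norm_sub_le _ _).trans (add_le_add (hpow _ _ ?_) (hM _ hi.1))
    rw [hmul i hi.2]
    exact hi.1.2
  rintro _ ⟨x, rfl⟩
  simp only [Function.comp]
  rw [NormedAddGroup.tendsto_nhds_zero]
  intro ε hε
  have hK : ∀ x : B, IsCompact ((fun t => V t x) '' Set.Icc 0 T) := fun x =>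
    isCompact_Icc.image (hV.continuous_apply x)
  set E := Real.exp (κ * T) with hE
  have hE0 : 0 < E := Real.exp_pos _
  obtain ⟨η, hη, hηε⟩ : ∃ η : ℝ, 0 < η ∧ (T * E * (1 + C * M) + E + 1) * η < ε := by
    refine ⟨ε / 2 / (T * E * (1 + C * M) + E + 1), by positivity, ?_⟩
    rw [mul_div_cancel₀ _ (by positivity)]
    linarith
  have hgen : ∀ᶠ τ : ℝ≥0 in 𝓝[>] 0,
      ‖(((τ : ℝ) : ℂ)⁻¹) • (V τ (R x) - R x) - ((lam : ℂ) • R x - x)‖ < η := by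
    have h1 : (R x, (lam : ℂ) • R x - x) ∈ A.graph := by rw [hR]; congr 1; abel
    have h2 := tendsto_iff_norm_sub_tendsto_zero.1 ((hA _ _).1 h1)
    exact h2.eventually (gt_mem_nhds hη)
  have hall := (hgen.and ((tendsto_zero_on_compact hbound hQR (hK x) hη).and
    (tendsto_zero_on_compact hbound hQR (hK (R x)) hη))).and hpos
  rw [eventually_nhdsWithin_iff] at hall
  filter_upwards [hquot.eventually hall, hev] with i hi ⟨hiT, hi0⟩
  obtain ⟨n, t⟩ := i
  simp only at hi hiT hi0 ⊢
  -- The resolvent limits are taken along τ > 0, so t = 0 is settled separately from S 0 = 1.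
  rcases eq_or_lt_of_le (zero_le : 0 ≤ t) with rfl | ht
  · simp [hS0, hV.map_zero, hε]
  have hτ : 0 < t / n := by positivity
  have hnt : n * (t / n) = t := hmul (n, t) hi0
  obtain ⟨⟨h1, h2, h3⟩, -⟩ := hi hτ
  set τ := t / n
  have hmain := norm_pow_resolvent_sub_le hV hA hκ hR hτ (hS τ) (hQ τ hτ).1 hM0 hM (hQ τ hτ).2.2
    hη.le x (η₁ := η) (fun s hs => h2 _ ⟨s, hs, rfl⟩) h1.le n (hnt.le.trans hiT.2)
  rw [hnt] at hmain
  have hsplit : (S τ ^ n - V t) (R (R x)) = (S τ ^ n) (-((Q τ - R) (R x))) +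
      ((S τ ^ n) (Q τ (R x)) - Q τ (V t (R x))) + (Q τ - R) (V t (R x)) := by
    simp only [sub_apply, hV.comm_resolvent hA hR t (R x), map_neg, map_sub]
    abel
  rw [hsplit]
  have hb1 : ‖(S τ ^ n) (-((Q τ - R) (R x)))‖ ≤ E * η := by
    refine (S τ ^ n).le_of_opNorm_le_of_le (hpow n τ (hnt.le.trans hiT.2)) ?_
    rw [norm_neg]
    exact h3 _ ⟨0, by simp, by simp [hV.map_zero]⟩
  have hb2 : ‖(S τ ^ n) (Q τ (R x)) - Q τ (V t (R x))‖ ≤ T * E * (1 + C * M) * η := by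
    refine hmain.trans ?_
    have h4 : (n : ℝ) * τ ≤ T := by exact_mod_cast hnt.le.trans hiT.2
    have h5 := hgrowth n τ (hnt.le.trans hiT.2)
    calc n * τ * (1 + κ * τ) ^ n * (η + C * M * η) ≤ T * E * (η + C * M * η) := by gcongr
      _ = _ := by ring
  have hb3 : ‖(Q τ - R) (V t (R x))‖ ≤ η := h3 _ ⟨t, hiT, rfl⟩
  calc _ ≤ E * η + T * E * (1 + C * M) * η + η :=
        (norm_add₃_le).trans (add_le_add (add_le_add hb1 hb2) hb3)
    _ = (T * E * (1 + C * M) + E + 1) * η := by ring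
    _ < ε := hηε

end Chernoff

/-! ### Symmetric operators bounded above -/

section SelfAdjoint

variable {H : Type*} [NormedAddCommGroup H] [InnerProductSpace ℂ H] {A : H →ₗ.[ℂ] H}

/-- Pair λx - y with x and apply Cauchy–Schwarz. For λ > κ this makes λ - A injective and bounded
below, and it is the source of the resolvent bound. -/
theorem norm_le_of_upperBound {κ lam : ℝ}
    (hb : ∀ x y, (x, y) ∈ A.graph → (inner ℂ x y).re ≤ κ * ‖x‖ ^ 2) {x y : H}
    (h : (x, y) ∈ A.graph) : (lam - κ) * ‖x‖ ≤ ‖(lam : ℂ) • x - y‖ := by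
  rcases eq_or_ne x 0 with rfl | hx
  · simp
  have h1 : (inner ℂ x ((lam : ℂ) • x - y)).re ≤ ‖x‖ * ‖(lam : ℂ) • x - y‖ :=
    (Complex.re_le_norm _).trans (norm_inner_le_norm _ _)
  rw [inner_sub_right, inner_smul_right, inner_self_eq_norm_sq_to_K, Complex.sub_re] at h1
  have h2 : ((lam : ℂ) * ((‖x‖ : ℂ)) ^ 2).re = lam * ‖x‖ ^ 2 := by
    norm_cast
  have h3 := hb x y h
  have hx' : 0 < ‖x‖ := norm_pos_iff.2 hx
  simp only [Complex.coe_algebraMap] at h1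
  rw [h2] at h1
  nlinarith

/-- On the graph, complete because A is closed, the map (x, y) ↦ λx - y is bounded below, so its
range is closed as well as dense. -/
theorem range_eq_univ_of_dense [CompleteSpace H] {κ lam : ℝ} (hlam : κ < lam) (hA : A.IsClosed)
    (hb : ∀ x y, (x, y) ∈ A.graph → (inner ℂ x y).re ≤ κ * ‖x‖ ^ 2)
    (hd : Dense ((fun p : H × H => (lam : ℂ) • p.1 - p.2) '' A.graph)) (w : H) :
    ∃ x y, (x, y) ∈ A.graph ∧ (lam : ℂ) • x - y = w := by
  let F : A.graph →L[ℂ] H := ((lam : ℂ) • ContinuousLinearMap.fst ℂ H H -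
    ContinuousLinearMap.snd ℂ H H).comp A.graph.subtypeL
  have hF : ∀ p : A.graph, F p = (lam : ℂ) • p.1.1 - p.1.2 := fun p => rfl
  have : CompleteSpace A.graph := IsClosed.completeSpace_coe (hs := hA)
  have hd' : 0 < lam - κ := sub_pos.2 hlam
  have hanti : AntilipschitzWith (Real.toNNReal (|lam| / (lam - κ) + 1 + 1 / (lam - κ))) F := by
    refine ContinuousLinearMap.antilipschitz_of_bound F fun p => ?_
    have h1 := norm_le_of_upperBound (lam := lam) hb p.2
    rw [← hF] at h1
    have h2 : ‖p.1.1‖ ≤ 1 / (lam - κ) * ‖F p‖ := by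
      rw [div_mul_eq_mul_div, one_mul, le_div_iff₀ hd']
      linarith
    have h3 : ‖p.1.2‖ ≤ |lam| * ‖p.1.1‖ + ‖F p‖ := by
      have : p.1.2 = (lam : ℂ) • p.1.1 - F p := by rw [hF]; abel
      rw [this]
      refine (norm_sub_le _ _).trans (le_of_eq ?_)
      rw [norm_smul, Complex.norm_real, Real.norm_eq_abs]
    have h4 : |lam| * ‖p.1.1‖ ≤ |lam| * (1 / (lam - κ) * ‖F p‖) := by gcongr
    rw [Real.coe_toNNReal _ (by positivity), Submodule.coe_norm, Prod.norm_def]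
    have h5 : 0 ≤ |lam| / (lam - κ) * ‖F p‖ := by positivity
    have h6 : 0 ≤ 1 / (lam - κ) * ‖F p‖ := by positivity
    have h7 : |lam| * (1 / (lam - κ) * ‖F p‖) = |lam| / (lam - κ) * ‖F p‖ := by ring
    refine max_le ?_ ?_ <;> nlinarith [norm_nonneg (F p)]
  have hr : Set.range F = Set.univ := by
    rw [← (hanti.isClosed_range F.uniformContinuous).closure_eq]
    have : Set.range F = (fun p : H × H => (lam : ℂ) • p.1 - p.2) '' A.graph := by
      ext z
      simp [hF]
    rw [this]
    exact hd.closure_eq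
  obtain ⟨p, hp⟩ := hr.ge (Set.mem_univ w)
  exact ⟨p.1.1, p.1.2, p.2, hp⟩

theorem exists_resolvent {κ lam : ℝ} (hlam : κ < lam)
    (hb : ∀ x y, (x, y) ∈ A.graph → (inner ℂ x y).re ≤ κ * ‖x‖ ^ 2)
    (hs : ∀ w, ∃ x y, (x, y) ∈ A.graph ∧ (lam : ℂ) • x - y = w) :
    ∃ R : H →L[ℂ] H, (∀ x y, (x, y) ∈ A.graph ↔ R ((lam : ℂ) • x - y) = x) ∧
      ‖R‖ ≤ 1 / (lam - κ) := by
  have hd' : 0 < lam - κ := sub_pos.2 hlam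
  have huniq : ∀ x y x' y', (x, y) ∈ A.graph → (x', y') ∈ A.graph →
      (lam : ℂ) • x - y = (lam : ℂ) • x' - y' → x = x' ∧ y = y' := by
    intro x y x' y' h h' he
    have h1 := norm_le_of_upperBound (lam := lam) hb
      (show (x - x', y - y') ∈ A.graph from A.graph.sub_mem h h')
    have h2 : (lam : ℂ) • (x - x') - (y - y') = 0 := by
      rw [smul_sub, sub_sub_sub_comm, he, sub_self]
    rw [h2, norm_zero] at h1
    have h3 : x = x' := by
      have : ‖x - x'‖ = 0 := le_antisymm (nonpos_of_mul_nonpos_right h1 hd') (norm_nonneg _)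
      rwa [norm_eq_zero, sub_eq_zero] at this
    refine ⟨h3, ?_⟩
    rw [h3] at he
    exact sub_right_injective he
  choose r r' hr hr' using hs
  let R₀ : H →ₗ[ℂ] H :=
    { toFun := r
      map_add' := fun v w => (huniq _ _ _ _ (hr (v + w)) (A.graph.add_mem (hr v) (hr w)) (by
        rw [hr']; nth_rewrite 1 [← hr' v, ← hr' w]; simp only [smul_add]; abel)).1
      map_smul' := fun a w => (huniq _ _ _ _ (hr (a • w)) (A.graph.smul_mem a (hr w)) (by
        rw [hr']; nth_rewrite 1 [← hr' w]; simp only [smul_sub, smul_comm a])).1 }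
  have hbd : ∀ w, ‖R₀ w‖ ≤ 1 / (lam - κ) * ‖w‖ := fun w => by
    have h1 := norm_le_of_upperBound (lam := lam) hb (hr w)
    rw [hr'] at h1
    rw [div_mul_eq_mul_div, one_mul, le_div_iff₀ hd', mul_comm]
    exact h1
  refine ⟨R₀.mkContinuous _ hbd, fun x y => ⟨fun h => ?_, fun h => ?_⟩,
    R₀.mkContinuous_norm_le (by positivity) hbd⟩
  · exact (huniq _ _ _ _ (hr _) h (hr' _)).1
  · have h1 := hr ((lam : ℂ) • x - y)
    have h2 := hr' ((lam : ℂ) • x - y)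
    change r ((lam : ℂ) • x - y) = x at h
    rw [h] at h1 h2
    rwa [sub_right_injective h2] at h1

/-- Surjectivity of λ - A makes a symmetric operator maximal. Solve λx₀ - y₀ = λu - w in the graph;
then u and x₀ have the same inner product with every λx - y, that is, with every vector. -/
theorem mem_graph_of_formal_adjoint {lam : ℝ}
    (hsym : ∀ x y x' y', (x, y) ∈ A.graph → (x', y') ∈ A.graph → inner ℂ y x' = inner ℂ x y')
    (hs : ∀ w, ∃ x y, (x, y) ∈ A.graph ∧ (lam : ℂ) • x - y = w) {u w : H}
    (h : ∀ x y, (x, y) ∈ A.graph → inner ℂ y u = inner ℂ x w) : (u, w) ∈ A.graph := by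
  obtain ⟨x₀, y₀, h0, h0'⟩ := hs ((lam : ℂ) • u - w)
  have hux : u = x₀ := by
    refine ext_inner_left ℂ fun v => ?_
    obtain ⟨x, y, hxy, rfl⟩ := hs v
    have h1 : inner ℂ x ((lam : ℂ) • u - w) = inner ℂ x ((lam : ℂ) • x₀ - y₀) := by rw [h0']
    rw [inner_sub_right, inner_sub_right, ← h x y hxy, ← hsym x y x₀ y₀ hxy h0, inner_smul_right,
      inner_smul_right] at h1
    rw [inner_sub_left, inner_sub_left, inner_smul_left, inner_smul_left, Complex.conj_ofReal]
    exact h1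
  rw [hux] at h0' ⊢
  rwa [sub_right_injective h0'] at h0

theorem isSelfAdjoint_of_range [CompleteSpace H] {lam : ℝ} (hd : Dense (A.domain : Set H))
    (hsym : ∀ x y x' y', (x, y) ∈ A.graph → (x', y') ∈ A.graph → inner ℂ y x' = inner ℂ x y')
    (hs : ∀ w, ∃ x y, (x, y) ∈ A.graph ∧ (lam : ℂ) • x - y = w) : IsSelfAdjoint A := by
  rw [LinearPMap.isSelfAdjoint_def]
  refine LinearPMap.eq_of_eq_graph ?_
  rw [LinearPMap.adjoint_graph_eq_graph_adjoint hd]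
  ext ⟨u, w⟩
  rw [Submodule.mem_adjoint_iff]
  simp only [sub_eq_zero]
  exact ⟨fun h => mem_graph_of_formal_adjoint hsym hs h, fun h x y hxy => hsym x y u w hxy h⟩

/-- A vector orthogonal to the range of λ - A lies in the domain of the adjoint and would be an
eigenvector of A for λ > κ, which the upper bound excludes. -/
theorem dense_range_of_selfAdjoint [CompleteSpace H] {κ lam : ℝ} (hlam : κ < lam)
    (hb : ∀ x y, (x, y) ∈ A.graph → (inner ℂ x y).re ≤ κ * ‖x‖ ^ 2)
    (hsa : ∀ u w, (∀ x y, (x, y) ∈ A.graph → inner ℂ y u = inner ℂ x w) → (u, w) ∈ A.graph) :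
    Dense ((fun p : H × H => (lam : ℂ) • p.1 - p.2) '' A.graph) := by
  let F : H × H →ₗ[ℂ] H := (lam : ℂ) • LinearMap.fst ℂ H H - LinearMap.snd ℂ H H
  have hF : (fun p : H × H => (lam : ℂ) • p.1 - p.2) '' A.graph = (A.graph.map F : Set H) := by
    ext z; simp [F]
  rw [hF, Submodule.dense_iff_topologicalClosure_eq_top,
    Submodule.topologicalClosure_eq_top_iff, Submodule.eq_bot_iff]
  intro u hu
  rw [Submodule.mem_orthogonal] at hu
  have h1 : (u, (lam : ℂ) • u) ∈ A.graph := by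
    refine hsa _ _ fun x y hxy => ?_
    have h2 := hu _ (Submodule.mem_map_of_mem hxy)
    change inner ℂ ((lam : ℂ) • x - y) u = 0 at h2
    rw [inner_sub_left, inner_smul_left, Complex.conj_ofReal, sub_eq_zero] at h2
    rw [← h2, inner_smul_right]
  have h3 := norm_le_of_upperBound (lam := lam) hb h1
  rw [sub_self, norm_zero] at h3
  exact norm_le_zero_iff.1 (nonpos_of_mul_nonpos_right h3 (sub_pos.2 hlam))

/-! ### The semigroup generated by a self-adjoint operator bounded above -/

theorem abs_exp_sub_one_le (x : ℝ) : |Real.exp x - 1| ≤ |x| * Real.exp (max x 0) := by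
  rcases le_total 0 x with hx | hx
  · rw [abs_of_nonneg (by linarith [Real.add_one_le_exp x]), abs_of_nonneg hx, max_eq_left hx]
    have h1 := mul_le_mul_of_nonneg_left (Real.add_one_le_exp (-x)) (Real.exp_pos x).le
    rw [← Real.exp_add, add_neg_cancel, Real.exp_zero] at h1
    linarith
  · rw [abs_of_nonpos (by linarith [Real.exp_le_one_iff.2 hx]), abs_of_nonpos hx, max_eq_right hx,
      Real.exp_zero]
    linarith [Real.add_one_le_exp x]

theorem abs_exp_sub_one_sub_le (x : ℝ) :
    |Real.exp x - 1 - x| ≤ x ^ 2 * Real.exp (max x 0) := by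
  have h0 := Real.add_one_le_exp x
  have h1 := mul_le_mul_of_nonneg_left (Real.add_one_le_exp (-x)) (Real.exp_pos x).le
  rw [← Real.exp_add, add_neg_cancel, Real.exp_zero] at h1
  rw [abs_of_nonneg (by linarith)]
  calc Real.exp x - 1 - x ≤ x * (Real.exp x - 1) := by linarith
    _ ≤ |x| * |Real.exp x - 1| := by rw [← abs_mul]; exact le_abs_self _
    _ ≤ |x| * (|x| * Real.exp (max x 0)) := by gcongr; exact abs_exp_sub_one_le x
    _ = _ := by rw [← mul_assoc, ← sq, sq_abs]

/-- The function `r ↦ exp (t (lam - 1 / r))` on the spectrum of the resolvent at `lam`. -/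
noncomputable def resolventExp (lam t r : ℝ) : ℝ :=
  -- `expNegInvGlue (r / t)` is exp(-t/r) for r > 0 and 0 at r = 0, which makes the function
  -- continuous at the point of the spectrum of R that corresponds to -∞. For t = 0 the convention r
  -- / 0 = 0 would give 0 in place of 1.
  if t = 0 then 1 else Real.exp (lam * t) * expNegInvGlue (r / t)

theorem continuous_resolventExp (lam t : ℝ) : Continuous (resolventExp lam t) := by
  unfold resolventExp
  split_ifs
  · exact continuous_const
  · exact continuous_const.mul ((expNegInvGlue.contDiff (n := 0)).continuous.comp
      (continuous_id.div_const t))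

theorem resolventExp_of_pos {lam t r : ℝ} (ht : 0 ≤ t) (hr : 0 < r) :
    resolventExp lam t r = Real.exp (t * (lam - 1 / r)) := by
  unfold resolventExp
  split_ifs with h
  · simp [h]
  · have ht' : 0 < t := lt_of_le_of_ne ht (Ne.symm h)
    rw [expNegInvGlue, if_neg (not_le.2 (by positivity)), ← Real.exp_add, inv_div]
    congr 1
    ring

theorem resolventExp_zero_right {lam t : ℝ} (ht : 0 < t) : resolventExp lam t 0 = 0 := by
  simp [resolventExp, ht.ne', expNegInvGlue.zero_of_nonpos]

theorem resolventExp_add {lam t s r : ℝ} (ht : 0 ≤ t) (hs : 0 ≤ s) (hr : 0 ≤ r) :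
    resolventExp lam (t + s) r = resolventExp lam t r * resolventExp lam s r := by
  rcases hr.eq_or_lt with rfl | hr
  · rcases ht.eq_or_lt with rfl | ht
    · simp [resolventExp]
    · rw [resolventExp_zero_right ht, resolventExp_zero_right (by linarith), zero_mul]
  · rw [resolventExp_of_pos ht hr, resolventExp_of_pos hs hr, resolventExp_of_pos (by linarith) hr,
      ← Real.exp_add]
    congr 1
    ring

/-- For r ≤ 1 the exponent κ + 1 - 1/r is at most κ: the spectral form of the bound A ≤ κ. -/
theorem max_mul_exponent_le {κ t r : ℝ} (hκ : 0 ≤ κ) (ht : 0 ≤ t) (hr : 0 < r) (hr1 : r ≤ 1) :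
    max (t * (κ + 1 - 1 / r)) 0 ≤ κ * t := by
  have h1 : 1 ≤ 1 / r := by rwa [le_div_iff₀ hr, one_mul]
  refine max_le ?_ (by positivity)
  rw [mul_comm κ]
  gcongr
  linarith

theorem abs_resolventExp_le {κ t r : ℝ} (hκ : 0 ≤ κ) (ht : 0 ≤ t) (hr : 0 ≤ r) (hr1 : r ≤ 1) :
    |resolventExp (κ + 1) t r| ≤ Real.exp (κ * t) := by
  rcases hr.eq_or_lt with rfl | hr
  · rcases ht.eq_or_lt with rfl | ht
    · simp [resolventExp]
    · rw [resolventExp_zero_right ht, abs_zero]; positivity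
  · rw [resolventExp_of_pos ht hr, Real.abs_exp, Real.exp_le_exp]
    exact (le_max_left _ _).trans (max_mul_exponent_le hκ ht hr hr1)

/-- The factor r cancels the pole of 1/r in the exponent. For the semigroup this is Lipschitz
continuity on the range of R. -/
theorem abs_resolventExp_sub_one_mul_le {κ t r : ℝ} (hκ : 0 ≤ κ) (ht : 0 ≤ t) (hr : 0 ≤ r)
    (hr1 : r ≤ 1) :
    |(resolventExp (κ + 1) t r - 1) * r| ≤ t * ((κ + 2) * Real.exp (κ * t)) := by
  rcases hr.eq_or_lt with rfl | hr
  · rw [mul_zero, abs_zero]; positivity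
  · have h1 : |(κ + 1 - 1 / r) * r| ≤ κ + 2 := by
      rw [sub_mul, one_div_mul_cancel hr.ne', abs_le]
      constructor <;> nlinarith
    rw [resolventExp_of_pos ht hr, abs_mul]
    calc _ ≤ |t * (κ + 1 - 1 / r)| * Real.exp (κ * t) * |r| := by
          refine mul_le_mul_of_nonneg_right ((abs_exp_sub_one_le _).trans ?_) (abs_nonneg _)
          gcongr
          exact max_mul_exponent_le hκ ht hr hr1
      _ = t * (|(κ + 1 - 1 / r) * r| * Real.exp (κ * t)) := by
          rw [abs_mul, abs_mul, abs_of_nonneg ht]; ring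
      _ ≤ _ := by gcongr

/-- The second order remainder of the exponential needs two factors of r to cancel the squared pole.
For the semigroup it gives the derivative at 0 on the range of R². -/
theorem abs_resolventExp_remainder_le {κ t r : ℝ} (hκ : 0 ≤ κ) (ht : 0 ≤ t) (hr : 0 ≤ r)
    (hr1 : r ≤ 1) :
    |(resolventExp (κ + 1) t r - 1) * r * r - t * (((κ + 1) * r - 1) * r)| ≤
      t ^ 2 * ((κ + 2) ^ 2 * Real.exp (κ * t)) := by
  rcases hr.eq_or_lt with rfl | hr
  · simp only [mul_zero, sub_zero, abs_zero]; positivity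
  · have h1 : |(κ + 1 - 1 / r) * r| ≤ κ + 2 := by
      rw [sub_mul, one_div_mul_cancel hr.ne', abs_le]
      constructor <;> nlinarith
    have h2 : (resolventExp (κ + 1) t r - 1) * r * r - t * (((κ + 1) * r - 1) * r) =
        (Real.exp (t * (κ + 1 - 1 / r)) - 1 - t * (κ + 1 - 1 / r)) * r ^ 2 := by
      rw [resolventExp_of_pos ht hr]
      field_simp
    rw [h2, abs_mul]
    calc _ ≤ (t * (κ + 1 - 1 / r)) ^ 2 * Real.exp (κ * t) * |r ^ 2| := by
          refine mul_le_mul_of_nonneg_right ((abs_exp_sub_one_sub_le _).trans ?_) (abs_nonneg _)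
          gcongr
          exact max_mul_exponent_le hκ ht hr hr1
      _ = t ^ 2 * (|(κ + 1 - 1 / r) * r| ^ 2 * Real.exp (κ * t)) := by
          rw [abs_of_nonneg (sq_nonneg r), sq_abs]; ring
      _ ≤ _ := by gcongr

/-- A semigroup that commutes with the resolvent and has the right derivative on its range has
the given generator. -/
theorem isGenerator_of_resolvent {B : Type*} [NormedAddCommGroup B] [NormedSpace ℂ B]
    {A : B →ₗ.[ℂ] B} {V : ℝ≥0 → B →L[ℂ] B} {lam : ℝ} {R : B →L[ℂ] B}
    (hR : ∀ x y, (x, y) ∈ A.graph ↔ R ((lam : ℂ) • x - y) = x)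
    (hcomm : ∀ t x, V t (R x) = R (V t x))
    (hderiv : ∀ w, Tendsto (fun t : ℝ≥0 => (((t : ℝ) : ℂ)⁻¹) • (V t (R w) - R w)) (𝓝[>] 0)
      (𝓝 ((lam : ℂ) • R w - w))) : IsGenerator A V := by
  intro x y
  constructor
  · intro h
    rw [hR] at h
    have := hderiv ((lam : ℂ) • x - y)
    rw [h] at this
    convert this using 2
    abel
  · intro h
    have h1 := ((R.continuous.tendsto _).comp h).congr fun t => by
      rw [Function.comp, map_smul, map_sub, ← hcomm]
    rw [hR, map_sub, map_smul, tendsto_nhds_unique h1 (hderiv x)]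
    abel

/-- With V t = f_t(R), scalar identities and bounds on [0, 1], which contains the spectrum of R,
become operator identities and norm bounds. Strong continuity and the derivative are checked on the
dense range of R and extended by uniform boundedness. -/
theorem exists_semigroup_of_resolvent [CompleteSpace H] {κ : ℝ} (hκ : 0 ≤ κ) {R : H →L[ℂ] H}
    (hR : ∀ x y, (x, y) ∈ A.graph ↔ R (((κ + 1 : ℝ) : ℂ) • x - y) = x) (hR0 : 0 ≤ R)
    (hR1 : ‖R‖ ≤ 1) (hRd : DenseRange R) :
    ∃ V : ℝ≥0 → H →L[ℂ] H, IsC0Semigroup V ∧ IsGenerator A V := by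
  have hRsa : IsSelfAdjoint R := IsSelfAdjoint.of_nonneg hR0
  have hsp0 : ∀ r ∈ spectrum ℝ R, 0 ≤ r := fun r hr => spectrum_nonneg_of_nonneg hR0 hr
  have hsp1 : ∀ r ∈ spectrum ℝ R, r ≤ 1 := fun r hr => by
    refine (le_abs_self r).trans ((spectrum.norm_le_norm_mul_of_mem hr).trans ?_)
    calc ‖R‖ * ‖(1 : H →L[ℂ] H)‖ ≤ 1 * 1 := by
          gcongr; exact ContinuousLinearMap.norm_id_le
      _ = 1 := one_mul 1
  let f : ℝ≥0 → ℝ → ℝ := fun t => resolventExp (κ + 1) t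
  have hf : ∀ t, ContinuousOn (f t) (spectrum ℝ R) := fun t =>
    (continuous_resolventExp _ _).continuousOn
  let V : ℝ≥0 → H →L[ℂ] H := fun t => cfc (f t) R
  have hV0 : V 0 = 1 := by
    have : f 0 = fun _ => 1 := by funext r; simp [f, resolventExp]
    simp only [V, this]
    exact cfc_const_one ℝ R
  have hVadd : ∀ t s, V (t + s) = V t * V s := by
    intro t s
    simp only [V]
    rw [← cfc_mul (f t) (f s) R (hf t) (hf s)]
    refine cfc_congr fun r hr => ?_
    simp only [f, NNReal.coe_add]
    exact resolventExp_add t.2 s.2 (hsp0 r hr)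
  have hVn : ∀ t, ‖V t‖ ≤ Real.exp (κ * t) := fun t =>
    norm_cfc_le (Real.exp_pos _).le fun r hr => abs_resolventExp_le hκ t.2 (hsp0 r hr) (hsp1 r hr)
  have hcommR : ∀ t, Commute (V t) R := fun t => by
    have h := cfc_commute_cfc (f t) (fun r : ℝ => r) R
    rwa [cfc_id' ℝ R] at h
  have hsub : ∀ t, cfc (fun r => f t r - 1) R = V t - 1 := fun t => by
    rw [cfc_sub (f t) (fun _ => 1) R (hf t) continuousOn_const, cfc_const_one ℝ R]
  have hsubc : ∀ t, ContinuousOn (fun r => f t r - 1) (spectrum ℝ R) := fun t =>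
    (hf t).sub continuousOn_const
  have hmulR : ∀ g : ℝ → ℝ, ContinuousOn g (spectrum ℝ R) →
      cfc (fun r => g r * r) R = cfc g R * R := fun g hg => by
    rw [cfc_mul g (fun r => r) R hg (by fun_prop), cfc_id' ℝ R]
  have hfirst : ∀ t : ℝ≥0, ‖(V t - 1) * R‖ ≤ t * ((κ + 2) * Real.exp (κ * t)) := by
    intro t
    have h1 : (V t - 1) * R = cfc (fun r => (f t r - 1) * r) R := by
      rw [hmulR _ (hsubc t), hsub]
    rw [h1]
    exact norm_cfc_le (by positivity) fun r hr =>
      abs_resolventExp_sub_one_mul_le hκ t.2 (hsp0 r hr) (hsp1 r hr)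
  have hsecond : ∀ t : ℝ≥0, ‖(V t - 1) * R * R - (t : ℝ) • (((κ + 1) • R - 1) * R)‖ ≤
      t ^ 2 * ((κ + 2) ^ 2 * Real.exp (κ * t)) := by
    intro t
    have h1 : (V t - 1) * R * R - (t : ℝ) • (((κ + 1) • R - 1) * R) =
        cfc (fun r => (f t r - 1) * r * r - t * (((κ + 1) * r - 1) * r)) R := by
      have hc : ContinuousOn (fun r => (f t r - 1) * r) (spectrum ℝ R) :=
        (hsubc t).mul continuousOn_id
      rw [cfc_sub (fun r => (f t r - 1) * r * r) (fun r => t * (((κ + 1) * r - 1) * r)) R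
        (hc.mul continuousOn_id) (by fun_prop), hmulR _ hc, hmulR _ (hsubc t), hsub,
        cfc_const_mul (t : ℝ) (fun r => ((κ + 1) * r - 1) * r) R (by fun_prop),
        hmulR _ (by fun_prop), cfc_sub (fun r => (κ + 1) * r) (fun _ => 1) R (by fun_prop)
        (by fun_prop), cfc_const_one ℝ R, cfc_const_mul (κ + 1) (fun r => r) R (by fun_prop),
        cfc_id' ℝ R]
    rw [h1]
    exact norm_cfc_le (by positivity) fun r hr =>
      abs_resolventExp_remainder_le hκ t.2 (hsp0 r hr) (hsp1 r hr)
  have hlip : ∀ (T t s : ℝ≥0), s ≤ t → t ≤ T →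
      ‖(V t - V s) * R‖ ≤ (t - s) * ((κ + 2) * Real.exp (κ * T)) := by
    intro T t s hst htT
    have h1 : (V t - V s) * R = V s * ((V (t - s) - 1) * R) := by
      nth_rewrite 1 [← add_tsub_cancel_of_le hst]
      rw [hVadd]
      noncomm_ring
    have h2 : ((t - s : ℝ≥0) : ℝ) = t - s := NNReal.coe_sub hst
    have h3 : (t : ℝ) ≤ T := NNReal.coe_le_coe.2 htT
    have h4 : (0 : ℝ) ≤ t - s := sub_nonneg.2 (NNReal.coe_le_coe.2 hst)
    rw [h1]
    refine (norm_mul_le_of_le (hVn s) (hfirst (t - s))).trans ?_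
    rw [h2]
    calc Real.exp (κ * s) * ((t - s) * ((κ + 2) * Real.exp (κ * (t - s))))
        = (t - s) * ((κ + 2) * Real.exp (κ * t)) := by
          have : Real.exp (κ * t) = Real.exp (κ * s) * Real.exp (κ * (t - s)) := by
            rw [← Real.exp_add]; ring_nf
          rw [this]; ring
      _ ≤ _ := by gcongr
  have hV : IsC0Semigroup V := by
    refine ⟨hV0, hVadd, fun x => continuous_iff_continuousAt.2 fun s => ?_⟩
    have hnear : ∀ᶠ t in 𝓝 s, t ≤ s + 1 :=
      (eventually_lt_nhds (lt_add_of_pos_right s one_pos)).mono fun t ht => ht.le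
    refine tendsto_sub_nhds_zero_iff.1 (tendsto_zero_of_dense (T := fun t => V t - V s)
      (M := Real.exp (κ * (s + 1)) + Real.exp (κ * s)) ?_ hRd ?_ x)
    · filter_upwards [hnear] with t ht
      refine (norm_sub_le _ _).trans (add_le_add ((hVn t).trans ?_) (hVn s))
      gcongr
      exact_mod_cast ht
    · rintro _ ⟨y, rfl⟩
      have h1 : Tendsto (fun t : ℝ≥0 => |(t : ℝ) - s| * ((κ + 2) * Real.exp (κ * (s + 1))) * ‖y‖)
          (𝓝 s) (𝓝 0) := by
        have : Continuous fun t : ℝ≥0 =>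
            |(t : ℝ) - s| * ((κ + 2) * Real.exp (κ * (s + 1))) * ‖y‖ := by fun_prop
        simpa using this.tendsto s
      refine squeeze_zero_norm' ?_ h1
      filter_upwards [hnear] with t ht
      refine ContinuousLinearMap.le_of_opNorm_le ((V t - V s) * R) ?_ y
      rcases le_total s t with h | h
      · rw [abs_of_nonneg (sub_nonneg.2 (NNReal.coe_le_coe.2 h))]
        simpa using hlip (s + 1) t s h ht
      · rw [abs_sub_comm, abs_of_nonneg (sub_nonneg.2 (NNReal.coe_le_coe.2 h)), ← norm_neg,
          ← neg_mul, neg_sub]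
        simpa using hlip (s + 1) s t h (by simp)
  refine ⟨V, hV, isGenerator_of_resolvent hR (fun t x => DFunLike.congr_fun (hcommR t) x)
    fun w => ?_⟩
  have hsmall : ∀ᶠ t : ℝ≥0 in 𝓝[>] 0, 0 < t ∧ t ≤ 1 := by
    filter_upwards [self_mem_nhdsWithin,
      mem_nhdsWithin_of_mem_nhds (Iic_mem_nhds (zero_lt_one' ℝ≥0))] with t h1 h2 using ⟨h1, h2⟩
  -- The operators t⁻¹(V t - 1)R are bounded for t ≤ 1 by `hfirst` and converge on the range of R by
  -- `hsecond`, hence converge strongly: V is differentiable at 0 on the whole range of R, the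
  -- domain of A.
  refine tendsto_sub_nhds_zero_iff.1 (tendsto_zero_of_dense
    (T := fun t : ℝ≥0 => (t : ℝ)⁻¹ • ((V t - 1) * R) - ((κ + 1) • R - 1))
    (M := (κ + 2) * Real.exp κ + ‖(κ + 1) • R - 1‖) ?_ hRd ?_ w |>.congr fun t => ?_)
  · filter_upwards [hsmall] with t ⟨ht0, ht1⟩
    have ht0' : (0 : ℝ) < t := ht0
    refine (norm_sub_le _ _).trans (add_le_add ?_ le_rfl)
    rw [norm_smul, norm_inv, Real.norm_of_nonneg t.coe_nonneg, inv_mul_le_iff₀ ht0']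
    refine (hfirst t).trans ?_
    gcongr
    exact mul_le_of_le_one_right hκ ht1
  · rintro _ ⟨y, rfl⟩
    have h1 : Tendsto (fun t : ℝ≥0 => (t : ℝ) * ((κ + 2) ^ 2 * Real.exp (κ * t)) * ‖y‖)
        (𝓝[>] 0) (𝓝 0) := by
      have : Continuous fun t : ℝ≥0 => (t : ℝ) * ((κ + 2) ^ 2 * Real.exp (κ * t)) * ‖y‖ := by
        fun_prop
      simpa using (this.tendsto 0).mono_left nhdsWithin_le_nhds
    refine squeeze_zero_norm' ?_ h1
    filter_upwards [hsmall] with t ⟨ht0, ht1⟩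
    have ht0' : (0 : ℝ) < t := ht0
    have h2 : ((t : ℝ)⁻¹ • ((V t - 1) * R) - ((κ + 1) • R - 1)) * R =
        (t : ℝ)⁻¹ • ((V t - 1) * R * R - (t : ℝ) • (((κ + 1) • R - 1) * R)) := by
      rw [smul_sub, smul_smul, inv_mul_cancel₀ ht0'.ne', one_smul, sub_mul, smul_mul_assoc]
    refine ContinuousLinearMap.le_of_opNorm_le
      (((t : ℝ)⁻¹ • ((V t - 1) * R) - ((κ + 1) • R - 1)) * R) ?_ y
    rw [h2, norm_smul, norm_inv, Real.norm_of_nonneg t.coe_nonneg, inv_mul_le_iff₀ ht0']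
    refine (hsecond t).trans (le_of_eq ?_)
    ring
  · change (t : ℝ)⁻¹ • (V t (R w) - R w) - ((κ + 1) • R w - w) = _
    rw [← Complex.ofReal_inv, Complex.coe_smul, Complex.coe_smul]

/-- A densely defined operator that is self-adjoint and bounded above generates a strongly
continuous semigroup. -/
theorem exists_semigroup_of_selfAdjoint [CompleteSpace H] {κ : ℝ} (hκ : 0 ≤ κ) (hA : A.IsClosed)
    (hd : Dense (A.domain : Set H))
    (hb : ∀ x y, (x, y) ∈ A.graph → (inner ℂ x y).re ≤ κ * ‖x‖ ^ 2)
    (hsym : ∀ x y x' y', (x, y) ∈ A.graph → (x', y') ∈ A.graph → inner ℂ y x' = inner ℂ x y')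
    (hsa : ∀ u w, (∀ x y, (x, y) ∈ A.graph → inner ℂ y u = inner ℂ x w) → (u, w) ∈ A.graph) :
    ∃ (R : H →L[ℂ] H) (V : ℝ≥0 → H →L[ℂ] H),
      (∀ x y, (x, y) ∈ A.graph ↔ R (((κ + 1 : ℝ) : ℂ) • x - y) = x) ∧ DenseRange R ∧
      Dense ((fun p : H × H => ((κ + 1 : ℝ) : ℂ) • p.1 - p.2) '' A.graph) ∧
      IsC0Semigroup V ∧ IsGenerator A V := by
  have hlam : κ < κ + 1 := by linarith
  have hdr := dense_range_of_selfAdjoint hlam hb hsa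
  obtain ⟨R, hR, hR1⟩ := exists_resolvent hlam hb (range_eq_univ_of_dense hlam hA hb hdr)
  have hg : ∀ w, (R w, ((κ + 1 : ℝ) : ℂ) • R w - w) ∈ A.graph := fun w => by
    rw [hR]; congr 1; abel
  have hRd : DenseRange R := by
    refine hd.mono fun x hx => ?_
    obtain ⟨y, hy⟩ := LinearPMap.mem_domain_iff.1 hx
    exact ⟨_, (hR x y).1 hy⟩
  -- Symmetry passes from A to R. With x = Rw, Re⟨Rw, w⟩ = Re⟨x, (κ + 1)x - Ax⟩ ≥ ‖x‖² ≥ 0.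
  have hR0 : 0 ≤ R := by
    rw [ContinuousLinearMap.nonneg_iff_isPositive]
    refine ⟨fun v w => ?_, fun w => ?_⟩
    · have h1 := hsym _ _ _ _ (hg v) (hg w)
      rw [inner_sub_left, inner_sub_right, inner_smul_left, inner_smul_right, Complex.conj_ofReal,
        sub_right_inj] at h1
      exact h1.symm
    · have h1 := hb _ _ (hg w)
      rw [inner_sub_right, inner_smul_right, inner_self_eq_norm_sq_to_K, Complex.sub_re] at h1
      have h2 : (((κ + 1 : ℝ) : ℂ) * ((‖R w‖ : ℂ)) ^ 2).re = (κ + 1) * ‖R w‖ ^ 2 := by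
        norm_cast
      simp only [Complex.coe_algebraMap] at h1
      rw [h2] at h1
      rw [ContinuousLinearMap.reApplyInnerSelf_apply]
      change 0 ≤ (inner ℂ (R w) w).re
      nlinarith [sq_nonneg ‖R w‖]
  have hR1' : ‖R‖ ≤ 1 := by simpa using hR1
  obtain ⟨V, hV, hAV⟩ := exists_semigroup_of_resolvent hκ hR hR0 hR1' hRd
  exact ⟨R, V, hR, hRd, hdr, hV, hAV⟩

end SelfAdjoint

/-! ### The Heisenberg group -/

section Heisenberg

variable {d : ℕ}

theorem sigmaForm_self (z : HorizontalSpace d) : sigmaForm z z = 0 := by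
  rw [sigmaForm, dotProduct_comm, sub_self]

theorem sigmaForm_add_left (z z' w : HorizontalSpace d) :
    sigmaForm (z + z') w = sigmaForm z w + sigmaForm z' w := by
  simp only [sigmaForm, Prod.fst_add, Prod.snd_add, add_dotProduct, dotProduct_add]
  ring

theorem sigmaForm_add_right (z w w' : HorizontalSpace d) :
    sigmaForm z (w + w') = sigmaForm z w + sigmaForm z w' := by
  simp only [sigmaForm, Prod.fst_add, Prod.snd_add, add_dotProduct, dotProduct_add]
  ring

theorem sigmaForm_smul_left (a : ℝ) (z w : HorizontalSpace d) :
    sigmaForm (a • z) w = a * sigmaForm z w := by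
  simp only [sigmaForm, Prod.smul_fst, Prod.smul_snd, smul_dotProduct, dotProduct_smul, smul_eq_mul]
  ring

theorem sigmaForm_smul_right (a : ℝ) (z w : HorizontalSpace d) :
    sigmaForm z (a • w) = a * sigmaForm z w := by
  simp only [sigmaForm, Prod.smul_fst, Prod.smul_snd, smul_dotProduct, dotProduct_smul, smul_eq_mul]
  ring

theorem sigmaForm_neg_left (z w : HorizontalSpace d) : sigmaForm (-z) w = -sigmaForm z w := by
  simpa using sigmaForm_smul_left (-1) z w

theorem sigmaForm_neg_right (z w : HorizontalSpace d) : sigmaForm z (-w) = -sigmaForm z w := by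
  simpa using sigmaForm_smul_right (-1) z w

theorem sigmaForm_swap (z w : HorizontalSpace d) : sigmaForm z w = -sigmaForm w z := by
  simp only [sigmaForm, dotProduct_comm z.1, dotProduct_comm w.1]
  ring

theorem ContDiff.sigmaForm {E : Type*} [NormedAddCommGroup E] [NormedSpace ℝ E]
    {n : WithTop ℕ∞} {f g : E → HorizontalSpace d} (hf : ContDiff ℝ n f) (hg : ContDiff ℝ n g) :
    ContDiff ℝ n fun x => sigmaForm (f x) (g x) := by
  unfold _root_.sigmaForm dotProduct
  fun_prop

theorem Continuous.sigmaForm {X : Type*} [TopologicalSpace X]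
    {f g : X → HorizontalSpace d} (hf : Continuous f) (hg : Continuous g) :
    Continuous fun x => sigmaForm (f x) (g x) := by
  unfold _root_.sigmaForm dotProduct
  fun_prop

/-- The group law of the Heisenberg group. -/
noncomputable def heisMul (p q : Heisenberg d) : Heisenberg d := (p.1 + q.1, p.2 + q.2 + sigmaForm p.1 q.1)

theorem heisMul_assoc (p q r : Heisenberg d) :
    heisMul (heisMul p q) r = heisMul p (heisMul q r) := by
  simp only [heisMul, sigmaForm_add_left, sigmaForm_add_right, Prod.mk.injEq, add_assoc, true_and]
  ring

theorem neg_heisMul_self (p : Heisenberg d) : heisMul (-p) p = 0 := by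
  simp [heisMul, sigmaForm_neg_left, sigmaForm_self]

theorem heisMul_neg_self (p : Heisenberg d) : heisMul p (-p) = 0 := by
  simp [heisMul, sigmaForm_neg_right, sigmaForm_self]

theorem zero_heisMul (p : Heisenberg d) : heisMul 0 p = p := by
  simp [heisMul, sigmaForm]

theorem heisMul_zero (p : Heisenberg d) : heisMul p 0 = p := by
  simp [heisMul, sigmaForm]

theorem neg_heisMul_cancel (p q : Heisenberg d) : heisMul (-p) (heisMul p q) = q := by
  rw [← heisMul_assoc, neg_heisMul_self, zero_heisMul]

theorem neg_heisMul (p q : Heisenberg d) : -heisMul p q = heisMul (-q) (-p) := by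
  simp only [heisMul, Prod.neg_mk, Prod.fst_neg, Prod.snd_neg, sigmaForm_neg_left,
    sigmaForm_neg_right, neg_neg, Prod.mk.injEq]
  rw [sigmaForm_swap q.1]
  constructor
  · abel
  · ring

theorem ContDiff.heisMul {E : Type*} [NormedAddCommGroup E] [NormedSpace ℝ E]
    {n : WithTop ℕ∞} {f g : E → Heisenberg d} (hf : ContDiff ℝ n f) (hg : ContDiff ℝ n g) :
    ContDiff ℝ n fun x => heisMul (f x) (g x) :=
  (hf.fst.add hg.fst).prodMk ((hf.snd.add hg.snd).add (hf.fst.sigmaForm hg.fst))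

theorem Continuous.heisMul {X : Type*} [TopologicalSpace X]
    {f g : X → Heisenberg d} (hf : Continuous f) (hg : Continuous g) :
    Continuous fun x => heisMul (f x) (g x) :=
  (hf.fst.add hg.fst).prodMk ((hf.snd.add hg.snd).add (hf.fst.sigmaForm hg.fst))

/-- Left and right translations both have this form, a translation of z with a shift of s depending
on z alone. Hence Lebesgue measure is bi-invariant under the group law. -/
theorem measurePreserving_shear (a : HorizontalSpace d) {h : HorizontalSpace d → ℝ}
    (hh : Continuous h) :
    MeasurePreserving (fun p : Heisenberg d => (p.1 + a, p.2 + h p.1)) volume volume := by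
  have : (volume : Measure (HorizontalSpace d)).IsAddRightInvariant :=
    Measure.prod.instIsAddRightInvariant
  exact (measurePreserving_add_right (volume : Measure (HorizontalSpace d)) a).skew_product
    (g := fun z s => s + h z) (μc := (volume : Measure ℝ)) (by fun_prop)
    (Eventually.of_forall fun z => (measurePreserving_add_right volume (h z)).map_eq)

theorem measurePreserving_heisMul_left (q : Heisenberg d) :
    MeasurePreserving (heisMul q) (volume : Measure (Heisenberg d)) volume := by
  have h := measurePreserving_shear q.1 (h := fun z => q.2 + sigmaForm q.1 z)
    (continuous_const.add (continuous_const.sigmaForm continuous_id))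
  have h' : heisMul q = fun p : Heisenberg d => (p.1 + q.1, p.2 + (q.2 + sigmaForm q.1 p.1)) := by
    funext p
    simp only [heisMul, add_comm q.1, Prod.mk.injEq, true_and]
    ring
  rw [h']
  exact h

theorem measurePreserving_heisMul_right (q : Heisenberg d) :
    MeasurePreserving (fun p => heisMul p q) (volume : Measure (Heisenberg d)) volume := by
  have h := measurePreserving_shear q.1 (h := fun z => q.2 + sigmaForm z q.1)
    (continuous_const.add (continuous_id.sigmaForm continuous_const))
  have h' : (fun p : Heisenberg d => heisMul p q) =
      fun p : Heisenberg d => (p.1 + q.1, p.2 + (q.2 + sigmaForm p.1 q.1)) := by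
    funext p
    simp only [heisMul, Prod.mk.injEq, true_and]
    ring
  rw [h']
  exact h

/-- Left translation as a homeomorphism. -/
noncomputable def heisMulLeft (q : Heisenberg d) : Heisenberg d ≃ₜ Heisenberg d where
  toFun := heisMul q
  invFun := heisMul (-q)
  left_inv := neg_heisMul_cancel q
  right_inv p := by simpa using neg_heisMul_cancel (-q) p
  continuous_toFun := continuous_const.heisMul continuous_id
  continuous_invFun := continuous_const.heisMul continuous_id

/-! ### Horizontal vector fields -/

/-- The left-invariant field with value `(ζ, 0)` at the origin. -/
noncomputable def horizontalField (ζ : HorizontalSpace d) (f : Heisenberg d → ℂ) : Heisenberg d → ℂ := fun p =>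
  fderiv ℝ f p (ζ, sigmaForm p.1 ζ)

/-- The standard basis of `ℝ^{2d}`. -/
noncomputable def horizontalBasis : Fin d ⊕ Fin d → HorizontalSpace d :=
  Sum.elim (fun i => (Pi.single i 1, 0)) fun i => (0, Pi.single i 1)

theorem fieldX_eq_horizontalField (i : Fin d) (f : Heisenberg d → ℂ) :
    fieldX i f = horizontalField (horizontalBasis (.inl i)) f := by
  funext p
  have h : ((horizontalBasis (.inl i), sigmaForm p.1 (horizontalBasis (.inl i))) : Heisenberg d) =
      ((Pi.single i 1, 0), 0) + p.1.2 i • ((0, 0), 1) := by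
    simp [horizontalBasis, sigmaForm]
  rw [horizontalField, h, map_add, map_smul, fieldX, Complex.real_smul]

theorem fieldY_eq_horizontalField (i : Fin d) (f : Heisenberg d → ℂ) :
    fieldY i f = horizontalField (horizontalBasis (.inr i)) f := by
  funext p
  have h : ((horizontalBasis (.inr i), sigmaForm p.1 (horizontalBasis (.inr i))) : Heisenberg d) =
      ((0, Pi.single i 1), 0) - p.1.1 i • ((0, 0), 1) := by
    simp [horizontalBasis, sigmaForm]
  rw [horizontalField, h, map_sub, map_smul, fieldY, Complex.real_smul]

theorem subLaplacianExpr_eq_sum (f : Heisenberg d → ℂ) (p : Heisenberg d) :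
    subLaplacianExpr f p =
      ∑ j, horizontalField (horizontalBasis j) (horizontalField (horizontalBasis j) f) p := by
  simp [subLaplacianExpr, fieldX_eq_horizontalField, fieldY_eq_horizontalField,
    Finset.sum_add_distrib]

theorem contDiff_horizontalField (ζ : HorizontalSpace d) {f : Heisenberg d → ℂ}
    (hf : ContDiff ℝ ∞ f) : ContDiff ℝ ∞ (horizontalField ζ f) :=
  (hf.fderiv_right (m := ∞) (by simp)).clm_apply
    (contDiff_const.prodMk (contDiff_fst.sigmaForm contDiff_const))

theorem horizontalField_mem_testFunctions (ζ : HorizontalSpace d) {f : Heisenberg d → ℂ}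
    (hf : f ∈ testFunctions d) : horizontalField ζ f ∈ testFunctions d := by
  refine ⟨contDiff_horizontalField ζ hf.1, (hf.2.fderiv ℝ).mono' fun p hp => ?_⟩
  refine subset_tsupport _ fun h => hp ?_
  simp [horizontalField, h]

theorem integrable_of_mem_testFunctions {f : Heisenberg d → ℂ} (hf : f ∈ testFunctions d) :
    Integrable f volume :=
  hf.1.continuous.integrable_of_hasCompactSupport hf.2

theorem integral_fderiv_eq_zero_of_mem_testFunctions {f : Heisenberg d → ℂ}
    (hf : f ∈ testFunctions d) (v : Heisenberg d) : ∫ p, fderiv ℝ f p v = 0 := by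
  have h := integral_mul_fderiv_eq_neg_fderiv_mul_of_integrable (μ := (volume : Measure (Heisenberg d)))
    (f := fun _ => (1 : ℂ)) (g := f) (v := v) (by simp)
    (by simpa using integrable_of_mem_testFunctions (fderiv_apply_mem_testFunctions hf v))
    (by simpa using integrable_of_mem_testFunctions hf) (by simp)
    fun p _ => differentiable_of_mem_testFunctions hf p
  simpa using h

/-- The linear form `z ↦ z ·_σ ζ`. -/
noncomputable def sigmaFormCLM (ζ : HorizontalSpace d) : HorizontalSpace d →L[ℝ] ℝ :=
  LinearMap.toContinuousLinearMap
    { toFun := fun z => sigmaForm z ζ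
      map_add' := fun z z' => sigmaForm_add_left z z' ζ
      map_smul' := fun a z => sigmaForm_smul_left a z ζ }

theorem sigmaFormCLM_apply (ζ z : HorizontalSpace d) : sigmaFormCLM ζ z = sigmaForm z ζ := rfl

/-- The field is divergence free: the coefficient z ·_σ ζ of ∂_s does not depend on s and can be
moved inside that derivative. -/
theorem integral_horizontalField_eq_zero (ζ : HorizontalSpace d) {f : Heisenberg d → ℂ}
    (hf : f ∈ testFunctions d) : ∫ p, horizontalField ζ f p = 0 := by
  have hs : ContDiff ℝ ∞ fun p : Heisenberg d => sigmaForm p.1 ζ :=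
    contDiff_fst.sigmaForm contDiff_const
  have hsf := mul_mem_testFunctions hf hs
  have key : ∀ p, horizontalField ζ f p = fderiv ℝ f p (ζ, 0) +
      fderiv ℝ (fun p => ((sigmaForm p.1 ζ : ℝ) : ℂ) * f p) p (0, 1) := by
    intro p
    have h1 := ((Complex.ofRealCLM.comp ((sigmaFormCLM ζ).comp
      (ContinuousLinearMap.fst ℝ (HorizontalSpace d) ℝ))).hasFDerivAt (x := p)).mul
      (differentiable_of_mem_testFunctions hf p).hasFDerivAt
    have h2 : ((ζ, sigmaForm p.1 ζ) : Heisenberg d) = (ζ, 0) + sigmaForm p.1 ζ • (0, 1) := by simp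
    rw [horizontalField, h2, map_add, map_smul, Complex.real_smul]
    congr 1
    refine Eq.symm ((DFunLike.congr_fun h1.fderiv _).trans ?_)
    simp [sigmaFormCLM_apply, sigmaForm]
  simp only [key]
  rw [integral_add (integrable_of_mem_testFunctions (fderiv_apply_mem_testFunctions hf _))
    (integrable_of_mem_testFunctions (fderiv_apply_mem_testFunctions hsf _)),
    integral_fderiv_eq_zero_of_mem_testFunctions hf,
    integral_fderiv_eq_zero_of_mem_testFunctions hsf, add_zero]

theorem horizontalField_conj_mul (ζ : HorizontalSpace d) {f g : Heisenberg d → ℂ}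
    {p : Heisenberg d} (hf : DifferentiableAt ℝ f p) (hg : DifferentiableAt ℝ g p) :
    horizontalField ζ (fun p => conj (f p) * g p) p =
      conj (horizontalField ζ f p) * g p + conj (f p) * horizontalField ζ g p := by
  have h1 := (Complex.conjCLE.hasFDerivAt.comp p hf.hasFDerivAt).mul hg.hasFDerivAt
  refine (DFunLike.congr_fun h1.fderiv _).trans ?_
  simp [horizontalField]
  ring

theorem conj_mul_mem_testFunctions {f g : Heisenberg d → ℂ} (hf : f ∈ testFunctions d)
    (hg : ContDiff ℝ ∞ g) : (fun p => conj (f p) * g p) ∈ testFunctions d := by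
  refine ⟨(Complex.conjCLE.contDiff.comp hf.1).mul hg, hf.2.mono fun p hp => ?_⟩
  contrapose! hp
  simp only [Function.mem_support, not_not] at hp ⊢
  simp [hp]

theorem integral_conj_horizontalField_mul (ζ : HorizontalSpace d) {f g : Heisenberg d → ℂ}
    (hf : f ∈ testFunctions d) (hg : ContDiff ℝ ∞ g) :
    ∫ p, conj (horizontalField ζ f p) * g p = -∫ p, conj (f p) * horizontalField ζ g p := by
  have h := integral_horizontalField_eq_zero ζ (conj_mul_mem_testFunctions hf hg)
  have h1 : ∀ p, horizontalField ζ (fun p => conj (f p) * g p) p =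
      conj (horizontalField ζ f p) * g p + conj (f p) * horizontalField ζ g p := fun p =>
    horizontalField_conj_mul ζ (differentiable_of_mem_testFunctions hf p)
      (hg.differentiable (by simp) p)
  simp only [h1] at h
  rw [integral_add (integrable_of_mem_testFunctions
      (conj_mul_mem_testFunctions (horizontalField_mem_testFunctions ζ hf) hg))
    (integrable_of_mem_testFunctions
      (conj_mul_mem_testFunctions hf (contDiff_horizontalField ζ hg)))] at h
  exact eq_neg_of_add_eq_zero_left h

/-- One integration by parts for each field. Compact support is asked of one factor only, so that
`caccioppoli` can take for the other a weak solution that is merely smooth. -/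
theorem integral_conj_subLaplacianExpr_mul {f g : Heisenberg d → ℂ}
    (hf : f ∈ testFunctions d) (hg : ContDiff ℝ ∞ g) :
    ∫ p, conj (subLaplacianExpr f p) * g p = -∑ j, ∫ p,
      conj (horizontalField (horizontalBasis j) f p) * horizontalField (horizontalBasis j) g p := by
  simp only [subLaplacianExpr_eq_sum, map_sum, Finset.sum_mul]
  rw [integral_finsetSum, ← Finset.sum_neg_distrib]
  · exact Finset.sum_congr rfl fun j _ => integral_conj_horizontalField_mul _
      (horizontalField_mem_testFunctions _ hf) hg
  · exact fun j _ => integrable_of_mem_testFunctions (conj_mul_mem_testFunctions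
      (horizontalField_mem_testFunctions _ (horizontalField_mem_testFunctions _ hf)) hg)

theorem integral_conj_mul_subLaplacianExpr {f g : Heisenberg d → ℂ}
    (hf : f ∈ testFunctions d) (hg : g ∈ testFunctions d) :
    ∫ p, conj (subLaplacianExpr f p) * g p = ∫ p, conj (f p) * subLaplacianExpr g p := by
  have h1 : ∫ p, conj (f p) * subLaplacianExpr g p =
      conj (∫ p, conj (subLaplacianExpr g p) * f p) := by
    rw [← integral_conj]
    simp only [map_mul, Complex.conj_conj, mul_comm]
  rw [h1, integral_conj_subLaplacianExpr_mul hf hg.1, integral_conj_subLaplacianExpr_mul hg hf.1,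
    map_neg, map_sum]
  congr 1
  refine Finset.sum_congr rfl fun j _ => ?_
  rw [← integral_conj]
  simp only [map_mul, Complex.conj_conj, mul_comm]

/-! ### The sub-Laplacian on test functions -/

theorem coeFn_testToL2 (f : testFunctions d) : testToL2 d f =ᵐ[volume] f.1 :=
  MemLp.coeFn_toLp (memLp_of_mem_testFunctions f.2)

theorem inner_testToL2_left (f : testFunctions d) (u : L2Heis d) :
    inner ℂ (testToL2 d f) u = ∫ p, conj (f.1 p) * u p := by
  rw [L2.inner_def]
  refine integral_congr_ae ?_
  filter_upwards [coeFn_testToL2 f] with p hp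
  rw [hp, RCLike.inner_apply, mul_comm]

theorem inner_testToL2 (f g : testFunctions d) :
    inner ℂ (testToL2 d f) (testToL2 d g) = ∫ p, conj (f.1 p) * g.1 p := by
  rw [inner_testToL2_left]
  refine integral_congr_ae ?_
  filter_upwards [coeFn_testToL2 g] with p hp
  rw [hp]

theorem mem_graph_subLaplacianCore {x y : L2Heis d} :
    (x, y) ∈ (subLaplacianCore d).graph ↔
      ∃ f : testFunctions d, testToL2 d f = x ∧ testToL2 d (subLaplacianTest d f) = y := by
  have key : ∀ (f : testFunctions d) (h : testToL2 d f ∈ (subLaplacianCore d).domain),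
      subLaplacianCore d ⟨testToL2 d f, h⟩ = testToL2 d (subLaplacianTest d f) := by
    intro f h
    change testToL2 d (subLaplacianTest d ((LinearEquiv.ofInjective (testToL2 d)
      (testToL2_injective d)).symm ⟨testToL2 d f, h⟩)) = _
    congr 2
    exact (LinearEquiv.symm_apply_eq _).2 (Subtype.ext rfl)
  rw [LinearPMap.mem_graph_iff]
  constructor
  · rintro ⟨⟨_, f, rfl⟩, rfl, rfl⟩
    exact ⟨f, rfl, (key f _).symm⟩
  · rintro ⟨f, rfl, rfl⟩
    exact ⟨⟨_, f, rfl⟩, rfl, key f _⟩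

theorem eq_zero_of_forall_integral_mul {u : Heisenberg d → ℂ} (hu : LocallyIntegrable u volume)
    (h : ∀ g : Heisenberg d → ℝ, ContDiff ℝ ∞ g → HasCompactSupport g →
      ∫ p, (g p : ℂ) * u p = 0) : u =ᵐ[volume] 0 :=
  ae_eq_zero_of_integral_contDiff_smul_eq_zero hu fun g hg hgc => by
    simpa only [Complex.real_smul] using h g hg hgc

theorem ofReal_mem_testFunctions {g : Heisenberg d → ℝ} (hg : ContDiff ℝ ∞ g)
    (hgc : HasCompactSupport g) : (fun p => (g p : ℂ)) ∈ testFunctions d :=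
  ⟨Complex.ofRealCLM.contDiff.comp hg, hgc.comp_left (g := fun r : ℝ => (r : ℂ)) Complex.ofReal_zero⟩

theorem locallyIntegrable_L2Heis (u : L2Heis d) : LocallyIntegrable u volume :=
  (Lp.memLp u).locallyIntegrable (by norm_num)

theorem dense_range_testToL2 (d : ℕ) : Dense (LinearMap.range (testToL2 d) : Set (L2Heis d)) := by
  rw [Submodule.dense_iff_topologicalClosure_eq_top, Submodule.topologicalClosure_eq_top_iff,
    Submodule.eq_bot_iff]
  intro u hu
  rw [Submodule.mem_orthogonal] at hu
  refine (Lp.eq_zero_iff_ae_eq_zero).2 (eq_zero_of_forall_integral_mul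
    (locallyIntegrable_L2Heis u) fun g hg hgc => ?_)
  have h1 := hu _ ⟨⟨_, ofReal_mem_testFunctions hg hgc⟩, rfl⟩
  rw [inner_testToL2_left] at h1
  simpa only [Complex.conj_ofReal] using h1

/-! ### The closure of the sub-Laplacian -/

theorem isFormalAdjoint_subLaplacianCore (d : ℕ) :
    (subLaplacianCore d).IsFormalAdjoint (subLaplacianCore d) := by
  intro x y
  obtain ⟨f, hf, hf'⟩ := mem_graph_subLaplacianCore.1 ((subLaplacianCore d).mem_graph x)
  obtain ⟨g, hg, hg'⟩ := mem_graph_subLaplacianCore.1 ((subLaplacianCore d).mem_graph y)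
  rw [← hf, ← hf', ← hg, ← hg', inner_testToL2, inner_testToL2]
  exact integral_conj_mul_subLaplacianExpr f.2 g.2

/-- A densely defined symmetric operator is contained in its adjoint, which is closed. -/
theorem isClosable_subLaplacianCore (d : ℕ) : (subLaplacianCore d).IsClosable := by
  have hd : Dense ((subLaplacianCore d).domain : Set (L2Heis d)) := dense_range_testToL2 d
  exact (LinearPMap.adjoint_isClosed hd).isClosable.leIsClosable
    ((isFormalAdjoint_subLaplacianCore d).le_adjoint hd)

theorem isClosed_subLaplacian (d : ℕ) : (subLaplacian d).IsClosed :=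
  (isClosable_subLaplacianCore d).closure_isClosed

theorem mem_graph_subLaplacian {x y : L2Heis d} :
    (x, y) ∈ (subLaplacian d).graph ↔
      (x, y) ∈ closure ((subLaplacianCore d).graph : Set (L2Heis d × L2Heis d)) := by
  rw [subLaplacian, ← (isClosable_subLaplacianCore d).graph_closure_eq_closure_graph]
  rfl

theorem dense_domain_subLaplacian (d : ℕ) : Dense ((subLaplacian d).domain : Set (L2Heis d)) :=
  (dense_range_testToL2 d).mono ((subLaplacianCore d).le_closure).1

theorem subLaplacian_symmetric (x y x' y' : L2Heis d) (h : (x, y) ∈ (subLaplacian d).graph)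
    (h' : (x', y') ∈ (subLaplacian d).graph) : inner ℂ y x' = inner ℂ x y' := by
  rw [mem_graph_subLaplacian] at h h'
  have h2 := map_mem_closure₂ (f := fun a b : L2Heis d × L2Heis d =>
    inner ℂ a.2 b.1 - inner ℂ a.1 b.2) (u := {0}) (by fun_prop) h h' ?_
  · simpa [sub_eq_zero] using h2
  · rintro ⟨a, b⟩ ha ⟨a', b'⟩ ha'
    obtain ⟨f, rfl, rfl⟩ := mem_graph_subLaplacianCore.1 ha
    obtain ⟨g, rfl, rfl⟩ := mem_graph_subLaplacianCore.1 ha'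
    simp only [Set.mem_singleton_iff, inner_testToL2, sub_eq_zero]
    exact integral_conj_mul_subLaplacianExpr f.2 g.2

theorem subLaplacian_nonpos (x y : L2Heis d) (h : (x, y) ∈ (subLaplacian d).graph) :
    (inner ℂ x y).re ≤ 0 := by
  rw [mem_graph_subLaplacian] at h
  have h2 := map_mem_closure (f := fun a : L2Heis d × L2Heis d => (inner ℂ a.1 a.2).re)
    (t := Set.Iic 0) (by fun_prop) h ?_
  · simpa using h2
  · rintro ⟨a, b⟩ ha
    obtain ⟨f, rfl, rfl⟩ := mem_graph_subLaplacianCore.1 ha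
    simp only [Set.mem_Iic, inner_testToL2]
    change (∫ p, conj (f.1 p) * subLaplacianExpr f.1 p).re ≤ 0
    rw [← integral_conj_mul_subLaplacianExpr f.2 f.2, integral_conj_subLaplacianExpr_mul f.2 f.2.1,
      Complex.neg_re, Complex.re_sum, neg_nonpos]
    refine Finset.sum_nonneg fun j _ => ?_
    have : ∀ z : ℂ, conj z * z = ((‖z‖ ^ 2 : ℝ) : ℂ) := fun z => by
      rw [Complex.conj_mul']; norm_cast
    simp only [this]
    rw [integral_complex_ofReal, Complex.ofReal_re]
    positivity

end Heisenberg

/-! ### Averages of square integrable functions -/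

theorem MeasureTheory.MemLp.integrable_sq_norm {X F : Type*} [MeasurableSpace X] [NormedAddCommGroup F]
    {μ : Measure X} {f : X → F} (hf : MemLp f 2 μ) : Integrable (fun x => ‖f x‖ ^ 2) μ :=
  (memLp_two_iff_integrable_sq_norm hf.1).1 hf

section Average

variable {Ω X : Type*} [MeasurableSpace Ω] [MeasurableSpace X]

theorem lintegral_sq_le_measure_univ_mul {μ : Measure Ω} {f : Ω → ℝ≥0∞} (hf : AEMeasurable f μ) :
    (∫⁻ o, f o ∂μ) ^ 2 ≤ μ Set.univ * ∫⁻ o, f o ^ 2 ∂μ := by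
  have h := ENNReal.lintegral_mul_le_Lp_mul_Lq μ (Real.HolderConjugate.two_two) hf
    (aemeasurable_const (b := (1 : ℝ≥0∞)))
  simp only [Pi.mul_apply, mul_one, ENNReal.rpow_two] at h
  calc _ ≤ _ := pow_le_pow_left' h 2
    _ = _ := by
      rw [mul_pow, ← ENNReal.rpow_natCast, ← ENNReal.rpow_natCast, ← ENNReal.rpow_mul,
        ← ENNReal.rpow_mul]
      norm_num
      rw [mul_comm]

/-- The squared `L²` norm of an average is at most the average of the squared `L²` norms. -/
theorem lintegral_enorm_integral_sq_le {μ : Measure Ω} {ν : Measure X} [SFinite μ] [SFinite ν]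
    {F : Ω → X → ℂ} (hF : StronglyMeasurable (Function.uncurry F)) :
    ∫⁻ x, ‖∫ o, F o x ∂μ‖ₑ ^ 2 ∂ν ≤ μ Set.univ * ∫⁻ o, ∫⁻ x, ‖F o x‖ₑ ^ 2 ∂ν ∂μ := by
  have hm : Measurable fun p : Ω × X => ‖F p.1 p.2‖ₑ := hF.measurable.enorm
  calc ∫⁻ x, ‖∫ o, F o x ∂μ‖ₑ ^ 2 ∂ν
      ≤ ∫⁻ x, μ Set.univ * ∫⁻ o, ‖F o x‖ₑ ^ 2 ∂μ ∂ν := by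
        refine lintegral_mono fun x => ?_
        refine (pow_le_pow_left' (enorm_integral_le_lintegral_enorm _) 2).trans ?_
        exact lintegral_sq_le_measure_univ_mul (hm.comp measurable_prodMk_right).aemeasurable
    _ = μ Set.univ * ∫⁻ x, ∫⁻ o, ‖F o x‖ₑ ^ 2 ∂μ ∂ν := by
        refine lintegral_const_mul _ ?_
        exact Measurable.lintegral_prod_left' (f := fun p : Ω × X => ‖F p.1 p.2‖ₑ ^ 2)
          (hm.pow_const 2)
    _ = _ := by
        rw [lintegral_lintegral_swap]
        exact ((hm.comp measurable_swap).pow_const 2).aemeasurable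

end Average

section Heisenberg

variable {d : ℕ}

/-! ### Left-regularization -/

theorem measurePreserving_neg_heisenberg :
    MeasurePreserving (fun p : Heisenberg d => -p) volume volume :=
  ⟨measurable_neg, by
    simpa using Measure.map_addHaar_smul (volume : Measure (Heisenberg d)) (r := -1) (by simp)⟩

/-- The convolution `p ↦ ∫ φ(p r⁻¹) u(r) dr`. -/
noncomputable def leftMollify (φ u : Heisenberg d → ℂ) : Heisenberg d → ℂ := fun p =>
  ∫ r, u r * φ (heisMul p (-r))

/-- The homeomorphism `q ↦ q⁻¹ p`. -/
noncomputable def heisInvMul (p : Heisenberg d) : Heisenberg d ≃ₜ Heisenberg d where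
  toFun q := heisMul (-q) p
  invFun r := heisMul p (-r)
  left_inv q := by beta_reduce; rw [neg_heisMul, ← heisMul_assoc, heisMul_neg_self, zero_heisMul, neg_neg]
  right_inv r := by beta_reduce; rw [neg_heisMul, heisMul_assoc, neg_heisMul_self, heisMul_zero, neg_neg]
  continuous_toFun := continuous_neg.heisMul continuous_const
  continuous_invFun := continuous_const.heisMul continuous_neg

theorem leftMollify_eq (φ u : Heisenberg d → ℂ) (p : Heisenberg d) :
    leftMollify φ u p = ∫ q, u (heisMul (-q) p) * φ q := by
  have h1 : MeasurePreserving (heisInvMul p) (volume : Measure (Heisenberg d)) volume :=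
    (measurePreserving_heisMul_right p).comp measurePreserving_neg_heisenberg
  have h2 := h1.integral_comp (heisInvMul p).measurableEmbedding fun r => u r * φ (heisMul p (-r))
  rw [leftMollify, ← h2]
  refine integral_congr_ae (Eventually.of_forall fun q => ?_)
  exact congrArg (fun x => u (heisMul (-q) p) * φ x) ((heisInvMul p).left_inv q)

/-- Put z = p.1. Since σ(z, z) = 0, the kernel φ(p r⁻¹) equals g z (p - r), so the group convolution
is a Euclidean convolution whose kernel depends smoothly on the parameter z. The compact set k
contains the supports of g z for all z near the base point. -/
theorem contDiff_leftMollify {φ u : Heisenberg d → ℂ} (hφ : φ ∈ testFunctions d)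
    (hu : LocallyIntegrable u volume) : ContDiff ℝ ∞ (leftMollify φ u) := by
  let g : HorizontalSpace d → Heisenberg d → ℂ := fun z x => φ (x.1, x.2 + sigmaForm z x.1)
  have hg : ContDiff ℝ ∞ (Function.uncurry g) := hφ.1.comp
    (contDiff_snd.fst.prodMk (contDiff_snd.snd.add (contDiff_fst.sigmaForm contDiff_snd.fst)))
  have hconv : leftMollify φ u = fun p =>
      convolution u (g p.1) (ContinuousLinearMap.mul ℝ ℂ) volume p := by
    funext p
    refine integral_congr_ae (Eventually.of_forall fun r => ?_)
    simp only [ContinuousLinearMap.mul_apply', g, heisMul]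
    congr 3
    simp [sub_eq_add_neg, sigmaForm_add_right, sigmaForm_self]
  rw [contDiff_iff_contDiffAt]
  intro p₀
  let s : Set (HorizontalSpace d) := Metric.ball p₀.1 1
  let k : Set (Heisenberg d) := (fun x : HorizontalSpace d × Heisenberg d =>
    ((x.2.1, x.2.2 - sigmaForm x.1 x.2.1) : Heisenberg d)) '' (Metric.closedBall p₀.1 1 ×ˢ tsupport φ)
  have hk : IsCompact k := ((isCompact_closedBall _ _).prod hφ.2).image
    (continuous_snd.fst.prodMk
      (continuous_snd.snd.sub (continuous_fst.sigmaForm continuous_snd.fst)))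
  have hgs : ∀ (z : HorizontalSpace d) (x : Heisenberg d), z ∈ s → x ∉ k → g z x = 0 := by
    intro z x hz hx
    by_contra h
    refine hx ⟨(z, (x.1, x.2 + sigmaForm z x.1)), ⟨Metric.ball_subset_closedBall hz,
      subset_tsupport _ h⟩, ?_⟩
    simp
  have h := contDiffOn_convolution_right_with_param (n := ⊤) (ContinuousLinearMap.mul ℝ ℂ)
    Metric.isOpen_ball hk hgs hu hg.contDiffOn
  have hcomp : ContDiffOn ℝ ∞ (leftMollify φ u) (Prod.fst ⁻¹' s) := by
    rw [hconv]
    refine h.comp (f := fun p : Heisenberg d => (p.1, p)) (by fun_prop) fun p hp => ?_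
    exact ⟨hp, Set.mem_univ _⟩
  exact hcomp.contDiffAt ((Metric.isOpen_ball.preimage continuous_fst).mem_nhds
    (Metric.mem_ball_self one_pos))

theorem stronglyMeasurable_comp_neg_heisMul {u : Heisenberg d → ℂ} (hu : StronglyMeasurable u) :
    StronglyMeasurable fun x : Heisenberg d × Heisenberg d => u (heisMul (-x.1) x.2) :=
  hu.comp_measurable (continuous_fst.neg.heisMul continuous_snd).measurable

theorem lintegral_heisMul_left {f : Heisenberg d → ℝ≥0∞} (hf : Measurable f) (q : Heisenberg d) :
    ∫⁻ p, f (heisMul q p) = ∫⁻ p, f p :=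
  (measurePreserving_heisMul_left q).lintegral_comp hf

/-- By `leftMollify_eq` this averages left translates of u, all of the same L² norm, with a bounded
weight on a set of finite measure. -/
theorem memLp_leftMollify {φ u : Heisenberg d → ℂ} (hφ : φ ∈ testFunctions d)
    (hum : StronglyMeasurable u) (hu : MemLp u 2 volume) : MemLp (leftMollify φ u) 2 volume := by
  refine ⟨(contDiff_leftMollify hφ (hu.locallyIntegrable (by norm_num))).continuous.aestronglyMeasurable,
    ?_⟩
  rw [eLpNorm_lt_top_iff_lintegral_rpow_enorm_lt_top (by norm_num) (by norm_num)]
  have hfin : ∫⁻ p, ‖u p‖ₑ ^ 2 < ⊤ := by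
    have := (eLpNorm_lt_top_iff_lintegral_rpow_enorm_lt_top (by norm_num) (by norm_num)).1 hu.2
    simpa using this
  obtain ⟨C, hC⟩ := hφ.2.exists_bound_of_continuous hφ.1.continuous
  have hvK : ∀ p, leftMollify φ u p =
      ∫ q, u (heisMul (-q) p) * φ q ∂(volume.restrict (tsupport φ)) := fun p => by
    rw [leftMollify_eq, setIntegral_eq_integral_of_forall_compl_eq_zero]
    intro q hq
    rw [image_eq_zero_of_notMem_tsupport hq, mul_zero]
  have hF : StronglyMeasurable (Function.uncurry fun q p : Heisenberg d =>
      u (heisMul (-q) p) * φ q) :=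
    (stronglyMeasurable_comp_neg_heisMul hum).mul
      (hφ.1.continuous.comp continuous_fst).stronglyMeasurable
  have h1 := lintegral_enorm_integral_sq_le (μ := (volume : Measure (Heisenberg d)).restrict
    (tsupport φ)) (ν := (volume : Measure (Heisenberg d))) hF
  simp only [← hvK] at h1
  have hK : (volume : Measure (Heisenberg d)) (tsupport φ) < ⊤ := hφ.2.measure_lt_top
  simp only [ENNReal.toReal_ofNat, ENNReal.rpow_two]
  refine h1.trans_lt (ENNReal.mul_lt_top (by rwa [Measure.restrict_apply_univ]) ?_)
  have h2 : ∀ q, ∫⁻ p, ‖u (heisMul (-q) p) * φ q‖ₑ ^ 2 ≤ ENNReal.ofReal C ^ 2 * ∫⁻ p, ‖u p‖ₑ ^ 2 := by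
    intro q
    rw [← lintegral_heisMul_left (hum.measurable.enorm.pow_const 2) (-q), ← lintegral_const_mul]
    · refine lintegral_mono fun p => ?_
      rw [enorm_mul, mul_pow, mul_comm]
      gcongr
      rw [← ofReal_norm]
      exact ENNReal.ofReal_le_ofReal (hC q)
    · exact (hum.measurable.enorm.pow_const 2).comp (measurePreserving_heisMul_left (-q)).measurable
  refine (lintegral_mono h2).trans_lt ?_
  rw [lintegral_const, Measure.restrict_apply_univ]
  exact ENNReal.mul_lt_top (ENNReal.mul_lt_top (by simp) hfin) hK

/-! ### Left invariance -/

/-- The differential of left translation by q sends (ζ, σ(z, ζ)) to (ζ, σ(q.1 + z, ζ)), the value of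
the field at the translated point. -/
theorem horizontalField_comp_heisMul (ζ : HorizontalSpace d) {f : Heisenberg d → ℂ}
    (hf : Differentiable ℝ f) (q p : Heisenberg d) :
    horizontalField ζ (fun p => f (heisMul q p)) p = horizontalField ζ f (heisMul q p) := by
  let ℓ : HorizontalSpace d →L[ℝ] ℝ := -sigmaFormCLM q.1
  have hℓ : ∀ z, ℓ z = sigmaForm q.1 z := fun z => (sigmaForm_swap q.1 z).symm
  have h1 : HasFDerivAt (fun p : Heisenberg d => heisMul q p)
      ((ContinuousLinearMap.fst ℝ _ _).prod (ContinuousLinearMap.snd ℝ _ _ +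
        ℓ.comp (ContinuousLinearMap.fst ℝ _ _))) p := by
    have := (((ContinuousLinearMap.fst ℝ (HorizontalSpace d) ℝ).prod
      (ContinuousLinearMap.snd ℝ (HorizontalSpace d) ℝ +
        ℓ.comp (ContinuousLinearMap.fst ℝ _ _))).hasFDerivAt (x := p)).const_add q
    refine this.congr_of_eventuallyEq (Eventually.of_forall fun x => ?_)
    simp [heisMul, hℓ, Prod.ext_iff, add_assoc]
  refine (DFunLike.congr_fun ((hf _).hasFDerivAt.comp p h1).fderiv _).trans ?_
  rw [horizontalField, ContinuousLinearMap.comp_apply]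
  congr 1
  simp [hℓ, heisMul, sigmaForm_add_left, add_comm]

theorem comp_heisMul_mem_testFunctions {f : Heisenberg d → ℂ} (hf : f ∈ testFunctions d)
    (q : Heisenberg d) : (fun p => f (heisMul q p)) ∈ testFunctions d :=
  ⟨hf.1.comp (contDiff_const.heisMul contDiff_id), hf.2.comp_homeomorph (heisMulLeft q)⟩

theorem subLaplacianExpr_comp_heisMul {f : Heisenberg d → ℂ} (hf : f ∈ testFunctions d)
    (q p : Heisenberg d) :
    subLaplacianExpr (fun p => f (heisMul q p)) p = subLaplacianExpr f (heisMul q p) := by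
  simp only [subLaplacianExpr_eq_sum]
  refine Finset.sum_congr rfl fun j _ => ?_
  rw [← horizontalField_comp_heisMul _ (differentiable_of_mem_testFunctions
    (horizontalField_mem_testFunctions _ hf))]
  congr 1
  funext p
  exact horizontalField_comp_heisMul _ (differentiable_of_mem_testFunctions hf) q p

/-- Bound |g(p)||u(q⁻¹p)| by |g(p)|² + |u(q⁻¹p)|²; by left-invariance the p-integral of this does
not depend on q, and φ is integrable in q. -/
theorem integrable_prod_leftMollify {φ g u : Heisenberg d → ℂ} (hφ : φ ∈ testFunctions d)
    (hg : g ∈ testFunctions d) (hum : StronglyMeasurable u) (hu : MemLp u 2 volume) :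
    Integrable (Function.uncurry fun p q : Heisenberg d => conj (g p) * (u (heisMul (-q) p) * φ q))
      (volume.prod volume) := by
  have hm : StronglyMeasurable (Function.uncurry fun p q : Heisenberg d =>
      conj (g p) * (u (heisMul (-q) p) * φ q)) := by
    refine StronglyMeasurable.mul ?_ (StronglyMeasurable.mul ?_ ?_)
    · exact (Complex.continuous_conj.comp (hg.1.continuous.comp continuous_fst)).stronglyMeasurable
    · exact (stronglyMeasurable_comp_neg_heisMul hum).comp_measurable measurable_swap
    · exact (hφ.1.continuous.comp continuous_snd).stronglyMeasurable
  have huq : ∀ q, MemLp (fun p => u (heisMul (-q) p)) 2 volume := fun q =>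
    hu.comp_measurePreserving (measurePreserving_heisMul_left (-q))
  have hgL := memLp_of_mem_testFunctions hg
  rw [integrable_prod_iff' hm.aestronglyMeasurable]
  constructor
  · refine Eventually.of_forall fun q => ?_
    have := (MemLp.integrable_mul hgL.star (huq q)).mul_const (φ q)
    simpa only [Function.uncurry, Pi.mul_apply, Pi.star_apply, RCLike.star_def, mul_assoc] using this
  · have hbd : Integrable (fun q : Heisenberg d =>
        ‖φ q‖ * ((∫ p, ‖g p‖ ^ 2) + ∫ p, ‖u p‖ ^ 2)) volume :=
      (integrable_of_mem_testFunctions hφ).norm.mul_const _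
    refine hbd.mono' (hm.norm.integral_prod_left').aestronglyMeasurable
      (Eventually.of_forall fun q => ?_)
    rw [Real.norm_of_nonneg (integral_nonneg fun p => norm_nonneg _)]
    have hu2 : ∫ p, ‖u (heisMul (-q) p)‖ ^ 2 = ∫ p, ‖u p‖ ^ 2 :=
      (measurePreserving_heisMul_left (-q)).integral_comp
        (heisMulLeft (-q)).measurableEmbedding fun p => ‖u p‖ ^ 2
    rw [← hu2, ← integral_add hgL.integrable_sq_norm (huq q).integrable_sq_norm,
      ← integral_const_mul]
    refine integral_mono_of_nonneg (Eventually.of_forall fun p => norm_nonneg _)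
      ((hgL.integrable_sq_norm.add (huq q).integrable_sq_norm).const_mul _)
      (Eventually.of_forall fun p => ?_)
    simp only [Function.uncurry, norm_mul, RCLike.norm_conj]
    nlinarith [mul_nonneg (norm_nonneg (φ q)) (sq_nonneg (‖g p‖ - ‖u (heisMul (-q) p)‖)),
      mul_nonneg (norm_nonneg (φ q)) (sq_nonneg (‖g p‖ + ‖u (heisMul (-q) p)‖))]

/-- Left-regularization of a weak solution of `lam u = L u` is a weak solution. -/
theorem integral_conj_mul_leftMollify {lam : ℝ} {φ u : Heisenberg d → ℂ}
    (hφ : φ ∈ testFunctions d) (hum : StronglyMeasurable u) (hu : MemLp u 2 volume)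
    (hweak : ∀ f ∈ testFunctions d, ∫ p, conj (lam * f p - subLaplacianExpr f p) * u p = 0)
    {f : Heisenberg d → ℂ} (hf : f ∈ testFunctions d) :
    ∫ p, conj (lam * f p - subLaplacianExpr f p) * leftMollify φ u p = 0 := by
  set g : Heisenberg d → ℂ := fun p => lam * f p - subLaplacianExpr f p with hg
  have hgt : g ∈ testFunctions d :=
    (testFunctions d).sub_mem ((testFunctions d).smul_mem (lam : ℂ) hf)
      (subLaplacianExpr_mem_testFunctions hf)
  have h1 : ∀ p, conj (g p) * leftMollify φ u p =
      ∫ q, conj (g p) * (u (heisMul (-q) p) * φ q) := fun p => by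
    rw [leftMollify_eq, integral_const_mul]
  change ∫ p, conj (g p) * leftMollify φ u p = 0
  simp only [h1]
  -- For fixed q, the substitution p = qr turns the inner integral into that of u against (λ - L)f(q
  -- ·), by left-invariance of L. It vanishes because f(q ·) is again a test function.
  rw [integral_integral_swap (integrable_prod_leftMollify hφ hgt hum hu)]
  refine integral_eq_zero_of_ae (Eventually.of_forall fun q => ?_)
  have h2 := (measurePreserving_heisMul_left (-q)).integral_comp
    (heisMulLeft (-q)).measurableEmbedding fun r => conj (g (heisMul q r)) * u r
  have h3 : ∀ p, heisMul q (heisMul (-q) p) = p := fun p => by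
    simpa using neg_heisMul_cancel (-q) p
  simp only [h3] at h2
  have h4 := hweak _ (comp_heisMul_mem_testFunctions hf q)
  simp only [subLaplacianExpr_comp_heisMul hf] at h4
  simp only [← mul_assoc, integral_mul_const]
  rw [h2]
  simp only [hg]
  rw [h4, zero_mul]
  rfl

end Heisenberg

section Heisenberg

variable {d : ℕ}

/-! ### The Caccioppoli inequality -/

theorem horizontalField_ofReal_sq_mul (ζ : HorizontalSpace d) {χ : Heisenberg d → ℝ}
    {v : Heisenberg d → ℂ} {p : Heisenberg d} (hχ : DifferentiableAt ℝ χ p)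
    (hv : DifferentiableAt ℝ v p) :
    horizontalField ζ (fun p => ((χ p ^ 2 : ℝ) : ℂ) * v p) p =
      ((2 * χ p * fderiv ℝ χ p (ζ, sigmaForm p.1 ζ) : ℝ) : ℂ) * v p +
        ((χ p ^ 2 : ℝ) : ℂ) * horizontalField ζ v p := by
  have h1 := (Complex.ofRealCLM.hasFDerivAt.comp p (hχ.hasFDerivAt.pow 2)).mul hv.hasFDerivAt
  refine (DFunLike.congr_fun h1.fderiv _).trans ?_
  simp [horizontalField]
  ring

/-- Completing the square: the right side is |xw + av|² - a²|v|². Here x, a, w stand for the cutoff,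
its horizontal derivative and the horizontal derivative of the solution v. -/
theorem neg_sq_mul_le_re_conj_mul (a x : ℝ) (v w : ℂ) :
    -(a ^ 2 * ‖v‖ ^ 2) ≤ (conj (((2 * x * a : ℝ) : ℂ) * v + ((x ^ 2 : ℝ) : ℂ) * w) * w).re := by
  have h : (conj (((2 * x * a : ℝ) : ℂ) * v + ((x ^ 2 : ℝ) : ℂ) * w) * w).re + a ^ 2 * ‖v‖ ^ 2 =
      (x * w.re + a * v.re) ^ 2 + (x * w.im + a * v.im) ^ 2 := by
    rw [← Complex.normSq_eq_norm_sq, Complex.normSq_apply]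
    simp only [map_add, map_mul, Complex.conj_ofReal, Complex.mul_re, Complex.add_re,
      Complex.add_im, Complex.mul_im, Complex.ofReal_re, Complex.ofReal_im, Complex.conj_re,
      Complex.conj_im]
    ring
  nlinarith [sq_nonneg (x * w.re + a * v.re), sq_nonneg (x * w.im + a * v.im)]

/-- The Caccioppoli inequality for smooth weak solutions of `lam v = L v`. -/
theorem caccioppoli {lam : ℝ} {v : Heisenberg d → ℂ} (hv : ContDiff ℝ ∞ v)
    (hweak : ∀ f ∈ testFunctions d, ∫ p, conj (lam * f p - subLaplacianExpr f p) * v p = 0)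
    {χ : Heisenberg d → ℝ} (hχ : ContDiff ℝ ∞ χ) (hχc : HasCompactSupport χ) :
    lam * ∫ p, χ p ^ 2 * ‖v p‖ ^ 2 ≤
      ∑ j, ∫ p, (fderiv ℝ χ p (horizontalBasis j, sigmaForm p.1 (horizontalBasis j))) ^ 2 *
        ‖v p‖ ^ 2 := by
  have hf : (fun p => ((χ p ^ 2 : ℝ) : ℂ) * v p) ∈ testFunctions d := by
    have h1 := ofReal_mem_testFunctions (g := fun p => χ p ^ 2) (hχ.pow 2)
      (hχc.comp_left (g := fun r : ℝ => r ^ 2) (by simp))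
    exact ⟨h1.1.mul hv, h1.2.mul_right⟩
  set f : Heisenberg d → ℂ := fun p => ((χ p ^ 2 : ℝ) : ℂ) * v p with hfd
  have h1 := hweak f hf
  have h2 : ∀ p, conj (lam * f p - subLaplacianExpr f p) * v p =
      lam * (conj (f p) * v p) - conj (subLaplacianExpr f p) * v p := fun p => by
    rw [map_sub, map_mul, Complex.conj_ofReal]; ring
  simp only [h2] at h1
  rw [integral_sub ((integrable_of_mem_testFunctions (conj_mul_mem_testFunctions hf hv)).const_mul _)
    (integrable_of_mem_testFunctions (conj_mul_mem_testFunctions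
      (subLaplacianExpr_mem_testFunctions hf) hv)), integral_const_mul,
    integral_conj_subLaplacianExpr_mul hf hv, sub_neg_eq_add] at h1
  have h3 : ∫ p, conj (f p) * v p = ((∫ p, χ p ^ 2 * ‖v p‖ ^ 2 : ℝ) : ℂ) := by
    rw [← integral_complex_ofReal]
    refine integral_congr_ae (Eventually.of_forall fun p => ?_)
    simp only [hfd, map_mul, Complex.conj_ofReal, mul_assoc, Complex.conj_mul']
    push_cast
    ring
  have h4 := congrArg Complex.re h1
  rw [h3, Complex.add_re, ← Complex.ofReal_mul, Complex.ofReal_re, Complex.re_sum,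
    Complex.zero_re] at h4
  have h5 : ∀ j, -∫ p, (fderiv ℝ χ p (horizontalBasis j, sigmaForm p.1 (horizontalBasis j))) ^ 2 *
      ‖v p‖ ^ 2 ≤ (∫ p, conj (horizontalField (horizontalBasis j) f p) *
        horizontalField (horizontalBasis j) v p).re := by
    intro j
    have hint := integrable_of_mem_testFunctions (conj_mul_mem_testFunctions
      (horizontalField_mem_testFunctions (horizontalBasis j) hf)
      (contDiff_horizontalField (horizontalBasis j) hv))
    have hre : (∫ p, conj (horizontalField (horizontalBasis j) f p) *
        horizontalField (horizontalBasis j) v p).re = ∫ p,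
        (conj (horizontalField (horizontalBasis j) f p) *
          horizontalField (horizontalBasis j) v p).re := (integral_re hint).symm
    rw [hre, ← integral_neg]
    refine integral_mono ?_ hint.re fun p => ?_
    · have hcont : Continuous fun p : Heisenberg d =>
          fderiv ℝ χ p (horizontalBasis j, sigmaForm p.1 (horizontalBasis j)) :=
        (hχ.continuous_fderiv (by simp)).clm_apply
          (continuous_const.prodMk (continuous_fst.sigmaForm continuous_const))
      refine (Continuous.integrable_of_hasCompactSupport
        ((hcont.pow 2).mul (hv.continuous.norm.pow 2)) ?_).neg
      refine (hχc.fderiv ℝ).mono' fun p hp => subset_tsupport _ fun h => hp ?_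
      simp [h]
    · simp only [hfd, horizontalField_ofReal_sq_mul (horizontalBasis j)
        (hχ.differentiable (by simp) p) (hv.differentiable (by simp) p)]
      exact neg_sq_mul_le_re_conj_mul _ _ _ _
  have h6 := Finset.sum_le_sum fun j (_ : j ∈ Finset.univ) => h5 j
  rw [Finset.sum_neg_distrib] at h6
  linarith

/-! ### Cutoffs -/

/-- The homogeneous dilation `(z, s) ↦ (r z, r² s)`. -/
noncomputable def heisDilation (r : ℝ) : Heisenberg d →L[ℝ] Heisenberg d :=
  (r • ContinuousLinearMap.fst ℝ (HorizontalSpace d) ℝ).prod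
    (r ^ 2 • ContinuousLinearMap.snd ℝ (HorizontalSpace d) ℝ)

theorem heisDilation_apply (r : ℝ) (p : Heisenberg d) :
    heisDilation r p = (r • p.1, r ^ 2 * p.2) := rfl

theorem heisDilation_inv_cancel {r : ℝ} (hr : r ≠ 0) (p : Heisenberg d) :
    heisDilation r⁻¹ (heisDilation r p) = p := by
  simp only [heisDilation_apply, smul_smul, inv_mul_cancel₀ hr, one_smul]
  rw [← mul_assoc, ← mul_pow, inv_mul_cancel₀ hr, one_pow, one_mul]

theorem hasCompactSupport_comp_heisDilation {r : ℝ} (hr : r ≠ 0) {η : Heisenberg d → ℝ}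
    (hη : HasCompactSupport η) : HasCompactSupport fun p => η (heisDilation r p) :=
  hη.comp_homeomorph
    { toFun := heisDilation r
      invFun := heisDilation r⁻¹
      left_inv := heisDilation_inv_cancel hr
      right_inv := fun p => by simpa using heisDilation_inv_cancel (inv_ne_zero hr) p
      continuous_toFun := (heisDilation r).continuous
      continuous_invFun := (heisDilation r⁻¹).continuous }

/-- Horizontal fields are homogeneous of degree one. So the horizontal derivatives of a dilated
cutoff shrink uniformly by the factor r, although the coefficients of the fields grow linearly in z.
-/
theorem fderiv_comp_heisDilation {η : Heisenberg d → ℝ} (hη : Differentiable ℝ η) (r : ℝ)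
    (ζ : HorizontalSpace d) (p : Heisenberg d) :
    fderiv ℝ (fun p => η (heisDilation r p)) p (ζ, sigmaForm p.1 ζ) =
      r * fderiv ℝ η (heisDilation r p) (ζ, sigmaForm (heisDilation r p).1 ζ) := by
  have h := (hη (heisDilation r p)).hasFDerivAt.comp p (heisDilation r).hasFDerivAt
  refine (DFunLike.congr_fun h.fderiv _).trans ?_
  rw [ContinuousLinearMap.comp_apply, ← smul_eq_mul, ← map_smul]
  congr 1
  simp only [heisDilation_apply, sigmaForm_smul_left, Prod.smul_mk, smul_eq_mul, Prod.mk.injEq,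
    true_and]
  ring

theorem exists_cutoff (d : ℕ) : ∃ (η : Heisenberg d → ℝ) (M : ℝ), ContDiff ℝ ∞ η ∧
    HasCompactSupport η ∧ η 0 = 1 ∧ (∀ p, |η p| ≤ 1) ∧
    ∀ j p, |fderiv ℝ η p (horizontalBasis j, sigmaForm p.1 (horizontalBasis j))| ≤ M := by
  let b : ContDiffBump (0 : Heisenberg d) := ⟨1, 2, one_pos, one_lt_two⟩
  have hb : ContDiff ℝ ∞ b := b.contDiff
  have h1 : ∀ j, ∃ M, ∀ p : Heisenberg d,
      |fderiv ℝ b p (horizontalBasis j, sigmaForm p.1 (horizontalBasis j))| ≤ M := by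
    intro j
    refine HasCompactSupport.exists_bound_of_continuous (f := fun p : Heisenberg d =>
      fderiv ℝ b p (horizontalBasis j, sigmaForm p.1 (horizontalBasis j))) ?_
      ((hb.continuous_fderiv (by simp)).clm_apply
          (continuous_const.prodMk (continuous_fst.sigmaForm continuous_const)))
    refine (b.hasCompactSupport.fderiv ℝ).mono' fun p hp => subset_tsupport _ fun h => hp ?_
    simp [h]
  choose M hM using h1
  refine ⟨b, ∑ j, |M j|, hb, b.hasCompactSupport, ?_, fun p => ?_, fun j p => ?_⟩
  · exact b.one_of_mem_closedBall (by simp [b])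
  · rw [abs_of_nonneg b.nonneg]; exact b.le_one
  · exact (hM j p).trans ((le_abs_self _).trans
      (Finset.single_le_sum (f := fun j => |M j|) (fun i _ => abs_nonneg _) (Finset.mem_univ j)))

/-- Smooth square integrable weak solutions of `lam v = L v` vanish. -/
theorem eq_zero_of_weak_solution {lam : ℝ} (hlam : 0 < lam) {v : Heisenberg d → ℂ}
    (hv : ContDiff ℝ ∞ v) (hv2 : MemLp v 2 volume)
    (hweak : ∀ f ∈ testFunctions d, ∫ p, conj (lam * f p - subLaplacianExpr f p) * v p = 0) :
    v = 0 := by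
  obtain ⟨η, M, hη, hηc, hη0, hη1, hM⟩ := exists_cutoff d
  have hsq := hv2.integrable_sq_norm
  -- As r k → 0 the dilated cutoffs tend to η 0 = 1 pointwise, while the right side of `caccioppoli`
  -- is O((r k)²).
  let r : ℕ → ℝ := fun k => 1 / ((k : ℝ) + 1)
  have hr : ∀ k, r k ≠ 0 := fun k => by positivity
  have hr0 : Tendsto r atTop (𝓝 0) := tendsto_one_div_add_atTop_nhds_zero_nat
  have hbound : ∀ k, lam * ∫ p, η (heisDilation (r k) p) ^ 2 * ‖v p‖ ^ 2 ≤
      ∑ _j : Fin d ⊕ Fin d, (r k) ^ 2 * (M ^ 2 * ∫ p, ‖v p‖ ^ 2) := by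
    intro k
    refine (caccioppoli hv hweak (hη.comp (heisDilation (r k)).contDiff)
      (hasCompactSupport_comp_heisDilation (hr k) hηc)).trans ?_
    refine Finset.sum_le_sum fun j _ => ?_
    rw [← mul_assoc, ← integral_const_mul]
    refine integral_mono_of_nonneg (Eventually.of_forall fun p => by positivity)
      (hsq.const_mul _) (Eventually.of_forall fun p => ?_)
    have h1 := fderiv_comp_heisDilation (hη.differentiable (by simp)) (r k) (horizontalBasis j) p
    simp only [Function.comp_def]
    rw [h1, mul_pow]
    refine mul_le_mul_of_nonneg_right (mul_le_mul_of_nonneg_left ?_ (sq_nonneg _)) (sq_nonneg _)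
    exact sq_le_sq' (by linarith [neg_abs_le (fderiv ℝ η (heisDilation (r k) p) (horizontalBasis j,
      sigmaForm (heisDilation (r k) p).1 (horizontalBasis j))), hM j (heisDilation (r k) p)])
      ((le_abs_self _).trans (hM j _))
  have hlim : Tendsto (fun k => ∫ p, η (heisDilation (r k) p) ^ 2 * ‖v p‖ ^ 2) atTop
      (𝓝 (∫ p, ‖v p‖ ^ 2)) := by
    refine tendsto_integral_of_dominated_convergence (fun p => ‖v p‖ ^ 2) (fun k => ?_) hsq
      (fun k => Eventually.of_forall fun p => ?_) (Eventually.of_forall fun p => ?_)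
    · exact (((hη.continuous.comp (heisDilation (r k)).continuous).pow 2).mul
        (hv.continuous.norm.pow 2)).aestronglyMeasurable
    · rw [Real.norm_of_nonneg (by positivity)]
      refine mul_le_of_le_one_left (by positivity) ?_
      rw [← sq_abs]
      exact pow_le_one₀ (abs_nonneg _) (hη1 _)
    · have h1 : Tendsto (fun k => heisDilation (r k) p) atTop (𝓝 0) := by
        have h2 : Continuous fun t : ℝ => heisDilation t p := by
          simp only [heisDilation_apply]; fun_prop
        have h3 := (h2.tendsto 0).comp hr0
        simpa [heisDilation_apply, Function.comp_def, Prod.mk_zero_zero] using h3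
      have h4 := ((hη.continuous.tendsto 0).comp h1).pow 2 |>.mul_const (‖v p‖ ^ 2)
      simpa [hη0] using h4
  have hlim2 : Tendsto (fun k => ∑ _j : Fin d ⊕ Fin d, (r k) ^ 2 * (M ^ 2 * ∫ p, ‖v p‖ ^ 2)) atTop
      (𝓝 0) := by
    have := tendsto_finsetSum (Finset.univ : Finset (Fin d ⊕ Fin d)) fun j _ =>
      (hr0.pow 2).mul_const (M ^ 2 * ∫ p, ‖v p‖ ^ 2)
    simpa using this
  have hle := le_of_tendsto_of_tendsto' (hlim.const_mul lam) hlim2 hbound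
  have hzero : ∫ p, ‖v p‖ ^ 2 = 0 :=
    le_antisymm (nonpos_of_mul_nonpos_right hle hlam) (integral_nonneg fun p => by positivity)
  rw [integral_eq_zero_iff_of_nonneg (fun p => by positivity) hsq] at hzero
  refine (Continuous.ae_eq_iff_eq volume hv.continuous continuous_zero).1 ?_
  filter_upwards [hzero] with p hp
  simpa using hp

/-! ### Self-adjointness of the sub-Laplacian -/

theorem dense_range_sub_subLaplacianCore (d : ℕ) {lam : ℝ} (hlam : 0 < lam) :
    Dense ((fun p : L2Heis d × L2Heis d => (lam : ℂ) • p.1 - p.2) ''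
      (subLaplacianCore d).graph) := by
  let F : L2Heis d × L2Heis d →ₗ[ℂ] L2Heis d :=
    (lam : ℂ) • LinearMap.fst ℂ _ _ - LinearMap.snd ℂ _ _
  have hF : (fun p : L2Heis d × L2Heis d => (lam : ℂ) • p.1 - p.2) '' (subLaplacianCore d).graph =
      ((subLaplacianCore d).graph.map F : Set (L2Heis d)) := by
    rw [Submodule.map_coe]; rfl
  rw [hF, Submodule.dense_iff_topologicalClosure_eq_top, Submodule.topologicalClosure_eq_top_iff,
    Submodule.eq_bot_iff]
  intro u hu
  rw [Submodule.mem_orthogonal] at hu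
  have hum := Lp.stronglyMeasurable u
  have hu2 := Lp.memLp u
  have hweak : ∀ f ∈ testFunctions d, ∫ p, conj (lam * f p - subLaplacianExpr f p) * u p = 0 := by
    intro f hf
    have h1 := hu _ (Submodule.mem_map_of_mem (mem_graph_subLaplacianCore.2 ⟨⟨f, hf⟩, rfl, rfl⟩))
    have h2 : F (testToL2 d ⟨f, hf⟩, testToL2 d (subLaplacianTest d ⟨f, hf⟩)) =
        testToL2 d ((lam : ℂ) • ⟨f, hf⟩ - subLaplacianTest d ⟨f, hf⟩) := by
      rw [map_sub, map_smul]; rfl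
    rw [h2, inner_testToL2_left] at h1
    exact h1
  have hmoll : ∀ φ ∈ testFunctions d, leftMollify φ u = 0 := fun φ hφ =>
    eq_zero_of_weak_solution hlam (contDiff_leftMollify hφ (locallyIntegrable_L2Heis u))
      (memLp_leftMollify hφ hum hu2) fun f hf => integral_conj_mul_leftMollify hφ hum hu2 hweak hf
  refine (Lp.eq_zero_iff_ae_eq_zero).2 (eq_zero_of_forall_integral_mul
    (locallyIntegrable_L2Heis u) fun g hg hgc => ?_)
  -- At p = 0 the mollification is ∫ u(r)φ(r⁻¹) dr with r⁻¹ = -r, so the reflected test function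
  -- recovers ∫ g u.
  have hφ := ofReal_mem_testFunctions (g := fun p => g (-p)) (hg.comp contDiff_neg)
    (hgc.comp_homeomorph (Homeomorph.neg _))
  have h1 := congrFun (hmoll _ hφ) 0
  simpa [leftMollify, zero_heisMul, mul_comm] using h1

theorem range_sub_subLaplacian (d : ℕ) {lam : ℝ} (hlam : 0 < lam) (w : L2Heis d) :
    ∃ x y, (x, y) ∈ (subLaplacian d).graph ∧ (lam : ℂ) • x - y = w := by
  refine range_eq_univ_of_dense hlam (isClosed_subLaplacian d) (fun x y h => ?_)
    ((dense_range_sub_subLaplacianCore d hlam).mono (Set.image_mono fun p hp => ?_)) w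
  · rw [zero_mul]
    exact subLaplacian_nonpos x y h
  · exact mem_graph_subLaplacian.2 (subset_closure hp)

theorem isSelfAdjoint_subLaplacian (d : ℕ) : IsSelfAdjoint (subLaplacian d) :=
  isSelfAdjoint_of_range (lam := 1) (dense_domain_subLaplacian d) subLaplacian_symmetric
    (range_sub_subLaplacian d one_pos)

end Heisenberg

section Gaussian

variable {d : ℕ}

/-! ### Moments of the standard Gaussian measure -/

instance isProbabilityMeasure_stdGauss : IsProbabilityMeasure (stdGauss d) := by
  unfold stdGauss; infer_instance

/-- The coordinates on `ℝ^{2d}` dual to `horizontalBasis`. -/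
def horizontalCoord (j : Fin d ⊕ Fin d) (ζ : HorizontalSpace d) : ℝ :=
  Sum.elim ζ.1 ζ.2 j

theorem sum_horizontalCoord_smul (ζ : HorizontalSpace d) :
    ∑ j, horizontalCoord j ζ • horizontalBasis j = ζ := by
  have h : ∀ x : Fin d → ℝ, ∑ i, x i • (Pi.single i 1 : Fin d → ℝ) = x := fun x => by
    funext k
    simp [Finset.sum_apply, Pi.single_apply]
  rw [Fintype.sum_sum_type]
  ext k
  · simpa [horizontalCoord, horizontalBasis, Prod.fst_sum] using congrFun (h ζ.1) k
  · simpa [horizontalCoord, horizontalBasis, Prod.snd_sum] using congrFun (h ζ.2) k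

theorem measurePreserving_horizontalCoord (j : Fin d ⊕ Fin d) :
    MeasurePreserving (horizontalCoord j) (stdGauss d) (gaussianReal 0 1) := by
  rcases j with i | i
  · exact (measurePreserving_eval (fun _ : Fin d => gaussianReal 0 1) i).comp measurePreserving_fst
  · exact (measurePreserving_eval (fun _ : Fin d => gaussianReal 0 1) i).comp measurePreserving_snd

theorem memLp_horizontalCoord (j : Fin d ⊕ Fin d) {p : ℝ≥0∞} (hp : p ≠ ⊤) :
    MemLp (horizontalCoord j) p (stdGauss d) :=
  (memLp_id_gaussianReal' p hp).comp_measurePreserving (measurePreserving_horizontalCoord j)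

theorem integral_horizontalCoord (j : Fin d ⊕ Fin d) :
    ∫ ζ, horizontalCoord j ζ ∂(stdGauss d) = 0 := by
  have h := measurePreserving_horizontalCoord j
  have h1 := integral_map h.aemeasurable (f := fun x : ℝ => x)
    (measurable_id.aestronglyMeasurable)
  rw [← h1, h.map_eq, integral_id_gaussianReal]

theorem integral_sq_horizontalCoord (j : Fin d ⊕ Fin d) :
    ∫ ζ, horizontalCoord j ζ * horizontalCoord j ζ ∂(stdGauss d) = 1 := by
  have h := measurePreserving_horizontalCoord j
  have h1 := integral_map h.aemeasurable (f := fun x : ℝ => x * x)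
    (by fun_prop)
  have h2 := variance_of_integral_eq_zero (μ := gaussianReal 0 1) (X := fun x : ℝ => x)
    (by fun_prop) integral_id_gaussianReal
  rw [variance_fun_id_gaussianReal] at h2
  rw [← h1, h.map_eq]
  simpa [sq] using h2.symm

theorem integral_horizontalCoord_mul_of_ne {j k : Fin d ⊕ Fin d} (hjk : j ≠ k) :
    ∫ ζ, horizontalCoord j ζ * horizontalCoord k ζ ∂(stdGauss d) = 0 := by
  have hind : ∀ i l : Fin d, i ≠ l →
      ∫ x : Fin d → ℝ, x i * x l ∂(Measure.pi fun _ => gaussianReal 0 1) = 0 := by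
    intro i l hil
    have h1 := (iIndepFun_pi (μ := fun _ : Fin d => gaussianReal 0 1) (X := fun _ x => x)
      fun _ => aemeasurable_id).indepFun hil
    have h2 := h1.integral_fun_mul_eq_mul_integral
      (measurable_pi_apply i).aestronglyMeasurable (measurable_pi_apply l).aestronglyMeasurable
    have h3 := integral_map (measurePreserving_eval (fun _ : Fin d => gaussianReal 0 1) i).aemeasurable
      (f := fun x : ℝ => x) (by fun_prop)
    rw [(measurePreserving_eval (fun _ : Fin d => gaussianReal 0 1) i).map_eq,
      integral_id_gaussianReal] at h3
    rw [h2]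
    simp only [Function.eval] at h3
    rw [← h3, zero_mul]
  have hcross : ∀ i l : Fin d,
      ∫ ζ : HorizontalSpace d, ζ.1 i * ζ.2 l ∂(stdGauss d) = 0 := by
    intro i l
    have h1 := integral_prod_mul (μ := Measure.pi fun _ : Fin d => gaussianReal 0 1)
      (ν := Measure.pi fun _ : Fin d => gaussianReal 0 1) (fun x : Fin d → ℝ => x i) fun y => y l
    have h3 := integral_map (measurePreserving_eval (fun _ : Fin d => gaussianReal 0 1) i).aemeasurable
      (f := fun x : ℝ => x) (by fun_prop)
    rw [(measurePreserving_eval (fun _ : Fin d => gaussianReal 0 1) i).map_eq,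
      integral_id_gaussianReal] at h3
    simp only [Function.eval] at h3
    rw [stdGauss, h1, ← h3, zero_mul]
  rcases j with i | i <;> rcases k with l | l
  · have h1 := integral_map (μ := stdGauss d) measurable_fst.aemeasurable
      (f := fun x : Fin d → ℝ => x i * x l) (by fun_prop)
    change ∫ ζ : HorizontalSpace d, ζ.1 i * ζ.1 l ∂(stdGauss d) = 0
    rw [← h1, stdGauss, measurePreserving_fst.map_eq]
    exact hind i l fun h => hjk (h ▸ rfl)
  · exact hcross i l
  · exact (integral_congr_ae (Eventually.of_forall fun ζ => mul_comm _ _)).trans (hcross l i)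
  · have h1 := integral_map (μ := stdGauss d) measurable_snd.aemeasurable
      (f := fun x : Fin d → ℝ => x i * x l) (by fun_prop)
    change ∫ ζ : HorizontalSpace d, ζ.2 i * ζ.2 l ∂(stdGauss d) = 0
    rw [← h1, stdGauss, measurePreserving_snd.map_eq]
    exact hind i l fun h => hjk (h ▸ rfl)

theorem integrable_horizontalCoord (j : Fin d ⊕ Fin d) :
    Integrable (horizontalCoord j) (stdGauss d) :=
  (memLp_horizontalCoord j (p := 1) (by simp)).integrable le_rfl

theorem integrable_horizontalCoord_mul (j k : Fin d ⊕ Fin d) :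
    Integrable (fun ζ => horizontalCoord j ζ * horizontalCoord k ζ) (stdGauss d) :=
  (memLp_horizontalCoord j (p := 2) (by simp)).integrable_mul (memLp_horizontalCoord k (p := 2) (by simp))

theorem norm_horizontalSpace_le (ζ : HorizontalSpace d) : ‖ζ‖ ≤ ∑ j, |horizontalCoord j ζ| := by
  have h : ∀ j, |horizontalCoord j ζ| ≤ ∑ j, |horizontalCoord j ζ| := fun j =>
    Finset.single_le_sum (f := fun j => |horizontalCoord j ζ|) (fun i _ => abs_nonneg _)
      (Finset.mem_univ j)
  have h0 : 0 ≤ ∑ j, |horizontalCoord j ζ| := Finset.sum_nonneg fun j _ => abs_nonneg _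
  rw [Prod.norm_def, max_le_iff, pi_norm_le_iff_of_nonneg h0, pi_norm_le_iff_of_nonneg h0]
  exact ⟨fun i => h (.inl i), fun i => h (.inr i)⟩

theorem integrable_one_add_norm_pow (d n : ℕ) :
    Integrable (fun ζ : HorizontalSpace d => (1 + ‖ζ‖) ^ n) (stdGauss d) := by
  have h1 : MemLp (fun ζ : HorizontalSpace d => ∑ j, |horizontalCoord j ζ|) n (stdGauss d) :=
    memLp_finsetSum _ fun j _ => (memLp_horizontalCoord j (by simp)).abs
  have h2 : MemLp (fun ζ : HorizontalSpace d => 1 + ‖ζ‖) n (stdGauss d) := by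
    refine ((memLp_const (1 : ℝ)).add h1).of_le (by fun_prop) (Eventually.of_forall fun ζ => ?_)
    rw [Real.norm_of_nonneg (by positivity), Pi.add_apply, Real.norm_of_nonneg (by positivity)]
    linarith [norm_horizontalSpace_le ζ]
  refine h2.integrable_norm_pow' |>.congr (Eventually.of_forall fun ζ => ?_)
  simp only
  rw [Real.norm_of_nonneg (by positivity)]

/-- A linear function has mean zero. -/
theorem integral_linear_stdGauss (Λ : HorizontalSpace d →ₗ[ℝ] ℂ) :
    Integrable (fun ζ => Λ ζ) (stdGauss d) ∧ ∫ ζ, Λ ζ ∂(stdGauss d) = 0 := by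
  have h : ∀ ζ, Λ ζ = ∑ j, ((horizontalCoord j ζ : ℝ) : ℂ) * Λ (horizontalBasis j) := fun ζ => by
    nth_rewrite 1 [← sum_horizontalCoord_smul ζ]
    simp [map_sum]
  have hi : ∀ j, Integrable (fun ζ => ((horizontalCoord j ζ : ℝ) : ℂ) * Λ (horizontalBasis j))
      (stdGauss d) := fun j => (integrable_horizontalCoord j).ofReal.mul_const _
  have hae := Eventually.of_forall (f := ae (stdGauss d)) h
  refine ⟨(integrable_finsetSum _ fun j _ => hi j).congr (hae.mono fun ζ h => h.symm), ?_⟩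
  rw [integral_congr_ae hae, integral_finsetSum _ fun j _ => hi j]
  refine Finset.sum_eq_zero fun j _ => ?_
  rw [integral_mul_const, integral_complex_ofReal, integral_horizontalCoord, Complex.ofReal_zero,
    zero_mul]

/-- The mean of a quadratic form is its trace. -/
theorem integral_quadratic_stdGauss (Λ : HorizontalSpace d →ₗ[ℝ] HorizontalSpace d →ₗ[ℝ] ℂ) :
    Integrable (fun ζ => Λ ζ ζ) (stdGauss d) ∧
      ∫ ζ, Λ ζ ζ ∂(stdGauss d) = ∑ j, Λ (horizontalBasis j) (horizontalBasis j) := by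
  have h : ∀ ζ, Λ ζ ζ = ∑ j, ∑ k, ((horizontalCoord j ζ * horizontalCoord k ζ : ℝ) : ℂ) *
      Λ (horizontalBasis j) (horizontalBasis k) := fun ζ => by
    have h1 : Λ ζ ζ = Λ (∑ j, horizontalCoord j ζ • horizontalBasis j)
        (∑ k, horizontalCoord k ζ • horizontalBasis k) := by rw [sum_horizontalCoord_smul]
    rw [h1]
    simp only [map_sum, map_smul, LinearMap.sum_apply, LinearMap.smul_apply, Complex.real_smul,
      Finset.mul_sum]
    rw [Finset.sum_comm]
    refine Finset.sum_congr rfl fun j _ => Finset.sum_congr rfl fun k _ => ?_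
    push_cast
    ring
  have hi : ∀ j k, Integrable (fun ζ => ((horizontalCoord j ζ * horizontalCoord k ζ : ℝ) : ℂ) *
      Λ (horizontalBasis j) (horizontalBasis k)) (stdGauss d) := fun j k =>
    (integrable_horizontalCoord_mul j k).ofReal.mul_const _
  have hae := Eventually.of_forall (f := ae (stdGauss d)) h
  refine ⟨(integrable_finsetSum _ fun j _ => integrable_finsetSum _ fun k _ => hi j k).congr
    (hae.mono fun ζ h => h.symm), ?_⟩
  rw [integral_congr_ae hae, integral_finsetSum _ fun j _ => integrable_finsetSum _ fun k _ => hi j k]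
  refine Finset.sum_congr rfl fun j _ => ?_
  rw [integral_finsetSum _ fun k _ => hi j k, Finset.sum_eq_single j]
  · rw [integral_mul_const, integral_complex_ofReal, integral_sq_horizontalCoord,
      Complex.ofReal_one, one_mul]
  · intro k _ hk
    rw [integral_mul_const, integral_complex_ofReal, integral_horizontalCoord_mul_of_ne hk.symm,
      Complex.ofReal_zero, zero_mul]
  · simp

/-! ### Second order Taylor expansion along lines -/

/-- The bound on the third derivative is integrated three times by the mean value inequality; the
factor 1/6 is not kept. -/
theorem norm_taylor_two_le {A A₁ A₂ A₃ : ℝ → ℂ} {C r : ℝ} (hr : 0 ≤ r)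
    (h0 : ∀ u, HasDerivAt A (A₁ u) u) (h1 : ∀ u, HasDerivAt A₁ (A₂ u) u)
    (h2 : ∀ u, HasDerivAt A₂ (A₃ u) u) (hC : ∀ u, ‖A₃ u‖ ≤ C) :
    ‖A r - A 0 - r * A₁ 0 - r ^ 2 / 2 * A₂ 0‖ ≤ C * r ^ 3 := by
  have hC0 : 0 ≤ C := (norm_nonneg _).trans (hC 0)
  have hid : ∀ u : ℝ, HasDerivAt (fun u : ℝ => (u : ℂ)) 1 u := fun u => by
    simpa using (hasDerivAt_id (u : ℂ)).comp_ofReal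
  have b2 : ∀ u ∈ Set.Icc 0 r, ‖A₂ u - A₂ 0‖ ≤ C * r := by
    intro u hu
    refine (norm_image_sub_le_of_norm_deriv_le_segment' (f' := A₃) (C := C)
      (fun x _ => (h2 x).hasDerivWithinAt) (fun x _ => hC x) u ⟨hu.1, le_rfl⟩).trans ?_
    gcongr
    linarith [hu.2]
  have b1 : ∀ u ∈ Set.Icc 0 r, ‖A₁ u - A₁ 0 - u * A₂ 0‖ ≤ C * r ^ 2 := by
    intro u hu
    have := norm_image_sub_le_of_norm_deriv_le_segment' (a := 0) (b := u)
      (f := fun u => A₁ u - u * A₂ 0) (f' := fun u => A₂ u - 1 * A₂ 0) (C := C * r)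
      (fun x _ => ((h1 x).sub ((hid x).mul_const _)).hasDerivWithinAt)
      (fun x hx => by rw [one_mul]; exact b2 x ⟨hx.1, hx.2.le.trans hu.2⟩) u ⟨hu.1, le_rfl⟩
    calc _ = ‖A₁ u - u * A₂ 0 - (A₁ 0 - ((0 : ℝ) : ℂ) * A₂ 0)‖ := by
          congr 1; push_cast; ring
      _ ≤ C * r * (u - 0) := this
      _ ≤ C * r * r := by gcongr; linarith [hu.2]
      _ = _ := by ring
  have hsq : ∀ u : ℝ, HasDerivAt (fun u : ℝ => (u : ℂ) ^ 2 / 2) (u : ℂ) u := fun u => by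
    have := ((hid u).pow 2).div_const 2
    simpa using this
  have := norm_image_sub_le_of_norm_deriv_le_segment' (a := 0) (b := r)
      (f := fun u => A u - u * A₁ 0 - (u : ℂ) ^ 2 / 2 * A₂ 0)
      (f' := fun u => A₁ u - 1 * A₁ 0 - u * A₂ 0) (C := C * r ^ 2)
      (fun x _ => (((h0 x).sub ((hid x).mul_const _)).sub ((hsq x).mul_const _)).hasDerivWithinAt)
      (fun x hx => by rw [one_mul]; exact b1 x ⟨hx.1, hx.2.le⟩) r ⟨hr, le_rfl⟩
  calc _ = ‖A r - r * A₁ 0 - (r : ℂ) ^ 2 / 2 * A₂ 0 -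
          (A 0 - ((0 : ℝ) : ℂ) * A₁ 0 - ((0 : ℝ) : ℂ) ^ 2 / 2 * A₂ 0)‖ := by
        congr 1; push_cast; ring
    _ ≤ C * r ^ 2 * (r - 0) := this
    _ = _ := by ring

theorem norm_taylor_two_fderiv_le {E : Type*} [NormedAddCommGroup E] [NormedSpace ℝ E] {f : E → ℂ}
    (hf : ContDiff ℝ ∞ f) {M : ℝ} (hM : ∀ q v, ‖fderiv ℝ (fderiv ℝ (fderiv ℝ f)) q v v v‖ ≤ M * ‖v‖ ^ 3)
    (p v : E)
    {r : ℝ} (hr : 0 ≤ r) :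
    ‖f (p + r • v) - f p - r * fderiv ℝ f p v - r ^ 2 / 2 * fderiv ℝ (fderiv ℝ f) p v v‖ ≤
      M * ‖v‖ ^ 3 * r ^ 3 := by
  have hf1 : ContDiff ℝ ∞ (fderiv ℝ f) := hf.fderiv_right (by simp)
  have hf2 : ContDiff ℝ ∞ (fderiv ℝ (fderiv ℝ f)) := hf1.fderiv_right (by simp)
  have hline : ∀ u : ℝ, HasDerivAt (fun u : ℝ => p + u • v) v u := fun u => by
    simpa using ((hasDerivAt_id u).smul_const v).const_add p
  have h0 : ∀ u : ℝ, HasDerivAt (fun u : ℝ => f (p + u • v)) (fderiv ℝ f (p + u • v) v) u :=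
    fun u => ((hf.differentiable (by simp) _).hasFDerivAt).comp_hasDerivAt u (hline u)
  have h1 : ∀ u : ℝ, HasDerivAt (fun u : ℝ => fderiv ℝ f (p + u • v) v)
      (fderiv ℝ (fderiv ℝ f) (p + u • v) v v) u := fun u => by
    have := (((hf1.differentiable (by simp) _).hasFDerivAt).comp_hasDerivAt u (hline u)).clm_apply
      (hasDerivAt_const u v)
    simpa using this
  have h2 : ∀ u : ℝ, HasDerivAt (fun u : ℝ => fderiv ℝ (fderiv ℝ f) (p + u • v) v v)
      (fderiv ℝ (fderiv ℝ (fderiv ℝ f)) (p + u • v) v v v) u := fun u => by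
    have := ((((hf2.differentiable (by simp) _).hasFDerivAt).comp_hasDerivAt u (hline u)).clm_apply
      (hasDerivAt_const u v)).clm_apply (hasDerivAt_const u v)
    simpa using this
  have := norm_taylor_two_le hr h0 h1 h2 (C := M * ‖v‖ ^ 3) fun u => hM _ _
  simpa using this

end Gaussian

section Gaussian

variable {d : ℕ}

/-! ### The Gaussian averages as contractions -/

/-- `∫ ψ(p (√τ ζ, 0)) dμ_G(ζ)`. -/
noncomputable def heatAverage (τ : ℝ≥0) (ψ : Heisenberg d → ℂ) : Heisenberg d → ℂ := fun p =>
  ∫ ζ, ψ (heisMul p (√(τ : ℝ) • ζ, 0)) ∂(stdGauss d)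

theorem gaussAverage_eq (c : Heisenberg d → ℝ) (τ : ℝ≥0) (ψ : Heisenberg d → ℂ)
    (p : Heisenberg d) :
    gaussAverage c τ ψ p = heatAverage τ ψ p + ((τ : ℝ) : ℂ) * (c p : ℂ) * ψ p := by
  simp [gaussAverage, heatAverage, heisMul, sigmaForm_smul_right]

theorem continuous_heisMul_horizontal (r : ℝ) :
    Continuous fun x : HorizontalSpace d × Heisenberg d => heisMul x.2 (r • x.1, 0) :=
  continuous_snd.heisMul ((continuous_fst.const_smul r).prodMk continuous_const)

theorem stronglyMeasurable_heatAverage (τ : ℝ≥0) {ψ : Heisenberg d → ℂ} (hψ : Continuous ψ) :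
    StronglyMeasurable (heatAverage τ ψ) :=
  StronglyMeasurable.integral_prod_left' (f := fun x : HorizontalSpace d × Heisenberg d =>
    ψ (heisMul x.2 (√(τ : ℝ) • x.1, 0)))
    (hψ.comp (continuous_heisMul_horizontal _)).stronglyMeasurable

theorem lintegral_heisMul_right {f : Heisenberg d → ℝ≥0∞} (hf : Measurable f) (q : Heisenberg d) :
    ∫⁻ p, f (heisMul p q) = ∫⁻ p, f p :=
  (measurePreserving_heisMul_right q).lintegral_comp hf

theorem lintegral_sq_eq_eLpNorm_sq {X F : Type*} [MeasurableSpace X] [NormedAddCommGroup F]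
    {μ : Measure X} (f : X → F) : ∫⁻ x, ‖f x‖ₑ ^ 2 ∂μ = eLpNorm f 2 μ ^ 2 := by
  have h := eLpNorm_nnreal_pow_eq_lintegral (μ := μ) (f := f) (p := 2) two_ne_zero
  simpa using h.symm

/-- The Gaussian measure has mass 1, and each right translation being averaged preserves the L²
norm. -/
theorem eLpNorm_heatAverage_le (τ : ℝ≥0) {ψ : Heisenberg d → ℂ} (hψ : Continuous ψ) :
    eLpNorm (heatAverage τ ψ) 2 volume ≤ eLpNorm ψ 2 volume := by
  have h := lintegral_enorm_integral_sq_le (μ := stdGauss d) (ν := (volume : Measure (Heisenberg d)))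
    (F := fun ζ p => ψ (heisMul p (√(τ : ℝ) • ζ, 0)))
    (hψ.comp (continuous_heisMul_horizontal _)).stronglyMeasurable
  rw [measure_univ, one_mul] at h
  have h1 : ∀ ζ : HorizontalSpace d, ∫⁻ p, ‖ψ (heisMul p (√(τ : ℝ) • ζ, 0))‖ₑ ^ 2 =
      ∫⁻ p, ‖ψ p‖ₑ ^ 2 := fun ζ =>
    lintegral_heisMul_right (hψ.measurable.enorm.pow_const 2) _
  simp only [h1, lintegral_const, measure_univ, mul_one] at h
  change ∫⁻ p, ‖heatAverage τ ψ p‖ₑ ^ 2 ≤ _ at h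
  rw [lintegral_sq_eq_eLpNorm_sq, lintegral_sq_eq_eLpNorm_sq] at h
  exact (ENNReal.pow_right_strictMono two_ne_zero).le_iff_le.1 h

theorem memLp_heatAverage (τ : ℝ≥0) {ψ : Heisenberg d → ℂ} (hψ : Continuous ψ)
    (h2 : MemLp ψ 2 volume) : MemLp (heatAverage τ ψ) 2 volume :=
  ⟨(stronglyMeasurable_heatAverage τ hψ).aestronglyMeasurable,
    (eLpNorm_heatAverage_le τ hψ).trans_lt h2.2⟩

theorem integrable_heat_integrand (τ : ℝ≥0) {ψ : Heisenberg d → ℂ} (hψ : Continuous ψ)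
    {C : ℝ} (hC : ∀ p, ‖ψ p‖ ≤ C) (p : Heisenberg d) :
    Integrable (fun ζ => ψ (heisMul p (√(τ : ℝ) • ζ, 0))) (stdGauss d) :=
  Integrable.of_bound ((hψ.comp ((continuous_heisMul_horizontal _).comp
    (Continuous.prodMk_left p))).aestronglyMeasurable) C (Eventually.of_forall fun _ => hC _)

theorem SchwartzMap.norm_le_bound (ψ : 𝓢(Heisenberg d, ℂ)) :
    ∃ C, ∀ p, ‖ψ p‖ ≤ C := ⟨_, fun p => SchwartzMap.norm_le_seminorm ℝ ψ p⟩

/-- The Gaussian averages of Schwartz functions, as a linear map to `L²`. -/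
noncomputable def heatSchwartz (d : ℕ) (τ : ℝ≥0) : 𝓢(Heisenberg d, ℂ) →ₗ[ℂ] L2Heis d where
  toFun ψ := (memLp_heatAverage τ ψ.continuous (ψ.memLp 2 volume)).toLp _
  map_add' ψ φ := by
    rw [← MemLp.toLp_add, MemLp.toLp_eq_toLp_iff]
    refine Eventually.of_forall fun p => ?_
    obtain ⟨C, hC⟩ := ψ.norm_le_bound
    obtain ⟨C', hC'⟩ := φ.norm_le_bound
    exact integral_add (integrable_heat_integrand τ ψ.continuous hC p)
      (integrable_heat_integrand τ φ.continuous hC' p)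
  map_smul' a ψ := by
    rw [RingHom.id_apply, ← MemLp.toLp_const_smul, MemLp.toLp_eq_toLp_iff]
    exact Eventually.of_forall fun p => integral_const_mul a _

theorem denseRange_schwartz_toLp (d : ℕ) :
    DenseRange (SchwartzMap.toLpCLM ℂ ℂ 2 (volume : Measure (Heisenberg d))) :=
  SchwartzMap.denseRange_toLpCLM (E := Heisenberg d) (F := ℂ) (p := 2) (by simp)

theorem exists_heat_contraction (d : ℕ) (τ : ℝ≥0) : ∃ G : L2Heis d →L[ℂ] L2Heis d, ‖G‖ ≤ 1 ∧
    ∀ ψ : 𝓢(Heisenberg d, ℂ), G (ψ.toLp 2 volume) =ᵐ[volume] heatAverage τ ψ := by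
  let e : 𝓢(Heisenberg d, ℂ) →ₗ[ℂ] L2Heis d :=
    (SchwartzMap.toLpCLM ℂ ℂ 2 (volume : Measure (Heisenberg d))).toLinearMap
  have he : DenseRange e := denseRange_schwartz_toLp d
  have hn : ∀ ψ, ‖heatSchwartz d τ ψ‖ ≤ 1 * ‖e ψ‖ := fun ψ => by
    rw [one_mul]
    change ‖(memLp_heatAverage τ ψ.continuous (ψ.memLp 2 volume)).toLp _‖ ≤ ‖ψ.toLp 2 volume‖
    rw [Lp.norm_toLp, SchwartzMap.norm_toLp]
    exact ENNReal.toReal_mono (ψ.memLp 2 volume).2.ne (eLpNorm_heatAverage_le τ ψ.continuous)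
  refine ⟨(heatSchwartz d τ).extendOfNorm e,
    LinearMap.opNorm_extendOfNorm_le he zero_le_one hn, fun ψ => ?_⟩
  have h := LinearMap.extendOfNorm_eq he ⟨1, hn⟩ ψ
  change (heatSchwartz d τ).extendOfNorm e (ψ.toLp 2 volume) = _ at h
  rw [h]
  exact MemLp.coeFn_toLp (memLp_heatAverage τ ψ.continuous (ψ.memLp 2 volume))

/-! ### Multiplication by a bounded function -/

theorem coeFn_mulOp {c : Heisenberg d → ℝ} (hc : MemLp c ∞ volume) (f : L2Heis d) :
    mulOp hc f =ᵐ[volume] fun p => (c p : ℂ) * f p :=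
  MemLp.coeFn_toLp ((Lp.memLp f).mul (p := ∞) (q := 2) (r := 2) (hc.ofReal (K := ℂ)))

theorem norm_mulOp_le {c : Heisenberg d → ℝ} (hc : MemLp c ∞ volume) (f : L2Heis d) :
    ‖mulOp hc f‖ ≤ (eLpNorm c ∞ volume).toReal * ‖f‖ := by
  refine Lp.norm_le_mul_norm_of_ae_le_mul ?_
  have h1 := ae_le_eLpNormEssSup (f := c) (μ := (volume : Measure (Heisenberg d)))
  filter_upwards [coeFn_mulOp hc f, h1] with p hp hcp
  rw [hp, norm_mul, Complex.norm_real]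
  gcongr
  rw [eLpNorm_exponent_top, ← toReal_enorm]
  refine ENNReal.toReal_mono ?_ hcp
  simpa using hc.2.ne

theorem mulOp_symmetric {c : Heisenberg d → ℝ} (hc : MemLp c ∞ volume) (f g : L2Heis d) :
    inner ℂ (mulOp hc f) g = inner ℂ f (mulOp hc g) := by
  rw [L2.inner_def, L2.inner_def]
  refine integral_congr_ae ?_
  filter_upwards [coeFn_mulOp hc f, coeFn_mulOp hc g] with p hf hg
  rw [hf, hg, RCLike.inner_apply, RCLike.inner_apply, map_mul, Complex.conj_ofReal]
  ring

/-! ### The derivative of the Gaussian averages -/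

/-- No first order terms appear: differentiating the coefficient (ζ, σ(z, ζ)) along the field itself
gives (0, σ(ζ, ζ)) = 0. -/
theorem subLaplacianExpr_eq_second_derivative {f : Heisenberg d → ℂ} (hf : ContDiff ℝ ∞ f)
    (p : Heisenberg d) : subLaplacianExpr f p = ∑ j, fderiv ℝ (fderiv ℝ f) p
      (horizontalBasis j, sigmaForm p.1 (horizontalBasis j))
      (horizontalBasis j, sigmaForm p.1 (horizontalBasis j)) := by
  rw [subLaplacianExpr_eq_sum]
  refine Finset.sum_congr rfl fun j _ => ?_
  set ζ := horizontalBasis j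
  have hf1 : ContDiff ℝ ∞ (fderiv ℝ f) := hf.fderiv_right (by simp)
  have h1 : HasFDerivAt (fun q : Heisenberg d => ((ζ, sigmaForm q.1 ζ) : Heisenberg d))
      ((0 : Heisenberg d →L[ℝ] HorizontalSpace d).prod ((sigmaFormCLM ζ).comp
        (ContinuousLinearMap.fst ℝ (HorizontalSpace d) ℝ))) p :=
    (hasFDerivAt_const ζ p).prodMk ((sigmaFormCLM ζ).comp
        (ContinuousLinearMap.fst ℝ (HorizontalSpace d) ℝ)).hasFDerivAt
  have h2 := ((hf1.differentiable (by simp) p).hasFDerivAt).clm_apply h1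
  refine (DFunLike.congr_fun h2.fderiv _).trans ?_
  simp [sigmaFormCLM_apply, sigmaForm_self, Prod.mk_zero_zero]

/-- The value at `p` of the left-invariant fields. -/
noncomputable def horizontalLift (p : Heisenberg d) : HorizontalSpace d →ₗ[ℝ] Heisenberg d where
  toFun ζ := (ζ, sigmaForm p.1 ζ)
  map_add' ζ ζ' := by simp [sigmaForm_add_right]
  map_smul' a ζ := by simp [sigmaForm_smul_right]

theorem horizontalLift_apply (p : Heisenberg d) (ζ : HorizontalSpace d) :
    horizontalLift p ζ = (ζ, sigmaForm p.1 ζ) := rfl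

theorem heisMul_horizontal (p : Heisenberg d) (r : ℝ) (ζ : HorizontalSpace d) :
    heisMul p (r • ζ, 0) = p + r • horizontalLift p ζ := by
  simp [heisMul, horizontalLift_apply, sigmaForm_smul_right, Prod.ext_iff]

/-- The remainder of the second order Taylor expansion of `f` along horizontal lines. -/
noncomputable def horizontalRemainder (f : Heisenberg d → ℂ) (r : ℝ) (ζ : HorizontalSpace d)
    (p : Heisenberg d) : ℂ :=
  f (heisMul p (r • ζ, 0)) - f p - r * fderiv ℝ f p (horizontalLift p ζ) -
    r ^ 2 / 2 * fderiv ℝ (fderiv ℝ f) p (horizontalLift p ζ) (horizontalLift p ζ)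

/-- The linear term averages to zero and the quadratic one to its trace over the horizontal basis,
which is Lf(p); the factor r² with r = √τ supplies τ. -/
theorem integral_horizontalRemainder {f : Heisenberg d → ℂ} (hf : f ∈ testFunctions d) (τ : ℝ≥0)
    (p : Heisenberg d) :
    ∫ ζ, horizontalRemainder f (√(τ : ℝ)) ζ p ∂(stdGauss d) =
      heatAverage τ f p - f p - ((τ : ℝ) : ℂ) / 2 * subLaplacianExpr f p := by
  obtain ⟨C, hC⟩ := hf.2.exists_bound_of_continuous hf.1.continuous
  have h0 := integrable_heat_integrand τ hf.1.continuous hC p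
  obtain ⟨h1, h1'⟩ := integral_linear_stdGauss
    ((fderiv ℝ f p).toLinearMap ∘ₗ horizontalLift p)
  obtain ⟨h2, h2'⟩ := integral_quadratic_stdGauss
    (((fderiv ℝ (fderiv ℝ f) p).toLinearMap₁₂).compl₁₂ (horizontalLift p) (horizontalLift p))
  change Integrable (fun ζ => fderiv ℝ f p (horizontalLift p ζ)) (stdGauss d) at h1
  change ∫ ζ, fderiv ℝ f p (horizontalLift p ζ) ∂(stdGauss d) = 0 at h1'
  change Integrable (fun ζ => fderiv ℝ (fderiv ℝ f) p (horizontalLift p ζ) (horizontalLift p ζ))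
    (stdGauss d) at h2
  change ∫ ζ, fderiv ℝ (fderiv ℝ f) p (horizontalLift p ζ) (horizontalLift p ζ) ∂(stdGauss d) =
    ∑ j, fderiv ℝ (fderiv ℝ f) p (horizontalLift p (horizontalBasis j))
      (horizontalLift p (horizontalBasis j)) at h2'
  have hsq : ((√(τ : ℝ) : ℝ) : ℂ) ^ 2 = ((τ : ℝ) : ℂ) := by
    rw [← Complex.ofReal_pow, Real.sq_sqrt τ.coe_nonneg]
  have i1 : Integrable (fun ζ => f (heisMul p (√(τ : ℝ) • ζ, 0)) - f p) (stdGauss d) :=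
    h0.sub (integrable_const _)
  have i2 : Integrable (fun ζ => f (heisMul p (√(τ : ℝ) • ζ, 0)) - f p -
      ((√(τ : ℝ) : ℝ) : ℂ) * fderiv ℝ f p (horizontalLift p ζ)) (stdGauss d) :=
    i1.sub (h1.const_mul _)
  have i3 := h2.const_mul (((√(τ : ℝ) : ℝ) : ℂ) ^ 2 / 2)
  simp only [horizontalRemainder]
  rw [integral_sub i2 i3, integral_sub i1 (h1.const_mul _), integral_sub h0 (integrable_const _),
    integral_const_mul, integral_const_mul, h1', h2', hsq, subLaplacianExpr_eq_second_derivative hf.1]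
  simp [heatAverage, horizontalLift_apply]

theorem abs_sigmaForm_le (z w : HorizontalSpace d) : |sigmaForm z w| ≤ 2 * d * ‖z‖ * ‖w‖ := by
  have h : ∀ x y : Fin d → ℝ, |x ⬝ᵥ y| ≤ d * ‖x‖ * ‖y‖ := fun x y => by
    refine (Finset.abs_sum_le_sum_abs _ _).trans ?_
    refine (Finset.sum_le_sum (g := fun _ => ‖x‖ * ‖y‖) fun i _ => ?_).trans (by simp [mul_assoc])
    rw [abs_mul]
    gcongr
    · exact norm_le_pi_norm x i
    · exact norm_le_pi_norm y i
  have h1 := h w.1 z.2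
  have h2 := h z.1 w.2
  have h3 : (d : ℝ) * ‖w.1‖ * ‖z.2‖ ≤ d * ‖w‖ * ‖z‖ := by
    gcongr
    · exact norm_fst_le w
    · exact norm_snd_le z
  have h4 : (d : ℝ) * ‖z.1‖ * ‖w.2‖ ≤ d * ‖z‖ * ‖w‖ := by
    gcongr
    · exact norm_fst_le z
    · exact norm_snd_le w
  rw [sigmaForm]
  calc _ ≤ |w.1 ⬝ᵥ z.2| + |z.1 ⬝ᵥ w.2| := abs_sub _ _
    _ ≤ d * ‖w‖ * ‖z‖ + d * ‖z‖ * ‖w‖ := by linarith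
    _ = _ := by ring

set_option maxSynthPendingDepth 3 in
theorem exists_third_derivative_bound {E : Type*} [NormedAddCommGroup E] [NormedSpace ℝ E]
    {f : E → ℂ} (hf : ContDiff ℝ ∞ f) (hfc : HasCompactSupport f) :
    ∃ M, 0 ≤ M ∧ ∀ q v, ‖fderiv ℝ (fderiv ℝ (fderiv ℝ f)) q v v v‖ ≤ M * ‖v‖ ^ 3 := by
  have hf1 : ContDiff ℝ ∞ (fderiv ℝ f) := hf.fderiv_right (by simp)
  have hf2 : ContDiff ℝ ∞ (fderiv ℝ (fderiv ℝ f)) := hf1.fderiv_right (by simp)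
  obtain ⟨M, hM⟩ := (((hfc.fderiv ℝ).fderiv ℝ).fderiv ℝ).exists_bound_of_continuous
    (hf2.continuous_fderiv (by simp))
  refine ⟨M, (norm_nonneg _).trans (hM 0), fun q v => ?_⟩
  calc _ ≤ ‖fderiv ℝ (fderiv ℝ (fderiv ℝ f)) q‖ * ‖v‖ * ‖v‖ * ‖v‖ :=
        (ContinuousLinearMap.le_opNorm _ _).trans (by
          gcongr
          exact ContinuousLinearMap.le_opNorm₂ _ _ _)
    _ ≤ M * ‖v‖ * ‖v‖ * ‖v‖ := by gcongr; exact hM _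
    _ = _ := by ring

/-- The remainder vanishes unless p or p(rζ, 0) lies in the support K of f. This confines p to a set
of measure at most 2|K| and, as r ≤ 1, gives ‖p.1‖ ≤ |m| + ‖ζ‖, which controls the linearly growing
coefficients. -/
theorem exists_lintegral_horizontalRemainder_le {f : Heisenberg d → ℂ} (hf : f ∈ testFunctions d) :
    ∃ C, 0 ≤ C ∧ ∀ r : ℝ, 0 ≤ r → r ≤ 1 → ∀ ζ : HorizontalSpace d,
      ∫⁻ p, ‖horizontalRemainder f r ζ p‖ₑ ^ 2 ≤ ENNReal.ofReal (C * r ^ 6 * (1 + ‖ζ‖) ^ 12) := by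
  obtain ⟨M, hM0, hM⟩ := exists_third_derivative_bound hf.1 hf.2
  set K := tsupport f with hK
  have hKc : IsCompact K := hf.2
  obtain ⟨m, hm⟩ := hKc.exists_bound_of_continuousOn (f := fun p : Heisenberg d => p.1)
    continuous_fst.continuousOn
  set C₀ : ℝ := 1 + 2 * d * (|m| + 1) with hC₀
  have hC₀0 : 0 ≤ C₀ := by positivity
  have hKfin : (volume : Measure (Heisenberg d)) K ≠ ⊤ := hKc.measure_lt_top.ne
  refine ⟨(M * C₀ ^ 3) ^ 2 * (2 * (volume K).toReal), by positivity, fun r hr0 hr1 ζ => ?_⟩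
  -- The lifted vector has norm at most C₀(1 + ‖ζ‖)², so its cube, squared once more for the L²
  -- norm, produces (1 + ‖ζ‖)¹², with r⁶ from the Taylor bound.
  set B : ℝ := M * (C₀ * (1 + ‖ζ‖) ^ 2) ^ 3 * r ^ 3 with hB
  have hB0 : 0 ≤ B := by positivity
  have hlift : ∀ p : Heisenberg d, ‖p.1‖ ≤ |m| + ‖ζ‖ →
      ‖horizontalRemainder f r ζ p‖ ≤ B := by
    intro p hp
    have h1 : ‖horizontalLift p ζ‖ ≤ C₀ * (1 + ‖ζ‖) ^ 2 := by
      rw [horizontalLift_apply, Prod.norm_def, max_le_iff]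
      have h2 : |sigmaForm p.1 ζ| ≤ 2 * d * (|m| + ‖ζ‖) * ‖ζ‖ :=
        (abs_sigmaForm_le _ _).trans (by gcongr)
      have h3 : 2 * d * (|m| + ‖ζ‖) * ‖ζ‖ ≤ 2 * d * ((|m| + 1) * (1 + ‖ζ‖)) * (1 + ‖ζ‖) := by
        gcongr
        · nlinarith [abs_nonneg m, norm_nonneg ζ]
        · linarith
      have h4 : C₀ * (1 + ‖ζ‖) ^ 2 = (1 + ‖ζ‖) ^ 2 +
          2 * d * ((|m| + 1) * (1 + ‖ζ‖)) * (1 + ‖ζ‖) := by rw [hC₀]; ring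
      have h5 : 0 ≤ 2 * d * ((|m| + 1) * (1 + ‖ζ‖)) * (1 + ‖ζ‖) := by positivity
      refine ⟨?_, ?_⟩
      · nlinarith [norm_nonneg ζ]
      · rw [Real.norm_eq_abs]
        nlinarith [norm_nonneg ζ]
    rw [horizontalRemainder, heisMul_horizontal]
    refine (norm_taylor_two_fderiv_le hf.1 hM p (horizontalLift p ζ) hr0).trans ?_
    rw [hB]
    gcongr
  have hpt : ∀ p : Heisenberg d, ‖horizontalRemainder f r ζ p‖ₑ ^ 2 ≤ ENNReal.ofReal (B ^ 2) *
      (K.indicator 1 p + K.indicator 1 (heisMul p (r • ζ, 0))) := by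
    intro p
    have hb : ‖p.1‖ ≤ |m| + ‖ζ‖ → ‖horizontalRemainder f r ζ p‖ₑ ^ 2 ≤ ENNReal.ofReal (B ^ 2) := by
      intro h
      rw [ENNReal.ofReal_pow hB0, ← ofReal_norm]
      gcongr
      exact hlift p h
    by_cases h1 : p ∈ K
    · refine (hb ?_).trans (le_mul_of_one_le_right' ?_)
      · linarith [hm p h1, le_abs_self m, norm_nonneg ζ]
      · rw [Set.indicator_of_mem h1]; exact le_self_add
    by_cases h2 : heisMul p (r • ζ, 0) ∈ K
    · refine (hb ?_).trans (le_mul_of_one_le_right' ?_)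
      · have h3 : ‖p.1 + r • ζ‖ ≤ m := hm _ h2
        have h4 : ‖r • ζ‖ ≤ ‖ζ‖ := by
          rw [norm_smul, Real.norm_of_nonneg hr0]
          exact mul_le_of_le_one_left (norm_nonneg _) hr1
        have h5 : ‖p.1‖ ≤ ‖p.1 + r • ζ‖ + ‖r • ζ‖ := by
          simpa using norm_sub_le (p.1 + r • ζ) (r • ζ)
        linarith [le_abs_self m]
      · rw [Set.indicator_of_mem h2]; exact le_add_self
    · have hz : horizontalRemainder f r ζ p = 0 := by
        have h3 : fderiv ℝ f p = 0 := by
          by_contra h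
          exact h1 (support_fderiv_subset ℝ h)
        have h4 : fderiv ℝ (fderiv ℝ f) p = 0 := by
          by_contra h
          exact h1 ((closure_minimal (support_fderiv_subset ℝ) isClosed_closure)
            (support_fderiv_subset ℝ (f := fderiv ℝ f) h))
        simp [horizontalRemainder, h3, h4, image_eq_zero_of_notMem_tsupport h1,
          image_eq_zero_of_notMem_tsupport h2]
      rw [hz]
      simp
  have hind : Measurable (K.indicator (1 : Heisenberg d → ℝ≥0∞)) :=
    measurable_one.indicator hKc.measurableSet
  calc ∫⁻ p, ‖horizontalRemainder f r ζ p‖ₑ ^ 2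
      ≤ ∫⁻ p, ENNReal.ofReal (B ^ 2) *
        (K.indicator 1 p + K.indicator 1 (heisMul p (r • ζ, 0))) := lintegral_mono hpt
    _ = ENNReal.ofReal (B ^ 2) * (volume K + volume K) := by
        rw [lintegral_const_mul' _ _ ENNReal.ofReal_ne_top, lintegral_add_left hind,
          lintegral_heisMul_right hind, lintegral_indicator_one hKc.measurableSet]
    _ = ENNReal.ofReal (B ^ 2) * ENNReal.ofReal (2 * (volume K).toReal) := by
        rw [two_mul, ENNReal.ofReal_add (by positivity) (by positivity), ENNReal.ofReal_toReal hKfin]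
    _ = _ := by
        rw [← ENNReal.ofReal_mul (by positivity), hB]
        congr 1
        ring

theorem continuous_horizontalRemainder {f : Heisenberg d → ℂ} (hf : ContDiff ℝ ∞ f) (r : ℝ) :
    Continuous (Function.uncurry (horizontalRemainder f r)) := by
  have hf1 : ContDiff ℝ ∞ (fderiv ℝ f) := hf.fderiv_right (by simp)
  have hl : Continuous fun x : HorizontalSpace d × Heisenberg d => horizontalLift x.2 x.1 :=
    continuous_fst.prodMk (continuous_snd.fst.sigmaForm continuous_fst)
  have h1 : Continuous fun x : HorizontalSpace d × Heisenberg d =>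
      fderiv ℝ f x.2 (horizontalLift x.2 x.1) := (hf1.continuous.comp continuous_snd).clm_apply hl
  have h2 : Continuous fun x : HorizontalSpace d × Heisenberg d =>
      fderiv ℝ (fderiv ℝ f) x.2 (horizontalLift x.2 x.1) (horizontalLift x.2 x.1) :=
    (((hf1.continuous_fderiv (by simp)).comp continuous_snd).clm_apply hl).clm_apply hl
  exact (((hf.continuous.comp (continuous_heisMul_horizontal r)).sub
    (hf.continuous.comp continuous_snd)).sub (continuous_const.mul h1)).sub (continuous_const.mul h2)

/-- Averaging the L² bound on the remainder over ζ is possible because the Gaussian has finite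
moments; r⁶ becomes τ³ for r = √τ. -/
theorem exists_norm_heat_sub_le (f : testFunctions d) :
    ∃ C, 0 ≤ C ∧ ∀ τ : ℝ≥0, τ ≤ 1 → ∀ G : L2Heis d →L[ℂ] L2Heis d,
      (∀ ψ : 𝓢(Heisenberg d, ℂ), G (ψ.toLp 2 volume) =ᵐ[volume] heatAverage τ ψ) →
      ‖G (testToL2 d f) - testToL2 d f -
        (((τ : ℝ) : ℂ) / 2) • testToL2 d (subLaplacianTest d f)‖ ^ 2 ≤ C * τ ^ 3 := by
  obtain ⟨C, hC0, hC⟩ := exists_lintegral_horizontalRemainder_le f.2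
  set I := ∫ ζ : HorizontalSpace d, (1 + ‖ζ‖) ^ 12 ∂(stdGauss d) with hI
  have hI0 : 0 ≤ I := integral_nonneg fun ζ => by positivity
  refine ⟨C * I, by positivity, fun τ hτ G hG => ?_⟩
  set X := G (testToL2 d f) - testToL2 d f -
    (((τ : ℝ) : ℂ) / 2) • testToL2 d (subLaplacianTest d f) with hX
  have hXae : X =ᵐ[volume] fun p => ∫ ζ, horizontalRemainder f.1 (√(τ : ℝ)) ζ p ∂(stdGauss d) := by
    have h1 := hG (f.2.2.toSchwartzMap f.2.1)
    have h2 : (f.2.2.toSchwartzMap f.2.1).toLp 2 volume = testToL2 d f := rfl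
    rw [h2] at h1
    filter_upwards [h1, coeFn_testToL2 f, coeFn_testToL2 (subLaplacianTest d f),
      Lp.coeFn_sub (G (testToL2 d f) - testToL2 d f)
        ((((τ : ℝ) : ℂ) / 2) • testToL2 d (subLaplacianTest d f)),
      Lp.coeFn_sub (G (testToL2 d f)) (testToL2 d f),
      Lp.coeFn_smul (((τ : ℝ) : ℂ) / 2) (testToL2 d (subLaplacianTest d f))]
      with p a1 a2 a3 a4 a5 a6
    rw [integral_horizontalRemainder f.2, hX, a4, Pi.sub_apply, a5, Pi.sub_apply, a6, Pi.smul_apply,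
      a1, a2, a3, smul_eq_mul]
    rfl
  have hsq : √(τ : ℝ) ^ 6 = τ ^ 3 := by
    rw [show (6 : ℕ) = 2 * 3 from rfl, pow_mul, Real.sq_sqrt τ.coe_nonneg]
  have hsqrt1 : √(τ : ℝ) ≤ 1 := Real.sqrt_le_one.2 (by exact_mod_cast hτ)
  have hmain : eLpNorm X 2 volume ^ 2 ≤ ENNReal.ofReal (C * I * τ ^ 3) := by
    rw [eLpNorm_congr_ae hXae, ← lintegral_sq_eq_eLpNorm_sq]
    refine (lintegral_enorm_integral_sq_le
      (continuous_horizontalRemainder f.2.1 _).stronglyMeasurable).trans ?_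
    rw [measure_univ, one_mul]
    refine (lintegral_mono fun ζ => hC _ (Real.sqrt_nonneg _) hsqrt1 ζ).trans (le_of_eq ?_)
    rw [hsq, ← ofReal_integral_eq_lintegral_ofReal
      ((integrable_one_add_norm_pow d 12).const_mul _)
      (Eventually.of_forall fun ζ => by positivity), integral_const_mul]
    congr 1
    ring
  rw [Lp.norm_def, ← ENNReal.toReal_pow]
  exact ENNReal.toReal_le_of_le_ofReal (by positivity) hmain

end Gaussian

/-! ### The operator L/2 + c and the Chernoff limit -/

variable {d : ℕ} {c : Heisenberg d → ℝ}

/-- Multiplication by an essentially bounded function, as a bounded operator. -/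
noncomputable def mulOpL (hc : MemLp c ∞ volume) : L2Heis d →L[ℂ] L2Heis d :=
  (mulOp hc).mkContinuous (eLpNorm c ∞ volume).toReal (norm_mulOp_le hc)

theorem mulOpL_apply (hc : MemLp c ∞ volume) (x : L2Heis d) : mulOpL hc x = mulOp hc x := rfl

theorem mem_graph_heatOperator (hc : MemLp c ∞ volume) {x y : L2Heis d} :
    (x, y) ∈ (heatOperator hc).graph ↔
      (x, (2 : ℂ) • (y - mulOpL hc x)) ∈ (subLaplacian d).graph := by
  rw [LinearPMap.mem_graph_iff, LinearPMap.mem_graph_iff]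
  refine exists_congr fun u => and_congr_right fun hu => ?_
  change mulOp hc u + (1 / 2 : ℂ) • subLaplacian d u = y ↔
    subLaplacian d u = (2 : ℂ) • (y - mulOpL hc x)
  change (u : L2Heis d) = x at hu
  rw [hu, mulOpL_apply]
  constructor
  · rintro rfl
    rw [add_sub_cancel_left, smul_smul]
    norm_num
  · intro h
    rw [h, smul_smul]
    norm_num

/-- L_c is a self-adjoint operator perturbed by a bounded symmetric one, and L ≤ 0 makes κ = ‖c‖_∞
an upper bound for it. -/
theorem exists_semigroup_heatOperator (hc : MemLp c ∞ volume) :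
    ∃ (R : L2Heis d →L[ℂ] L2Heis d) (V : ℝ≥0 → L2Heis d →L[ℂ] L2Heis d),
      (∀ x y, (x, y) ∈ (heatOperator hc).graph ↔
        R ((((eLpNorm c ∞ volume).toReal + 1 : ℝ) : ℂ) • x - y) = x) ∧ DenseRange R ∧
      Dense ((fun p : L2Heis d × L2Heis d =>
        (((eLpNorm c ∞ volume).toReal + 1 : ℝ) : ℂ) • p.1 - p.2) '' (heatOperator hc).graph) ∧
      IsC0Semigroup V ∧ IsGenerator (heatOperator hc) V := by
  have key : ∀ {x y : L2Heis d}, (x, y) ∈ (heatOperator hc).graph →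
      ∃ z, (x, z) ∈ (subLaplacian d).graph ∧ y = mulOpL hc x + (1 / 2 : ℂ) • z := fun {x y} h =>
    ⟨_, (mem_graph_heatOperator hc).1 h, by
      rw [smul_smul]; norm_num⟩
  have key' : ∀ {x z : L2Heis d}, (x, z) ∈ (subLaplacian d).graph →
      (x, mulOpL hc x + (1 / 2 : ℂ) • z) ∈ (heatOperator hc).graph := fun {x z} h => by
    rw [mem_graph_heatOperator, add_sub_cancel_left, smul_smul, mul_one_div_cancel two_ne_zero, one_smul]
    exact h
  have hms : ∀ f g, inner ℂ (mulOpL hc f) g = inner ℂ f (mulOpL hc g) := mulOp_symmetric hc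
  have hhalf : conj (1 / 2 : ℂ) = 1 / 2 := by
    simpa using Complex.conj_ofReal (1 / 2)
  refine exists_semigroup_of_selfAdjoint ENNReal.toReal_nonneg ?_ ?_ ?_ ?_ ?_
  · have h : ((heatOperator hc).graph : Set (L2Heis d × L2Heis d)) =
        (fun p => (p.1, (2 : ℂ) • (p.2 - mulOpL hc p.1))) ⁻¹' (subLaplacian d).graph :=
      Set.ext fun p => mem_graph_heatOperator hc
    rw [LinearPMap.IsClosed, h]
    exact (isClosed_subLaplacian d).preimage (by fun_prop)
  · exact dense_domain_subLaplacian d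
  · intro x y h
    obtain ⟨z, hz, rfl⟩ := key h
    rw [inner_add_right, inner_smul_right, Complex.add_re]
    have h1 := subLaplacian_nonpos x z hz
    have h2 : (inner ℂ x (mulOpL hc x)).re ≤ ‖x‖ * ‖mulOpL hc x‖ := re_inner_le_norm (𝕜 := ℂ) _ _
    have h3 : ‖mulOpL hc x‖ ≤ (eLpNorm c ∞ volume).toReal * ‖x‖ := norm_mulOp_le hc x
    have h4 : ((1 / 2 : ℂ) * inner ℂ x z).re = 1 / 2 * (inner ℂ x z).re := by
      simp
    rw [h4]
    nlinarith [norm_nonneg x]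
  · intro x y x' y' h h'
    obtain ⟨z, hz, rfl⟩ := key h
    obtain ⟨z', hz', rfl⟩ := key h'
    rw [inner_add_right, inner_add_left, inner_smul_right, inner_smul_left, hms, hhalf,
      subLaplacian_symmetric x z x' z' hz hz']
  -- A formal adjoint relation for L_c becomes one for L after moving the bounded symmetric c to the
  -- other side, and L is already maximal.
  · intro u w h
    rw [mem_graph_heatOperator]
    refine mem_graph_of_formal_adjoint (lam := 1) subLaplacian_symmetric
      (fun w => range_sub_subLaplacian d one_pos w) fun x z hz => ?_
    have h1 := h _ _ (key' hz)
    rw [inner_add_left, inner_smul_left, hhalf, hms] at h1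
    rw [inner_smul_right, inner_sub_right, ← h1]
    ring

/-- The pairs `(f, L f / 2 + c f)` with `f` a test function. -/
def heatCore (hc : MemLp c ∞ volume) : Set (L2Heis d × L2Heis d) :=
  Set.range fun f : testFunctions d => (testToL2 d f,
    mulOpL hc (testToL2 d f) + (1 / 2 : ℂ) • testToL2 d (subLaplacianTest d f))

theorem heatCore_subset (hc : MemLp c ∞ volume) :
    heatCore hc ⊆ ((heatOperator hc).graph : Set (L2Heis d × L2Heis d)) := by
  rintro _ ⟨f, rfl⟩
  refine (mem_graph_heatOperator hc).2 ?_
  rw [add_sub_cancel_left, smul_smul, mul_one_div_cancel two_ne_zero, one_smul]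
  exact mem_graph_subLaplacian.2 (subset_closure (mem_graph_subLaplacianCore.2 ⟨f, rfl, rfl⟩))

theorem graph_heatOperator_subset_closure (hc : MemLp c ∞ volume) :
    ((heatOperator hc).graph : Set (L2Heis d × L2Heis d)) ⊆ closure (heatCore hc) := by
  rintro ⟨x, y⟩ h
  have h1 := mem_graph_subLaplacian.1 ((mem_graph_heatOperator hc).1 h)
  have h2 := map_mem_closure (f := fun p : L2Heis d × L2Heis d =>
    (p.1, mulOpL hc p.1 + (1 / 2 : ℂ) • p.2)) (t := heatCore hc) (by fun_prop) h1 ?_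
  · convert h2 using 2
    rw [smul_smul]
    norm_num
  · rintro ⟨x, y⟩ hxy
    obtain ⟨f, rfl, rfl⟩ := mem_graph_subLaplacianCore.1 hxy
    exact ⟨f, rfl⟩

theorem extendsGaussAverage_add (hc : MemLp c ∞ volume) {τ : ℝ≥0} {G : L2Heis d →L[ℂ] L2Heis d}
    (hG : ∀ ψ : 𝓢(Heisenberg d, ℂ), G (ψ.toLp 2 volume) =ᵐ[volume] heatAverage τ ψ) :
    ExtendsGaussAverage c τ (G + ((τ : ℝ) : ℂ) • mulOpL hc) := by
  intro ψ
  filter_upwards [Lp.coeFn_add (G (ψ.toLp 2 volume)) (((τ : ℝ) : ℂ) • mulOpL hc (ψ.toLp 2 volume)),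
    hG ψ, Lp.coeFn_smul ((τ : ℝ) : ℂ) (mulOpL hc (ψ.toLp 2 volume)),
    coeFn_mulOp hc (ψ.toLp 2 volume), ψ.coeFn_toLp 2 volume] with p h1 h2 h3 h4 h5
  change (G (ψ.toLp 2 volume) + ((τ : ℝ) : ℂ) • mulOpL hc (ψ.toLp 2 volume) : L2Heis d) p = _
  rw [h1, Pi.add_apply, h2, h3, Pi.smul_apply, mulOpL_apply, h4, h5, gaussAverage_eq, smul_eq_mul,
    mul_assoc]

theorem ExtendsGaussAverage.unique {τ : ℝ≥0} {T T' : L2Heis d →L[ℂ] L2Heis d}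
    (h : ExtendsGaussAverage c τ T) (h' : ExtendsGaussAverage c τ T') : T = T' :=
  DFunLike.coe_injective ((denseRange_schwartz_toLp d).equalizer T.continuous T'.continuous
    (funext fun ψ => Lp.ext ((h ψ).trans (h' ψ).symm)))

theorem extendsGaussAverage_zero : ExtendsGaussAverage c 0 (1 : L2Heis d →L[ℂ] L2Heis d) := by
  intro ψ
  filter_upwards [ψ.coeFn_toLp 2 volume] with p hp
  change ψ.toLp 2 volume p = _
  simp [hp, gaussAverage]

/-- The term in c cancels exactly. The Gaussian part contributes an error of at most τ⁻¹(Cτ³)^{1/2}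
= √(Cτ). -/
theorem tendsto_difference_quotient_test (hc : MemLp c ∞ volume)
    {G : ℝ≥0 → L2Heis d →L[ℂ] L2Heis d}
    (hG : ∀ τ, ∀ ψ : 𝓢(Heisenberg d, ℂ), G τ (ψ.toLp 2 volume) =ᵐ[volume] heatAverage τ ψ)
    (f : testFunctions d) :
    Tendsto (fun τ : ℝ≥0 => (((τ : ℝ) : ℂ)⁻¹) •
      ((G τ + ((τ : ℝ) : ℂ) • mulOpL hc) (testToL2 d f) - testToL2 d f)) (𝓝[>] 0)
      (𝓝 (mulOpL hc (testToL2 d f) + (1 / 2 : ℂ) • testToL2 d (subLaplacianTest d f))) := by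
  obtain ⟨C, hC0, hC⟩ := exists_norm_heat_sub_le f
  rw [tendsto_iff_norm_sub_tendsto_zero]
  have hlim : Tendsto (fun τ : ℝ≥0 => √(C * (τ : ℝ))) (𝓝[>] 0) (𝓝 0) := by
    have : Continuous fun τ : ℝ≥0 => √(C * (τ : ℝ)) := by fun_prop
    simpa using (this.tendsto 0).mono_left nhdsWithin_le_nhds
  have h1 : ∀ᶠ τ : ℝ≥0 in 𝓝[>] 0, τ ≤ 1 :=
    nhdsWithin_le_nhds (Iic_mem_nhds one_pos)
  refine squeeze_zero' (Eventually.of_forall fun _ => norm_nonneg _) ?_ hlim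
  filter_upwards [h1, self_mem_nhdsWithin] with τ hτ1 hτ
  have hτ0 : 0 < (τ : ℝ) := NNReal.coe_pos.2 hτ
  have hτ' : ((τ : ℝ) : ℂ) ≠ 0 := Complex.ofReal_ne_zero.2 hτ0.ne'
  have h2 := hC τ hτ1 (G τ) (hG τ)
  set x := testToL2 d f
  set y := testToL2 d (subLaplacianTest d f)
  have h3 : (((τ : ℝ) : ℂ)⁻¹) • ((G τ + ((τ : ℝ) : ℂ) • mulOpL hc) x - x) -
      (mulOpL hc x + (1 / 2 : ℂ) • y) =
      (((τ : ℝ) : ℂ)⁻¹) • (G τ x - x - (((τ : ℝ) : ℂ) / 2) • y) := by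
    rw [add_apply, smul_apply]
    match_scalars <;> field_simp
    ring
  rw [h3, norm_smul, norm_inv, Complex.norm_real, Real.norm_of_nonneg hτ0.le]
  refine Real.le_sqrt_of_sq_le ?_
  rw [mul_pow, inv_pow, inv_mul_le_iff₀ (by positivity)]
  exact h2.trans_eq (by ring)

theorem isChernoffEquivalent_heatOperator (hc : MemLp c ∞ volume)
    {S V : ℝ≥0 → L2Heis d →L[ℂ] L2Heis d} (hS : ∀ τ, ExtendsGaussAverage c τ (S τ))
    (hV : IsC0Semigroup V) (hA : IsGenerator (heatOperator hc) V) : IsChernoffEquivalent S V := by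
  choose G hG1 hG using exists_heat_contraction d
  have hSG : ∀ τ, S τ = G τ + ((τ : ℝ) : ℂ) • mulOpL hc := fun τ =>
    (hS τ).unique (extendsGaussAverage_add hc (hG τ))
  obtain ⟨R, -, hR, hRd, hd, -, -⟩ := exists_semigroup_heatOperator hc
  have hκ : 0 ≤ (eLpNorm c ∞ volume).toReal := ENNReal.toReal_nonneg
  have hM : ‖mulOpL hc‖ ≤ (eLpNorm c ∞ volume).toReal :=
    LinearMap.mkContinuous_norm_le _ hκ _
  refine isChernoffEquivalent_of_core hV hA hκ (lt_add_one _) hR hRd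
    ((hS 0).unique extendsGaussAverage_zero) (fun τ => ?_) (heatCore_subset hc) ?_ ?_
  · rw [hSG]
    refine (norm_add_le _ _).trans (add_le_add (hG1 τ) ?_)
    rw [norm_smul, Complex.norm_real, Real.norm_of_nonneg τ.coe_nonneg, mul_comm]
    gcongr
  · rintro _ ⟨f, rfl⟩
    simp only [hSG]
    exact tendsto_difference_quotient_test hc hG f
  -- The image of the full graph under λ - L_c is dense, and that graph lies in the closure of its
  -- restriction to test functions.
  · refine (hd.mono (?_ : _ ⊆ closure _)).of_closure
    rintro _ ⟨p, hp, rfl⟩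
    exact map_mem_closure (f := fun p : L2Heis d × L2Heis d =>
      (((eLpNorm c ∞ volume).toReal + 1 : ℝ) : ℂ) • p.1 - p.2) (by fun_prop)
      (graph_heatOperator_subset_closure hc hp) fun q hq => Set.mem_image_of_mem _ hq

/-- This gives uniqueness of the semigroup with a prescribed generator, once every such semigroup is
known to be the limit of the same iterates. -/
theorem IsChernoffEquivalent.unique {B : Type*} [NormedAddCommGroup B] [NormedSpace ℂ B]
    {S V W : ℝ≥0 → B →L[ℂ] B} (hV : IsChernoffEquivalent S V) (hW : IsChernoffEquivalent S W) :
    V = W := by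
  funext t
  refine ContinuousLinearMap.ext fun x => ?_
  have ht : t ∈ Set.Icc 0 (t + 1) := ⟨zero_le, le_self_add⟩
  exact tendsto_nhds_unique ((hV x (t + 1) (by positivity)).tendsto_at ht)
    ((hW x (t + 1) (by positivity)).tendsto_at ht)

theorem mainTheorem1 (d : ℕ) (c : Heisenberg d → ℝ) (hc : MemLp c ∞ volume) :
    IsSelfAdjoint (subLaplacian d) ∧
    (∀ τ : ℝ≥0, ∃! T : L2Heis d →L[ℂ] L2Heis d, ExtendsGaussAverage c τ T) ∧
    (∃! V : ℝ≥0 → L2Heis d →L[ℂ] L2Heis d, IsC0Semigroup V ∧ IsGenerator (heatOperator hc) V) ∧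
    ∀ S V : ℝ≥0 → L2Heis d →L[ℂ] L2Heis d,
      (∀ τ : ℝ≥0, ExtendsGaussAverage c τ (S τ)) →
      IsC0Semigroup V → IsGenerator (heatOperator hc) V →
      IsChernoffEquivalent S V := by
  choose G _ hG using exists_heat_contraction d
  have hS : ∀ τ, ExtendsGaussAverage c τ (G τ + ((τ : ℝ) : ℂ) • mulOpL hc) := fun τ =>
    extendsGaussAverage_add hc (hG τ)
  obtain ⟨_, V, _, _, _, hV⟩ := exists_semigroup_heatOperator hc
  exact ⟨isSelfAdjoint_subLaplacian d, fun τ => ⟨_, hS τ, fun T hT => hT.unique (hS τ)⟩,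
    ⟨V, hV, fun W hW => (isChernoffEquivalent_heatOperator hc hS hW.1 hW.2).unique
      (isChernoffEquivalent_heatOperator hc hS hV.1 hV.2)⟩,
    fun S V hS hV hA => isChernoffEquivalent_heatOperator hc hS hV hA⟩
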